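/- **Open-book polyhedra.** Let $n\ge 2$ be an integer and $0<\theta\le\pi$. Put $\theta_n=\theta/(2n-1)$, $\eta=\theta\theta_n/(4\pi)$, $r_1=\cos(\theta_n/2+\eta)/\cos(\theta_n/2)$, $r_2=\sin\eta/\sin(\theta_n/2)$, and write $c(r,\alpha,h)=(r\cos\alpha,r\sin\alpha,h)\in\mathbb R^3$. For $j=1,\dots,n$ let $\mathbf y^{3j-2}=\mathbf 0$, $\mathbf y^{3j-1}=c(1,(2j-2)\theta_n,0)$, $\mathbf y^{3j}=c(1,(2j-1)\theta_n,0)$. Let $\mathbf z^1=(0,0,-1)$, $\mathbf z^2=c(r_1,0,-1)$, $\mathbf z^{3n}=c(r_1,\theta,-1)$, $\mathbf z^{3j-2}=c(r_2,(2j-\tfrac52)\theta_n,-1)$ and $\mathbf z^{3j-1}=c(1,(2j-2)\theta_n-\eta,-1)$ for $2\le j\le n$, and $\mathbf z^{3j}=c(1,(2j-1)\theta_n+\eta,-1)$ for $1\le j\le n-1$. With $\mathbf y^{3n+1}=\mathbf y^1$ and $\mathbf z^{3n+1}=\mathbf z^1$, let $\Gamma_m$ be the convex hull of $\mathbf y^m,\mathbf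 y^{m+1},\mathbf z^m,\mathbf z^{m+1}$ for $m=1,\dots,3n$ (a plane quadrilateral). Let $\Gamma_0$ be the union of the triangles $\mathbf y^{3j-2}\mathbf y^{3j-1}\mathbf y^{3j}$, $j=1,\dots,n$, and $\Gamma_{-1}$ the plane polygon with consecutive vertices $\mathbf z^1,\dots,\mathbf z^{3n}$. Let $\Gamma=\Gamma_{\theta,n}=\bigcup_{m=-1}^{3n}\Gamma_m$, a closed surface, and let $\Omega_{\theta,n}$ be the region it encloses, the union of the bounded components of $\mathbb R^3\setminus\Gamma$ (the open-book polyhedron with $n$ pages and opening angle $\theta$). **Operators.** Let $\mathbf n$ be the unit normal on $\Gamma$ pointing out of $\Omega_{\theta,n}$ and $ds$ surface measure. On the complex Hilbert space $L^2(\Gamma)$, the double-layer operator $D$ and the adjoint double-layer operator $D'$ are given, for almost all $\mathbf x\in\Gamma$, by $$D\phi(\mathbf x)=\frac1{4\pi}\int_\Gamma\frac{(\mathbf x-\mathbf y)\cdot\mathbf n(\mathbf y)}{|\mathbf x-\mathbf y|^3}\phi(\mathbf y)\,ds(\mathbf y),\qquad D'\phi(\mathbf x)=\frac1{4\pi}\int_\Gamma\frac{(\mathbf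 y-\mathbf x)\cdot\mathbf n(\mathbf x)}{|\mathbf x-\mathbf y|^3}\phi(\mathbf y)\,ds(\mathbf y).$$ **Notions.** Let $A$ be a bounded linear operator on a Hilbert space $\mathcal H$. Its numerical range is $W(A)=\{(A\psi,\psi):\|\psi\|=1\}$, its essential numerical range is $W_{\mathrm{ess}}(A)=\bigcap_{K\text{ compact}}\overline{W(A+K)}$, its essential numerical radius is $w_{\mathrm{ess}}(A)=\sup_{z\in W_{\mathrm{ess}}(A)}|z|$, and its essential norm is $\|A\|_{\mathrm{ess}}=\inf_{K\text{ compact}}\|A-K\|$. $A$ is coercive if, for some $\alpha>0$, $|(A\phi,\phi)|\ge\alpha\|\phi\|^2$ for all $\phi$. A sequence $(\mathcal H_N)$ of finite-dimensional subspaces is asymptotically dense if $\inf_{\phi_N\in\mathcal H_N}\|\psi-\phi_N\|\to0$ for every $\psi\in\mathcal H$. The Galerkin method for $A$ and $(\mathcal H_N)$ converges if, for some $N_0$, for all $N\ge N_0$ and all $g\in\mathcal H$ there is exactly one $\phi_N\in\mathcal H_N$ with $(A\phi_N,\psi_N)=(g,\psi_N)$ for all $\psi_N\in\mathcal H_N$,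 and if, for every $g\in\mathcal H$, $\phi_N$ tends as $N\to\infty$ to a solution $\phi$ of $A\phi=g$. **Theorem 1.3.** Let $n\ge2$. For every $\theta\in(0,\pi]$ the integrals above converge absolutely for every $\phi\in L^2(\Gamma_{\theta,n})$ and almost all $\mathbf x\in\Gamma_{\theta,n}$, and define bounded operators $D$ and $D'$ on $L^2(\Gamma_{\theta,n})$. For every $\epsilon>0$ there is $\theta_0\in(0,\pi]$ such that, for $0<\theta\le\theta_0$, $$\operatorname{conv}\Big(\big[-\tfrac{\sqrt n}2+\epsilon,\tfrac{\sqrt n}2-\epsilon\big]\cup\big\{\lambda\in\mathbb C:|\lambda|\le\tfrac{\sqrt{n-1}}2-\epsilon\big\}\Big)\subset W_{\mathrm{ess}}(D)\quad\text{and}\quad\|D\|_{\mathrm{ess}}\ge w_{\mathrm{ess}}(D)\ge\tfrac{\sqrt n}2-\epsilon.$$ Moreover, there is $\theta_1\in(0,\pi]$ such that, for $0<\theta\le\theta_1$ and each $T\in\{D,-D,D',-D'\}$, the operator $\frac12I+T$ is not the sum of a coercive and a compact operator and, for every compact operator $K$ on $L^2(\Gamma_{\theta,n})$, there is an asymptotically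 dense sequence of finite-dimensional subspaces of $L^2(\Gamma_{\theta,n})$ for which the Galerkin method for $A=\frac12I+T+K$ does not converge. -/

import Mathlib

open MeasureTheory Filter Topology Set

noncomputable section

/-! ## Numerical range, essential norm, coercivity and the Galerkin method in a Hilbert space -/

namespace Hilb

variable {H : Type*} [NormedAddCommGroup H] [InnerProductSpace ℂ H]

/-- `W(A) = {(Aψ, ψ) : ‖ψ‖ = 1}`. (Mathlib's inner product is linear in its second slot, so that
`(u, v)`, linear in `u`, is `inner ℂ v u`.) -/
def numericalRange (A : H →L[ℂ] H) : Set ℂ :=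
  {z | ∃ ψ : H, ‖ψ‖ = 1 ∧ z = inner ℂ ψ (A ψ)}

/-- `W_ess(A)`: the intersection over all compact `K` of the closure of `W(A + K)`. -/
def essNumericalRange (A : H →L[ℂ] H) : Set ℂ :=
  {z | ∀ K : H →L[ℂ] H, IsCompactOperator K → z ∈ closure (numericalRange (A + K))}

/-- `w_ess(A)`, the supremum of `|z|` over `z ∈ W_ess(A)`. -/
def essNumericalRadius (A : H →L[ℂ] H) : ℝ :=
  sSup {r | ∃ z ∈ essNumericalRange A, r = ‖z‖}

/-- `‖A‖_ess`, the infimum of `‖A - K‖` over all compact `K`. -/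
def essNorm (A : H →L[ℂ] H) : ℝ :=
  sInf {r | ∃ K : H →L[ℂ] H, IsCompactOperator K ∧ r = ‖A - K‖}

/-- `|(Aφ, φ)| ≥ α ‖φ‖²` for some `α > 0` and all `φ`. -/
def Coercive (A : H →L[ℂ] H) : Prop :=
  ∃ α : ℝ, 0 < α ∧ ∀ φ : H, α * ‖φ‖ ^ 2 ≤ ‖(inner ℂ φ (A φ) : ℂ)‖

/-- `A` is the sum of a coercive and a compact operator. -/
def CoercivePlusCompact (A : H →L[ℂ] H) : Prop :=
  ∃ A₀ K : H →L[ℂ] H, Coercive A₀ ∧ IsCompactOperator K ∧ A = A₀ + K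

/-- A sequence of finite-dimensional subspaces `V N` with `dist(ψ, V N) → 0` for every `ψ`. -/
def AsymptoticallyDense (V : ℕ → Submodule ℂ H) : Prop :=
  (∀ N, FiniteDimensional ℂ (V N)) ∧
    ∀ ψ : H, Tendsto (fun N => Metric.infDist ψ (V N : Set H)) atTop (𝓝 0)

/-- `φ ∈ V` solves the Galerkin equations `(Aφ, ψ) = (g, ψ)` for all `ψ ∈ V`. -/
def IsGalerkinSolution (A : H →L[ℂ] H) (V : Submodule ℂ H) (g φ : H) : Prop :=
  φ ∈ V ∧ ∀ ψ ∈ V, (inner ℂ ψ (A φ) : ℂ) = inner ℂ ψ g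

/-- The Galerkin method for `A` converges for the sequence `V`: from some `N₀` on the Galerkin
equations are uniquely solvable for every right-hand side `g`, and for every `g` the Galerkin
solutions converge to a solution `φ` of `Aφ = g`. -/
def GalerkinConverges (A : H →L[ℂ] H) (V : ℕ → Submodule ℂ H) : Prop :=
  ∃ N₀ : ℕ, (∀ N ≥ N₀, ∀ g : H, ∃! φ : H, IsGalerkinSolution A (V N) g φ) ∧
    ∀ g : H, ∃ φ : H, A φ = g ∧
      ∀ u : ℕ → H, (∀ N ≥ N₀, IsGalerkinSolution A (V N) g (u N)) → Tendsto u atTop (𝓝 φ)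

end Hilb

/-! ## The open-book polyhedra -/

namespace OpenBook

/-- Euclidean space `ℝ³`. -/
abbrev E3 : Type := EuclideanSpace ℝ (Fin 3)

/-- The angle `θ_n = θ / (2n - 1)` of one page. -/
def pageAngle (n : ℕ) (θ : ℝ) : ℝ := θ / (2 * (n : ℝ) - 1)

/-- `η = θ θ_n / (4π)`. -/
def eta (n : ℕ) (θ : ℝ) : ℝ := θ * pageAngle n θ / (4 * Real.pi)

/-- `r₁ = cos(θ_n/2 + η) / cos(θ_n/2)`. -/
def r₁ (n : ℕ) (θ : ℝ) : ℝ :=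
  Real.cos (pageAngle n θ / 2 + eta n θ) / Real.cos (pageAngle n θ / 2)

/-- `r₂ = sin η / sin(θ_n/2)`. -/
def r₂ (n : ℕ) (θ : ℝ) : ℝ := Real.sin (eta n θ) / Real.sin (pageAngle n θ / 2)

/-- The point with cylindrical coordinates `(r, α, h)`. -/
def cyl (r α h : ℝ) : E3 := !₂[r * Real.cos α, r * Real.sin α, h]

/- The vertices `y^m`, `z^m`, `m = 1, …, 3n`, listed page by page, `j = 1, …, n` being the number
of the page: `yA j = y^{3j-2}`, `yB j = y^{3j-1}`, `yC j = y^{3j}`, and likewise for `z`. -/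

/-- `y^{3j-2} = 0`. -/
def yA : E3 := 0

/-- `y^{3j-1}`. -/
def yB (n : ℕ) (θ : ℝ) (j : ℕ) : E3 := cyl 1 ((2 * (j : ℝ) - 2) * pageAngle n θ) 0

/-- `y^{3j}`. -/
def yC (n : ℕ) (θ : ℝ) (j : ℕ) : E3 := cyl 1 ((2 * (j : ℝ) - 1) * pageAngle n θ) 0

/-- `z^{3j-2}`. -/
def zA (n : ℕ) (θ : ℝ) (j : ℕ) : E3 :=
  if j = 1 then cyl 0 0 (-1) else cyl (r₂ n θ) ((2 * (j : ℝ) - 5 / 2) * pageAngle n θ) (-1)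

/-- `z^{3j-1}`. -/
def zB (n : ℕ) (θ : ℝ) (j : ℕ) : E3 :=
  if j = 1 then cyl (r₁ n θ) 0 (-1) else cyl 1 ((2 * (j : ℝ) - 2) * pageAngle n θ - eta n θ) (-1)

/-- `z^{3j}`. -/
def zC (n : ℕ) (θ : ℝ) (j : ℕ) : E3 :=
  if j = n then cyl (r₁ n θ) θ (-1) else cyl 1 ((2 * (j : ℝ) - 1) * pageAngle n θ + eta n θ) (-1)

/-- The page after page `j`, page `1` following page `n`. -/
def next (n j : ℕ) : ℕ := if j = n then 1 else j + 1

/-- The front of page `j`. -/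
def frontFace (n : ℕ) (θ : ℝ) (j : ℕ) : Set E3 :=
  convexHull ℝ {yA, yB n θ j, zA n θ j, zB n θ j}

/-- The end of page `j`. -/
def endFace (n : ℕ) (θ : ℝ) (j : ℕ) : Set E3 :=
  convexHull ℝ {yB n θ j, yC n θ j, zB n θ j, zC n θ j}

/-- The back of page `j`, whose further vertices are the first vertices of the next page. -/
def backFace (n : ℕ) (θ : ℝ) (j : ℕ) : Set E3 :=
  convexHull ℝ {yC n θ j, yA, zC n θ j, zA n θ (next n j)}

/-- The part of the top face that belongs to page `j`, a triangle. -/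
def topFace (n : ℕ) (θ : ℝ) (j : ℕ) : Set E3 :=
  convexHull ℝ {yA, yB n θ j, yC n θ j}

/-- The polygon with the consecutive vertices `z^1, z^2, …, z^{3n}` is the union of the triangles
`z^1 z^m z^{m+1}`, since the polar angles of `z^2, …, z^{3n}` about `z^1` increase from `0` to
`θ ≤ π`. These are the triangles with `m = 3j-2, 3j-1, 3j` (for `m = 1` and `m = 3n`, where
`z^{3n+1}` is `z^1`, they degenerate to edges of the polygon). -/
def bottomFace (n : ℕ) (θ : ℝ) (j : ℕ) : Set E3 :=
  convexHull ℝ {zA n θ 1, zA n θ j, zB n θ j} ∪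
    convexHull ℝ {zA n θ 1, zB n θ j, zC n θ j} ∪
    convexHull ℝ {zA n θ 1, zC n θ j, zA n θ (next n j)}

/-- The closed surface `Γ_{θ,n}`. -/
def surface (n : ℕ) (θ : ℝ) : Set E3 :=
  ⋃ j ∈ Finset.Icc 1 n,
    frontFace n θ j ∪ endFace n θ j ∪ backFace n θ j ∪ topFace n θ j ∪ bottomFace n θ j

/-- The open-book polyhedron `Ω_{θ,n}`: the interior of the closed surface `Γ_{θ,n}`, that is, the
union of the bounded connected components of its complement. -/
def polyhedron (n : ℕ) (θ : ℝ) : Set E3 :=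
  {x | x ∈ (surface n θ)ᶜ ∧ Bornology.IsBounded (connectedComponentIn (surface n θ)ᶜ x)}

/-- `ν` is the outward-pointing unit normal of `Ω` at `y`: near `y`, up to cones of arbitrarily
small opening about the tangent plane, `Ω` is the half-space `(x - y) · ν < 0`. -/
def IsOutwardUnitNormal (Ω : Set E3) (y ν : E3) : Prop :=
  ‖ν‖ = 1 ∧ ∀ ε : ℝ, 0 < ε → ∀ᶠ x in 𝓝 y,
    (inner ℝ (x - y) ν < -(ε * ‖x - y‖) → x ∈ Ω) ∧ (ε * ‖x - y‖ < inner ℝ (x - y) ν → x ∉ Ω)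

open Classical in
/-- The outward-pointing unit normal of `Ω` at `y` (`0` where there is none). -/
def outwardNormal (Ω : Set E3) (y : E3) : E3 :=
  if h : ∃ ν, IsOutwardUnitNormal Ω y ν then h.choose else 0

/-- The surface measure of `Γ_{θ,n}`: two-dimensional Hausdorff measure, normalised so as to agree
with area on planes. -/
def surfaceMeasure (n : ℕ) (θ : ℝ) : Measure E3 := (μHE[2] : Measure E3).restrict (surface n θ)

/-- The complex Hilbert space `L²(Γ_{θ,n})`. -/
abbrev L2 (n : ℕ) (θ : ℝ) : Type := Lp ℂ 2 (surfaceMeasure n θ)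

/-- The kernel `∂Φ(x, y)/∂n(y) = (x - y) · n(y) / (4π |x - y|³)` of the double-layer operator on
the boundary of `Ω`, where `Φ(x, y) = 1 / (4π |x - y|)`. -/
def dlKernel (Ω : Set E3) (x y : E3) : ℝ :=
  inner ℝ (x - y) (outwardNormal Ω y) / (4 * Real.pi * ‖x - y‖ ^ 3)

/-- `D` is the double-layer operator on `L²(Γ_{θ,n})`:
`Dφ(x) = ∫_Γ ∂Φ(x, y)/∂n(y) φ(y) ds(y)` for almost all `x`, the integral converging absolutely. -/
def IsDoubleLayer (n : ℕ) (θ : ℝ) (D : L2 n θ →L[ℂ] L2 n θ) : Prop :=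
  ∀ φ : L2 n θ, ∀ᵐ x ∂surfaceMeasure n θ,
    Integrable (fun y => dlKernel (polyhedron n θ) x y • φ y) (surfaceMeasure n θ) ∧
      D φ x = ∫ y, dlKernel (polyhedron n θ) x y • φ y ∂surfaceMeasure n θ

/-- `D'` is the adjoint double-layer operator on `L²(Γ_{θ,n})`:
`D'φ(x) = ∫_Γ ∂Φ(x, y)/∂n(x) φ(y) ds(y)` for almost all `x`, the integral converging absolutely.
Its kernel is that of the double-layer operator with `x` and `y` exchanged. -/
def IsAdjointDoubleLayer (n : ℕ) (θ : ℝ) (D' : L2 n θ →L[ℂ] L2 n θ) : Prop :=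
  ∀ φ : L2 n θ, ∀ᵐ x ∂surfaceMeasure n θ,
    Integrable (fun y => dlKernel (polyhedron n θ) y x • φ y) (surfaceMeasure n θ) ∧
      D' φ x = ∫ y, dlKernel (polyhedron n θ) y x • φ y ∂surfaceMeasure n θ

end OpenBook

end

/-! Everything is extracted from the corner `0`, where the fronts and the backs of the `n` pages,
`2n` faces in all, meet. The kernel of `D` is homogeneous of degree `-2` and these faces lie in
planes through `0`. Hence the matrix of `D` on the normalised indicators of the squares `δ • (1,
2)²`, one in each face, does not depend on `δ`. Letting `δ` run through a geometric sequence gives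
an orthonormal system, so every value of the quadratic form of this `2n × 2n` matrix on unit vectors
is a value of `(D e, e)` along unit vectors `e` tending weakly to zero
(`TestFaces.exists_orthonormal`, `sum_mem_weakRange`). Limits of this kind, collected in
`weakRange`, do not change under compact perturbations, lie in the essential numerical range and
form a closed convex set.

As `θ → 0` the `2n` faces collapse onto one half-plane. A point very close to the inside of a square
sees it under a solid angle close to `2π`, so the coupling of two different faces tends to `±1/2`
(`tendsto_faceEntry`). The sign depends on which of the two faces comes first and on the normals,
which alternate between fronts and backs. The limit matrix is therefore half of `alternatingSign`.
On vectors `(s, t, …, t, s)` twice the limit matrix acts by `(s, t) ↦ (-s, t - 2s)`; in orthonormal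
coordinates this has rows `(-1, 0)` and `(-2√(n-1), 1)`. The numerical range of half of it is the
elliptical disc with foci `±1/2` and semi-axes `√n/2` and `√(n-1)/2`, which contains the segment and
the disc of the theorem. Perturbing the finitely many entries costs the `ε`.

Since `√n/2 > 1/2`, for small `θ` both `1/2` and `-1/2` lie in `weakRange D`, and by conjugation in
that of the adjoint, so `0` lies in `weakRange (1/2 + T)`. This excludes coercivity up to compact
operators. It also spoils the Galerkin method: unit vectors `e N` with `(A e N, e N) → 0`, suitably
orthogonal, are adjoined to an exhausting sequence of subspaces (`exists_not_galerkinConverges`).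

Two analytic points remain. That `D` and `D'` are bounded follows from the Schur test for each pair
of plane pieces, with powers of the distances to the two planes as weights (`planarBound`). And the
outward normal on the test squares has to be found from the definition of the region by bounded
components. For this the book is written as a union of convex pages: the component of a point of the
book off the surface cannot leave the book, and a point from which a vertical ray avoids the book is
outside. -/

noncomputable section

/-! ### Limits along weakly null unit vectors, coercivity and the Galerkin method -/

namespace Hilb

variable {H : Type*} [NormedAddCommGroup H] [InnerProductSpace ℂ H]

/-- The values `z` that are limits of `(A e, e)` along unit vectors `e` tending weakly to `0`,
described through weak neighbourhoods of `0`. -/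
def weakRange (A : H →L[ℂ] H) : Set ℂ :=
  {z | ∀ (F : Finset H) (ε : ℝ), 0 < ε → ∃ e : H, ‖e‖ = 1 ∧
    (∀ f ∈ F, ‖(inner ℂ f e : ℂ)‖ < ε) ∧ ‖(inner ℂ e (A e) : ℂ) - z‖ < ε}

/-- Linear combinations and projections produce only almost unit vectors. Rescaling is harmless
because `(A (ce), ce) - z` equals `‖e‖⁻²` times `((A e, e) - z) - z (‖e‖² - 1)` for `c = ‖e‖⁻¹`, and
`‖e‖⁻² ≤ 2`. -/
theorem exists_normalized (A : H →L[ℂ] H) {e : H} {z : ℂ} {δ : ℝ} (hδ : δ ≤ 1 / 2)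
    (h1 : |‖e‖ ^ 2 - 1| ≤ δ) (h2 : ‖(inner ℂ e (A e) : ℂ) - z‖ ≤ δ) :
    ∃ c : ℂ, ‖c • e‖ = 1 ∧ ‖(inner ℂ (c • e) (A (c • e)) : ℂ) - z‖ ≤ 2 * (1 + ‖z‖) * δ ∧
      ∀ f : H, ‖(inner ℂ f (c • e) : ℂ)‖ ≤ 2 * ‖(inner ℂ f e : ℂ)‖ := by
  have h3 := abs_le.1 h1
  have hn0 : 0 ≤ ‖e‖ := norm_nonneg e
  have hn : 1 / 2 ≤ ‖e‖ := by nlinarith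
  have hpos : 0 < ‖e‖ := by linarith
  have hinv : ‖e‖⁻¹ ≤ 2 := by
    rw [inv_le_comm₀ hpos (by norm_num)]; linarith
  have hinv2 : (‖e‖ ^ 2)⁻¹ ≤ 2 := by
    rw [inv_le_comm₀ (by positivity) (by norm_num)]; linarith
  have hc : ‖((‖e‖⁻¹ : ℝ) : ℂ)‖ = ‖e‖⁻¹ := by
    rw [Complex.norm_real, Real.norm_of_nonneg (by positivity)]
  refine ⟨((‖e‖⁻¹ : ℝ) : ℂ), ?_, ?_, ?_⟩
  · rw [norm_smul, hc, inv_mul_cancel₀ hpos.ne']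
  · have hq : (inner ℂ (((‖e‖⁻¹ : ℝ) : ℂ) • e) (A (((‖e‖⁻¹ : ℝ) : ℂ) • e)) : ℂ) - z
        = (((‖e‖ ^ 2)⁻¹ : ℝ) : ℂ) *
          ((inner ℂ e (A e) - z) - z * ((‖e‖ ^ 2 - 1 : ℝ) : ℂ)) := by
      rw [map_smul, inner_smul_left, inner_smul_right, Complex.conj_ofReal]
      have : (‖e‖ : ℂ) ≠ 0 := by exact_mod_cast hpos.ne'
      push_cast
      field_simp
      ring
    rw [hq, norm_mul, Complex.norm_real, Real.norm_of_nonneg (by positivity)]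
    have h4 : ‖(inner ℂ e (A e) - z) - z * ((‖e‖ ^ 2 - 1 : ℝ) : ℂ)‖ ≤ δ + ‖z‖ * δ := by
      refine (norm_sub_le _ _).trans (add_le_add h2 ?_)
      rw [norm_mul, Complex.norm_real, Real.norm_eq_abs]
      gcongr
    calc _ ≤ 2 * (δ + ‖z‖ * δ) := by gcongr
      _ = _ := by ring
  · intro f
    rw [inner_smul_right, norm_mul, hc]
    gcongr

theorem mem_weakRange_of_approx (A : H →L[ℂ] H) {z : ℂ}
    (h : ∀ (F : Finset H) (ε : ℝ), 0 < ε → ∃ e : H, |‖e‖ ^ 2 - 1| < ε ∧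
      (∀ f ∈ F, ‖(inner ℂ f e : ℂ)‖ < ε) ∧ ‖(inner ℂ e (A e) : ℂ) - z‖ < ε) :
    z ∈ weakRange A := by
  intro F ε hε
  have hz := norm_nonneg z
  -- The bound `1/2` is what normalisation requires; the other one absorbs the factor `2 (1 + ‖z‖)`
  -- by which normalisation enlarges errors.
  set δ := min (1 / 2) (ε / (4 * (1 + ‖z‖))) with hδ
  have hδ0 : 0 < δ := lt_min (by norm_num) (by positivity)
  have hδ1 : δ ≤ 1 / 2 := min_le_left _ _
  have hδ2 : 4 * (1 + ‖z‖) * δ ≤ ε := by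
    have := min_le_right (1 / 2) (ε / (4 * (1 + ‖z‖)))
    rw [← hδ, le_div_iff₀ (by positivity)] at this
    linarith
  obtain ⟨e, h1, h2, h3⟩ := h F δ hδ0
  obtain ⟨c, hc1, hc2, hc3⟩ := exists_normalized A hδ1 h1.le h3.le
  refine ⟨c • e, hc1, fun f hf => ?_, ?_⟩
  · have h4 := hc3 f
    have h5 := h2 f hf
    have : 0 ≤ ‖z‖ * δ := by positivity
    nlinarith
  · have : 0 < (1 + ‖z‖) * δ := by positivity
    nlinarith

theorem isClosed_weakRange (A : H →L[ℂ] H) : IsClosed (weakRange A) := by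
  refine isClosed_of_closure_subset fun z hz F ε hε => ?_
  obtain ⟨w, hw, hzw⟩ := Metric.mem_closure_iff.1 hz (ε / 2) (by positivity)
  obtain ⟨e, h1, h2, h3⟩ := hw F (ε / 2) (by positivity)
  refine ⟨e, h1, fun f hf => (h2 f hf).trans (by linarith), ?_⟩
  rw [dist_comm, dist_eq_norm] at hzw
  calc _ = ‖((inner ℂ e (A e) : ℂ) - w) + (w - z)‖ := by ring_nf
    _ ≤ _ := norm_add_le _ _
    _ < ε := by linarith

/-- The image of the unit ball has a finite `ε`-net. If `e` is nearly orthogonal to the points of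
the net, then it is nearly orthogonal to `K e`, which is close to one of them. -/
theorem exists_finset_inner_compact_lt {K : H →L[ℂ] H} (hK : IsCompactOperator K) {ε : ℝ}
    (hε : 0 < ε) : ∃ F : Finset H, ∀ e : H, ‖e‖ = 1 → (∀ f ∈ F, ‖(inner ℂ f e : ℂ)‖ < ε) →
      ‖(inner ℂ e (K e) : ℂ)‖ < 2 * ε := by
  have hc : IsCompact (closure (K '' Metric.closedBall 0 1)) :=
    hK.isCompact_closure_image_closedBall 1
  obtain ⟨t, ht, hcov⟩ := Metric.totallyBounded_iff.1
    (hc.totallyBounded.subset subset_closure) ε hε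
  refine ⟨ht.toFinset, fun e he hF => ?_⟩
  have : K e ∈ ⋃ y ∈ t, Metric.ball y ε := hcov ⟨e, by simp [he], rfl⟩
  simp only [mem_iUnion, Metric.mem_ball, exists_prop] at this
  obtain ⟨y, hy, hd⟩ := this
  rw [dist_eq_norm] at hd
  have h1 := hF y (ht.mem_toFinset.2 hy)
  rw [norm_inner_symm] at h1
  calc ‖(inner ℂ e (K e) : ℂ)‖ = ‖(inner ℂ e y : ℂ) + inner ℂ e (K e - y)‖ := by
        rw [← inner_add_right]; congr 2; abel
    _ ≤ ‖(inner ℂ e y : ℂ)‖ + ‖(inner ℂ e (K e - y) : ℂ)‖ := norm_add_le _ _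
    _ ≤ ‖(inner ℂ e y : ℂ)‖ + ‖e‖ * ‖K e - y‖ := by gcongr; exact norm_inner_le_norm _ _
    _ < 2 * ε := by rw [he]; linarith

theorem weakRange_subset_add_compact (A : H →L[ℂ] H) {K : H →L[ℂ] H} (hK : IsCompactOperator K) :
    weakRange A ⊆ weakRange (A + K) := by
  classical
  intro z hz F ε hε
  obtain ⟨G, hG⟩ := exists_finset_inner_compact_lt hK (ε := ε / 3) (by positivity)
  obtain ⟨e, h1, h2, h3⟩ := hz (F ∪ G) (ε / 3) (by positivity)
  refine ⟨e, h1, fun f hf => (h2 f (Finset.mem_union_left _ hf)).trans (by linarith), ?_⟩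
  have h4 := hG e h1 fun f hf => h2 f (Finset.mem_union_right _ hf)
  calc _ = ‖((inner ℂ e (A e) : ℂ) - z) + inner ℂ e (K e)‖ := by
        rw [add_apply, inner_add_right]; ring_nf
    _ ≤ _ := norm_add_le _ _
    _ < ε := by linarith

theorem weakRange_subset_essNumericalRange (A : H →L[ℂ] H) :
    weakRange A ⊆ essNumericalRange A := by
  intro z hz K hK
  refine Metric.mem_closure_iff.2 fun ε hε => ?_
  obtain ⟨e, h1, -, h3⟩ := weakRange_subset_add_compact A hK hz ∅ ε hε
  exact ⟨_, ⟨e, h1, rfl⟩, by rwa [dist_comm, dist_eq_norm]⟩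

/-- Removing the compact part keeps `0` in the weak range, so the quadratic form of the other
summand is arbitrarily small on unit vectors. -/
theorem not_coercivePlusCompact_of_zero_mem {A : H →L[ℂ] H} (h : (0 : ℂ) ∈ weakRange A) :
    ¬ CoercivePlusCompact A := by
  rintro ⟨A₀, K, ⟨α, hα, hco⟩, hK, rfl⟩
  have hz := weakRange_subset_add_compact (A₀ + K) (K := -K) hK.neg h
  rw [add_neg_cancel_right] at hz
  obtain ⟨e, h1, -, h3⟩ := hz ∅ α hα
  have := hco e
  rw [h1] at this
  simp at h3 this
  linarith

theorem norm_le_of_mem_closure_numericalRange {A : H →L[ℂ] H} {z : ℂ}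
    (hz : z ∈ closure (numericalRange A)) : ‖z‖ ≤ ‖A‖ := by
  have hsub : numericalRange A ⊆ Metric.closedBall 0 ‖A‖ := by
    rintro _ ⟨ψ, hψ, rfl⟩
    rw [mem_closedBall_zero_iff]
    calc _ ≤ ‖ψ‖ * ‖A ψ‖ := norm_inner_le_norm _ _
      _ ≤ ‖ψ‖ * (‖A‖ * ‖ψ‖) := by gcongr; exact A.le_opNorm ψ
      _ = _ := by rw [hψ]; ring
  simpa using closure_minimal hsub Metric.isClosed_closedBall hz

theorem norm_le_essNorm {A : H →L[ℂ] H} {z : ℂ} (hz : z ∈ essNumericalRange A) :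
    ‖z‖ ≤ essNorm A := by
  refine le_csInf ⟨‖A - 0‖, 0, isCompactOperator_zero, rfl⟩ ?_
  rintro _ ⟨K, hK, rfl⟩
  rw [sub_eq_add_neg]
  exact norm_le_of_mem_closure_numericalRange (hz (-K) hK.neg)

theorem essNorm_nonneg (A : H →L[ℂ] H) : 0 ≤ essNorm A :=
  Real.sInf_nonneg (by rintro _ ⟨K, -, rfl⟩; exact norm_nonneg _)

theorem essNumericalRadius_le_essNorm (A : H →L[ℂ] H) : essNumericalRadius A ≤ essNorm A :=
  Real.sSup_le (by rintro _ ⟨z, hz, rfl⟩; exact norm_le_essNorm hz) (essNorm_nonneg A)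

theorem norm_le_essNumericalRadius {A : H →L[ℂ] H} {z : ℂ} (hz : z ∈ essNumericalRange A) :
    ‖z‖ ≤ essNumericalRadius A :=
  le_csSup ⟨essNorm A, by rintro _ ⟨w, hw, rfl⟩; exact norm_le_essNorm hw⟩ ⟨z, hz, rfl⟩

theorem neg_mem_weakRange {A : H →L[ℂ] H} {z : ℂ} (hz : z ∈ weakRange A) :
    -z ∈ weakRange (-A) := by
  intro F ε hε
  obtain ⟨e, h1, h2, h3⟩ := hz F ε hε
  refine ⟨e, h1, h2, ?_⟩
  rw [neg_apply, inner_neg_right, ← neg_sub', norm_neg]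
  exact h3

theorem add_mem_weakRange_smul_id_add {A : H →L[ℂ] H} {z : ℂ} (c : ℂ) (hz : z ∈ weakRange A) :
    c + z ∈ weakRange (c • ContinuousLinearMap.id ℂ H + A) := by
  intro F ε hε
  obtain ⟨e, h1, h2, h3⟩ := hz F ε hε
  refine ⟨e, h1, h2, ?_⟩
  have : (inner ℂ e e : ℂ) = 1 := by rw [inner_self_eq_norm_sq_to_K, h1]; simp
  simp only [add_apply, smul_apply,
    ContinuousLinearMap.id_apply, inner_add_right, inner_smul_right, this]
  rwa [mul_one, add_sub_add_left_eq_sub]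

/-- Testing weak smallness on an orthonormal basis of `U` makes the projection of `e` onto `U` small
in norm; it can be subtracted, and the rest normalised. -/
theorem exists_mem_orthogonal_of_mem_weakRange {A : H →L[ℂ] H} {z : ℂ} (hz : z ∈ weakRange A)
    (U : Submodule ℂ H) [FiniteDimensional ℂ U] {ε : ℝ} (hε : 0 < ε) :
    ∃ e ∈ Uᗮ, ‖e‖ = 1 ∧ ‖(inner ℂ e (A e) : ℂ) - z‖ < ε := by
  classical
  set u := stdOrthonormalBasis ℂ U
  set m := Module.finrank ℂ U
  have hz0 := norm_nonneg z
  have hA0 := norm_nonneg A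
  set δ := min (1 / 2) (ε / (4 * (1 + ‖z‖))) with hδ
  have hδ0 : 0 < δ := lt_min (by norm_num) (by positivity)
  have hδ1 : δ ≤ 1 / 2 := min_le_left _ _
  have hδ2 : 4 * (1 + ‖z‖) * δ ≤ ε := by
    have := min_le_right (1 / 2) (ε / (4 * (1 + ‖z‖)))
    rw [← hδ, le_div_iff₀ (by positivity)] at this
    linarith
  -- The projection has norm at most `m τ` and enters the quadratic form through two terms bounded
  -- by `‖A‖ ‖p‖`; the quadratic form itself is off by `τ`. With this `τ` the total is at most `δ`.
  set τ := δ / ((m + 1) * (4 * ‖A‖ + 2)) with hτ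
  have hτ0 : 0 < τ := by positivity
  have hτ1 : τ * ((m + 1) * (4 * ‖A‖ + 2)) = δ := by rw [hτ]; field_simp
  obtain ⟨e, h1, h2, h3⟩ := hz (Finset.univ.image fun i => (u i : H)) τ hτ0
  set p : H := U.starProjection e with hp
  have hpsum : p = ∑ i, (inner ℂ (u i : H) e : ℂ) • (u i : H) :=
    by rw [hp, Submodule.starProjection_apply, u.orthogonalProjectionOnto_apply_eq_sum]; simp
  have hpn : ‖p‖ ≤ m * τ := by
    rw [hpsum]
    refine (norm_sum_le _ _).trans ?_
    calc _ ≤ ∑ _i : Fin m, τ := Finset.sum_le_sum fun i _ => by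
            have hu : ‖(u i : H)‖ = 1 := u.norm_eq_one i
            rw [norm_smul, hu, mul_one]
            exact (h2 _ (Finset.mem_image_of_mem _ (Finset.mem_univ i))).le
      _ = m * τ := by simp
  have hpn1 : ‖p‖ * (4 * ‖A‖ + 2) ≤ δ - τ * (4 * ‖A‖ + 2) := by
    have : ‖p‖ * (4 * ‖A‖ + 2) ≤ m * τ * (4 * ‖A‖ + 2) := by gcongr
    nlinarith
  have hτA : 0 < τ * (4 * ‖A‖ + 2) := by positivity
  have hp0 := norm_nonneg p
  have hp1 : ‖p‖ * 2 ≤ δ := by nlinarith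
  have hmem : e - p ∈ Uᗮ := U.sub_starProjection_mem_orthogonal e
  have hnorm : ‖e - p‖ ^ 2 = 1 - ‖p‖ ^ 2 := by
    have hpU : p ∈ U := U.starProjection_apply_mem e
    have h5 : ‖e‖ * ‖e‖ = ‖p‖ * ‖p‖ + ‖e - p‖ * ‖e - p‖ := by
      have := norm_add_sq_eq_norm_sq_add_norm_sq_of_inner_eq_zero (𝕜 := ℂ) p (e - p)
        (hmem p hpU)
      rwa [add_sub_cancel] at this
    rw [h1] at h5
    nlinarith
  have hep : ‖e - p‖ ≤ 1 := by nlinarith [norm_nonneg (e - p), sq_nonneg ‖p‖]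
  have hq : ‖(inner ℂ (e - p) (A (e - p)) : ℂ) - z‖ ≤ δ := by
    have h6 : (inner ℂ (e - p) (A (e - p)) : ℂ) - z
        = (inner ℂ e (A e) - z) - (inner ℂ (e - p) (A p) + inner ℂ p (A e)) := by
      simp only [map_sub, inner_sub_left, inner_sub_right]; ring
    have h7 : ‖(inner ℂ (e - p) (A p) : ℂ)‖ ≤ ‖A‖ * ‖p‖ :=
      calc _ ≤ ‖e - p‖ * ‖A p‖ := norm_inner_le_norm _ _
        _ ≤ 1 * (‖A‖ * ‖p‖) := by gcongr; exact A.le_opNorm p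
        _ = _ := one_mul _
    have h8 : ‖(inner ℂ p (A e) : ℂ)‖ ≤ ‖A‖ * ‖p‖ :=
      calc _ ≤ ‖p‖ * ‖A e‖ := norm_inner_le_norm _ _
        _ ≤ ‖p‖ * (‖A‖ * ‖e‖) := by gcongr; exact A.le_opNorm e
        _ = _ := by rw [h1]; ring
    rw [h6]
    calc _ ≤ _ := norm_sub_le _ _
      _ ≤ τ + (‖A‖ * ‖p‖ + ‖A‖ * ‖p‖) :=
        add_le_add h3.le ((norm_add_le _ _).trans (add_le_add h7 h8))
      _ ≤ δ := by nlinarith [mul_nonneg hτ0.le hA0]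
  obtain ⟨c, hc1, hc2, -⟩ := exists_normalized A hδ1 (e := e - p) (z := z)
    (by rw [hnorm, show 1 - ‖p‖ ^ 2 - 1 = -(‖p‖ ^ 2) by ring, abs_neg, abs_of_nonneg (by positivity)]
        nlinarith) hq
  refine ⟨c • (e - p), Submodule.smul_mem _ _ hmem, hc1, hc2.trans_lt ?_⟩
  have : 0 < (1 + ‖z‖) * δ := by positivity
  nlinarith

variable [CompleteSpace H]

theorem conj_mem_weakRange_adjoint {A : H →L[ℂ] H} {z : ℂ} (hz : z ∈ weakRange A) :
    (starRingEnd ℂ) z ∈ weakRange A.adjoint := by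
  intro F ε hε
  obtain ⟨e, h1, h2, h3⟩ := hz F ε hε
  refine ⟨e, h1, h2, ?_⟩
  rw [ContinuousLinearMap.adjoint_inner_right, ← inner_conj_symm, ← map_sub, RCLike.norm_conj]
  exact h3

/-- Take `e` for `z` first, and then `g` for `w` almost orthogonal to `e`, `A e` and `A* e`. All
cross terms of the form at `√a e + √b g` are then small, which leaves `a z + b w`. -/
theorem convex_weakRange (A : H →L[ℂ] H) : Convex ℝ (weakRange A) := by
  classical
  intro z hz w hw a b ha hb hab
  refine mem_weakRange_of_approx A fun F ε hε => ?_
  set δ := ε / 6 with hδ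
  have hδ0 : 0 < δ := by positivity
  obtain ⟨e, e1, e2, e3⟩ := hz F δ hδ0
  obtain ⟨g, g1, g2, g3⟩ := hw (F ∪ {e, A e, A.adjoint e}) δ hδ0
  have ha1 : √a ≤ 1 := Real.sqrt_le_one.2 (by linarith)
  have hb1 : √b ≤ 1 := Real.sqrt_le_one.2 (by linarith)
  have ha0 := Real.sqrt_nonneg a
  have hb0 := Real.sqrt_nonneg b
  have hge : ‖(inner ℂ e g : ℂ)‖ < δ := g2 e (by simp)
  have hgAe : ‖(inner ℂ g (A e) : ℂ)‖ < δ := by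
    rw [norm_inner_symm]; exact g2 (A e) (by simp)
  have heAg : ‖(inner ℂ e (A g) : ℂ)‖ < δ := by
    rw [← ContinuousLinearMap.adjoint_inner_left]; exact g2 (A.adjoint e) (by simp)
  have hna : ‖((√a : ℝ) : ℂ)‖ = √a := by rw [Complex.norm_real, Real.norm_of_nonneg ha0]
  have hnb : ‖((√b : ℝ) : ℂ)‖ = √b := by rw [Complex.norm_real, Real.norm_of_nonneg hb0]
  have haa : ((√a : ℝ) : ℂ) * ((√a : ℝ) : ℂ) = a := by
    rw [← Complex.ofReal_mul, Real.mul_self_sqrt ha]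
  have hbb : ((√b : ℝ) : ℂ) * ((√b : ℝ) : ℂ) = b := by
    rw [← Complex.ofReal_mul, Real.mul_self_sqrt hb]
  have hp1 : √a * √b ≤ 1 := mul_le_one₀ ha1 hb0 hb1
  have hp0 : 0 ≤ √a * √b := by positivity
  refine ⟨((√a : ℝ) : ℂ) • e + ((√b : ℝ) : ℂ) • g, ?_, fun f hf => ?_, ?_⟩
  · have h1 : ‖((√a : ℝ) : ℂ) • e + ((√b : ℝ) : ℂ) • g‖ ^ 2 - 1
        = 2 * (√a * √b * (inner ℂ e g : ℂ).re) := by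
      rw [norm_add_sq (𝕜 := ℂ), norm_smul, norm_smul, hna, hnb, e1, g1, mul_one, mul_one,
        Real.sq_sqrt ha, Real.sq_sqrt hb, inner_smul_left, inner_smul_right, Complex.conj_ofReal,
        ← mul_assoc, ← Complex.ofReal_mul]
      simp only [RCLike.re_eq_complex_re, Complex.re_ofReal_mul]
      linarith
    rw [h1, abs_mul, abs_mul, abs_of_nonneg hp0, abs_two]
    have h2 := (Complex.abs_re_le_norm (inner ℂ e g : ℂ))
    have h3 : √a * √b * |(inner ℂ e g : ℂ).re| ≤ 1 * δ := by gcongr; linarith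
    linarith
  · rw [inner_add_right, inner_smul_right, inner_smul_right]
    have h1 := e2 f hf
    have h2 := g2 f (by simp [hf])
    calc _ ≤ _ := norm_add_le _ _
      _ = √a * ‖(inner ℂ f e : ℂ)‖ + √b * ‖(inner ℂ f g : ℂ)‖ := by
        rw [norm_mul, norm_mul, hna, hnb]
      _ ≤ 1 * δ + 1 * δ := by gcongr
      _ < ε := by linarith
  · have h1 : (inner ℂ (((√a : ℝ) : ℂ) • e + ((√b : ℝ) : ℂ) • g)
          (A (((√a : ℝ) : ℂ) • e + ((√b : ℝ) : ℂ) • g)) : ℂ) - (a • z + b • w)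
        = (a : ℂ) * (inner ℂ e (A e) - z) + (b : ℂ) * (inner ℂ g (A g) - w)
          + (((√a * √b : ℝ) : ℂ) * inner ℂ e (A g) + ((√a * √b : ℝ) : ℂ) * inner ℂ g (A e)) := by
      simp only [map_add, map_smul, inner_add_left, inner_add_right, inner_smul_left,
        inner_smul_right, Complex.conj_ofReal, Complex.real_smul, ← haa, ← hbb]
      push_cast
      ring
    rw [h1]
    have hnab : ‖((√a * √b : ℝ) : ℂ)‖ = √a * √b := by
      rw [Complex.norm_real, Real.norm_of_nonneg hp0]
    calc _ ≤ ‖(a : ℂ) * (inner ℂ e (A e) - z)‖ + ‖(b : ℂ) * (inner ℂ g (A g) - w)‖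
          + (‖((√a * √b : ℝ) : ℂ) * inner ℂ e (A g)‖
            + ‖((√a * √b : ℝ) : ℂ) * inner ℂ g (A e)‖) :=
          (norm_add_le _ _).trans (add_le_add (norm_add_le _ _) (norm_add_le _ _))
      _ = a * ‖(inner ℂ e (A e) : ℂ) - z‖ + b * ‖(inner ℂ g (A g) : ℂ) - w‖
          + (√a * √b * ‖(inner ℂ e (A g) : ℂ)‖ + √a * √b * ‖(inner ℂ g (A e) : ℂ)‖) := by
          simp only [norm_mul, hnab, Complex.norm_real, Real.norm_of_nonneg ha,
            Real.norm_of_nonneg hb]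
      _ ≤ 1 * δ + 1 * δ + (1 * δ + 1 * δ) := by gcongr <;> linarith
      _ < ε := by linarith

/-- Let `U N` be the span of the first `N` terms of a dense sequence and `e N` a unit vector
orthogonal to `U N` and to `A* (U N)` with `|(A e, e)| < 1 / (N + 1)`. On `V N = U N ⊔ span {e N}`
the vector `e N` solves the Galerkin equations with right-hand side `(A e, e) e`, since `A e` is
orthogonal to `U N`. So the Galerkin solution operators have norms exceeding `N`, while convergence
would make them uniformly bounded by Banach–Steinhaus. -/
theorem exists_not_galerkinConverges [TopologicalSpace.SeparableSpace H] {A : H →L[ℂ] H}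
    (h : (0 : ℂ) ∈ weakRange A) :
    ∃ V : ℕ → Submodule ℂ H, AsymptoticallyDense V ∧ ¬ GalerkinConverges A V := by
  set b := TopologicalSpace.denseSeq H
  set U : ℕ → Submodule ℂ H := fun N => Submodule.span ℂ (b '' Iio N) with hU
  have hUfin : ∀ N, FiniteDimensional ℂ (U N) := fun N =>
    FiniteDimensional.span_of_finite ℂ ((finite_Iio N).image b)
  have hex : ∀ N : ℕ, ∃ e ∈ (U N ⊔ (U N).map (A.adjoint : H →ₗ[ℂ] H))ᗮ, ‖e‖ = 1 ∧
      ‖(inner ℂ e (A e) : ℂ) - 0‖ < 1 / ((N : ℝ) + 1) := fun N =>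
    exists_mem_orthogonal_of_mem_weakRange h _ (by positivity)
  choose e he he1 heA using hex
  have hVfin : ∀ N, FiniteDimensional ℂ (U N ⊔ Submodule.span ℂ {e N} : Submodule ℂ H) :=
    fun N => inferInstance
  refine ⟨fun N => U N ⊔ Submodule.span ℂ {e N}, ⟨hVfin, fun ψ => ?_⟩, ?_⟩
  · rw [Metric.tendsto_atTop]
    intro ε hε
    obtain ⟨k, hk⟩ := (TopologicalSpace.denseRange_denseSeq H).exists_dist_lt ψ hε
    refine ⟨k + 1, fun N hN => ?_⟩
    have hmem : b k ∈ ((U N ⊔ Submodule.span ℂ {e N} : Submodule ℂ H) : Set H) :=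
      (le_sup_left : U N ≤ _) (Submodule.subset_span ⟨k, by simp; omega, rfl⟩)
    rw [Real.dist_eq, sub_zero, abs_of_nonneg Metric.infDist_nonneg]
    exact (Metric.infDist_le_dist_of_mem hmem).trans_lt hk
  · rintro ⟨N₀, huniq, hconv⟩
    set V : ℕ → Submodule ℂ H := fun N => U N ⊔ Submodule.span ℂ {e N} with hV
    have hgal : ∀ (N : ℕ) (g : H), ∃ φ, N₀ ≤ N → IsGalerkinSolution A (V N) g φ := by
      intro N g
      by_cases hN : N₀ ≤ N
      · obtain ⟨φ, hφ, -⟩ := huniq N hN g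
        exact ⟨φ, fun _ => hφ⟩
      · exact ⟨0, fun h => absurd h hN⟩
    choose S hS using hgal
    have hSeq : ∀ N, N₀ ≤ N → ∀ g φ, IsGalerkinSolution A (V N) g φ → S N g = φ := by
      intro N hN g φ hφ
      exact (huniq N hN g).unique (hS N g hN) hφ
    -- Uniqueness of the Galerkin solution makes the solution map additive and homogeneous.
    let G : ∀ k : ℕ, H →ₗ[ℂ] H := fun k =>
      { toFun := S (N₀ + k)
        map_add' := fun x y => hSeq _ (by omega) _ _
          ⟨Submodule.add_mem _ (hS _ x (by omega)).1 (hS _ y (by omega)).1, fun ψ hψ => by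
            rw [map_add, inner_add_right, inner_add_right, (hS _ x (by omega)).2 ψ hψ,
              (hS _ y (by omega)).2 ψ hψ]⟩
        map_smul' := fun c x => hSeq _ (by omega) _ _
          ⟨Submodule.smul_mem _ _ (hS _ x (by omega)).1, fun ψ hψ => by
            rw [RingHom.id_apply, map_smul, inner_smul_right, inner_smul_right,
              (hS _ x (by omega)).2 ψ hψ]⟩ }
    have hVfin' : ∀ N, FiniteDimensional ℂ (V N) := hVfin
    -- Only the orthogonal projection of `g` onto the Galerkin space enters the equations, so the
    -- solution map factors through a finite-dimensional space and is continuous.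
    let G' : ℕ → H →L[ℂ] H := fun k =>
      (LinearMap.toContinuousLinearMap ((G k).comp (V (N₀ + k)).subtype)).comp
        (V (N₀ + k)).orthogonalProjectionOnto
    have hG' : ∀ k g, G' k g = S (N₀ + k) g := by
      intro k g
      change S (N₀ + k) ((V (N₀ + k)).orthogonalProjectionOnto g : H) = _
      refine hSeq _ (by omega) _ _ ⟨(hS _ g (by omega)).1, fun ψ hψ => ?_⟩
      rw [(hS _ g (by omega)).2 ψ hψ]
      have := Submodule.sub_starProjection_mem_orthogonal (K := V (N₀ + k)) g ψ hψ
      rw [inner_sub_right, sub_eq_zero] at this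
      exact this
    obtain ⟨C, hC⟩ := banach_steinhaus (g := G') fun g => by
      obtain ⟨φ, -, hφ⟩ := hconv g
      have ht : Tendsto (fun k => G' k g) atTop (𝓝 φ) := by
        have := hφ (fun N => S N g) fun N hN => hS N g hN
        simp only [hG']
        exact (tendsto_add_atTop_iff_nat N₀).2 this |>.congr fun k => by rw [add_comm]
      obtain ⟨C, hC⟩ := (ht.norm.bddAbove_range)
      exact ⟨C, fun k => hC ⟨k, rfl⟩⟩
    obtain ⟨k, hk⟩ := exists_nat_gt C
    set N := N₀ + k with hN
    have hsol : IsGalerkinSolution A (V N) ((inner ℂ (e N) (A (e N)) : ℂ) • e N) (e N) := by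
      refine ⟨(le_sup_right : _ ≤ V N) (Submodule.mem_span_singleton_self _), fun ψ hψ => ?_⟩
      obtain ⟨u, hu, v, hv, rfl⟩ := Submodule.mem_sup.1 hψ
      obtain ⟨c, rfl⟩ := Submodule.mem_span_singleton.1 hv
      have hu1 : (inner ℂ u (A (e N)) : ℂ) = 0 := by
        rw [← ContinuousLinearMap.adjoint_inner_left]
        exact he N _ ((le_sup_right : _ ≤ U N ⊔ _) ⟨u, hu, rfl⟩)
      have hu2 : (inner ℂ u (e N) : ℂ) = 0 := he N _ ((le_sup_left : U N ≤ _) hu)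
      have hee : (inner ℂ (e N) (e N) : ℂ) = 1 := by
        rw [inner_self_eq_norm_sq_to_K, he1]; simp
      simp only [inner_add_left, inner_smul_left, inner_smul_right, hu1, hu2, hee]
      ring
    have h1 : ‖e N‖ ≤ C * ‖(inner ℂ (e N) (A (e N)) : ℂ) • e N‖ := by
      have h2 := hG' k ((inner ℂ (e N) (A (e N)) : ℂ) • e N)
      rw [hSeq N (by omega) _ _ hsol] at h2
      exact (congrArg norm h2).symm.le.trans <| (G' k).le_of_opNorm_le (hC k) ((inner ℂ (e N) (A (e N)) : ℂ) • e N)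
    have h3 := heA N
    rw [sub_zero] at h3
    rw [norm_smul, he1, mul_one] at h1
    have hN1 : (0 : ℝ) < N + 1 := by positivity
    rw [lt_div_iff₀ hN1] at h3
    have hCN : C < N := hk.trans_le (by rw [hN]; push_cast; linarith [Nat.cast_nonneg (α := ℝ) N₀])
    have hw := norm_nonneg (inner ℂ (e N) (A (e N)) : ℂ)
    nlinarith

end Hilb

end

/-! ### The limit matrix and its numerical range -/

noncomputable section

namespace Hilb

/-- `sgn (i - k)` with the sign reversed for even `k`. -/
def alternatingSign (i k : ℕ) : ℝ :=
  if i = k then 0 else if (Even k ↔ k < i) then -1 else 1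

/-- Along a row the signs alternate, starting with `-1`, up to the diagonal entry `0`; after it they
alternate with the opposite phase. The partial sums thus only take the values `0` and `-1`. -/
theorem sum_range_alternatingSign (i m : ℕ) :
    ∑ k ∈ Finset.range m, alternatingSign i k =
      if m ≤ i then (if Even m then 0 else -1) else (if Even m then -1 else 0) := by
  induction m with
  | zero => simp
  | succ m ih =>
    rw [Finset.sum_range_succ, ih, alternatingSign]
    rcases lt_trichotomy m i with h | h | h
    · have h1 : i ≠ m := by omega
      have h2 : m ≤ i := by omega
      have h3 : m + 1 ≤ i := by omega
      by_cases he : Even m <;> simp [h, h1, h2, h3, he, Nat.even_add_one]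
    · subst h
      by_cases he : Even m <;> simp [he, Nat.even_add_one]
    · have h1 : i ≠ m := by omega
      have h2 : ¬ m ≤ i := by omega
      have h3 : ¬ m + 1 ≤ i := by omega
      have h4 : ¬ m < i := by omega
      by_cases he : Even m <;> simp [h1, h2, h3, h4, he, Nat.even_add_one]

/-- The vector of length `2n` with first and last entry `s` and the other entries `t`. -/
def outerInner (n : ℕ) (s t : ℂ) (i : ℕ) : ℂ := if i = 0 ∨ i = 2 * n - 1 then s else t

theorem sum_range_outerInner {n : ℕ} (hn : 1 ≤ n) (f : ℂ → ℂ) (s t : ℂ) :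
    ∑ i ∈ Finset.range (2 * n), f (outerInner n s t i) = 2 * f s + (2 * n - 2) * f t := by
  obtain ⟨m, rfl⟩ : ∃ m, n = m + 1 := ⟨n - 1, by omega⟩
  rw [show 2 * (m + 1) = 2 * m + 1 + 1 by ring, Finset.sum_range_succ, Finset.sum_range_succ']
  have : ∀ i ∈ Finset.range (2 * m), f (outerInner (m + 1) s t (i + 1)) = f t := fun i hi => by
    rw [Finset.mem_range] at hi
    rw [outerInner, if_neg (by omega)]
  rw [Finset.sum_congr rfl this, Finset.sum_const, Finset.card_range, outerInner, outerInner,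
    if_pos (by simp), if_pos (by right; omega), nsmul_eq_mul]
  push_cast
  ring

/-- This says that the vectors `(s, t, …, t, s)` form an invariant plane. Every full row sum is
`-1`, which accounts for the constant vector `t`; the two end entries add `s - t` times the first
and the last entry of the row. -/
theorem sum_range_alternatingSign_mul_outerInner {n : ℕ} (hn : 1 ≤ n) (s t : ℂ) {i : ℕ}
    (hi : i < 2 * n) :
    ∑ k ∈ Finset.range (2 * n), (alternatingSign i k : ℂ) * outerInner n s t k
      = outerInner n (-s) (t - 2 * s) i := by
  have h1 : ∀ k ∈ Finset.range (2 * n), (alternatingSign i k : ℂ) * outerInner n s t k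
      = t * (alternatingSign i k : ℂ) + ((if k = 0 then (s - t) * alternatingSign i k else 0)
        + (if k = 2 * n - 1 then (s - t) * alternatingSign i k else 0)) := fun k _ => by
    rw [outerInner]
    by_cases h0 : k = 0
    · rw [if_pos (Or.inl h0), if_pos h0, if_neg (by omega)]; ring
    · by_cases h2 : k = 2 * n - 1
      · rw [if_pos (Or.inr h2), if_neg h0, if_pos h2]; ring
      · rw [if_neg (by tauto), if_neg h0, if_neg h2]; ring
  rw [Finset.sum_congr rfl h1, Finset.sum_add_distrib, Finset.sum_add_distrib, ← Finset.mul_sum,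
    Finset.sum_ite_eq', Finset.sum_ite_eq', if_pos (by simp; omega), if_pos (by simp; omega),
    ← Complex.ofReal_sum, sum_range_alternatingSign, if_neg (by omega), if_pos (by simp),
    outerInner]
  have hodd : ¬ Even (2 * n - 1) := by rw [Nat.not_even_iff]; omega
  by_cases h0 : i = 0
  · subst h0
    have h3 : ¬ (0 = 2 * n - 1) := by omega
    simp [alternatingSign, h3, hodd]
    ring
  · by_cases h2 : i = 2 * n - 1
    · have h3 : 0 < i := by omega
      rw [if_pos (Or.inr h2)]
      simp [alternatingSign, h0, ← h2, h3]
      ring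
    · rw [if_neg (by tauto)]
      have h3 : 0 < i := by omega
      have h4 : ¬ (2 * n - 1 < i) := by omega
      simp [alternatingSign, h0, h2, h3, h4, hodd]
      ring

/-- With `x = √2 s` and `y = √(2n - 2) t` the right-hand side is `-|x|² + |y|² - 2 √(n-1) ȳ x`. By
the elliptical range theorem, its values at unit vectors fill the ellipse with foci `±1` and
semi-axes `√n` and `√(n-1)`; only a few points of its boundary are used below. -/
theorem sum_alternatingSign_outerInner {n : ℕ} (hn : 1 ≤ n) (s t : ℂ) :
    ∑ i ∈ Finset.range (2 * n), ∑ k ∈ Finset.range (2 * n),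
      (starRingEnd ℂ) (outerInner n s t i) * outerInner n s t k * (alternatingSign i k : ℂ)
      = -2 * ((starRingEnd ℂ) s * s)
        + (2 * n - 2) * ((starRingEnd ℂ) t * t - 2 * ((starRingEnd ℂ) t * s)) := by
  have h1 : ∀ i ∈ Finset.range (2 * n), ∑ k ∈ Finset.range (2 * n),
      (starRingEnd ℂ) (outerInner n s t i) * outerInner n s t k * (alternatingSign i k : ℂ)
      = outerInner n ((starRingEnd ℂ) s * -s) ((starRingEnd ℂ) t * (t - 2 * s)) i := fun i hi => by
    rw [Finset.sum_congr rfl fun k _ => show _ = (starRingEnd ℂ) (outerInner n s t i) *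
      ((alternatingSign i k : ℂ) * outerInner n s t k) by ring, ← Finset.mul_sum,
      sum_range_alternatingSign_mul_outerInner hn s t (Finset.mem_range.1 hi)]
    simp only [outerInner]
    split_ifs <;> rfl
  rw [Finset.sum_congr rfl h1, sum_range_outerInner hn (fun z => z)]
  ring

variable {H : Type*} [NormedAddCommGroup H] [InnerProductSpace ℂ H]

/-- For fixed coefficients the combinations of the `e (i, m)` tend weakly to zero as `m → ∞`, by
Bessel's inequality, while the form takes the same value for every `m`. No hypothesis on entries
with different `m` is needed. -/
theorem sum_mem_weakRange {N : ℕ} {D : H →L[ℂ] H} {e : Fin N × ℕ → H} (he : Orthonormal ℂ e)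
    {a : ℕ → ℕ → ℂ} (ha : ∀ (i k : Fin N) (m : ℕ), inner ℂ (e (i, m)) (D (e (k, m))) = a i k)
    {c : ℕ → ℂ} (hc : ∑ i ∈ Finset.range N, ‖c i‖ ^ 2 = 1) :
    ∑ i ∈ Finset.range N, ∑ k ∈ Finset.range N, (starRingEnd ℂ) (c i) * c k * a i k
      ∈ weakRange D := by
  intro F ε hε
  have htend : ∀ f : H, Tendsto (fun m => ‖(inner ℂ f (∑ i : Fin N, c i • e (i, m)) : ℂ)‖)
      atTop (𝓝 0) := by
    intro f
    rw [← norm_zero (E := ℂ)]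
    refine Tendsto.norm ?_
    simp only [inner_sum, inner_smul_right]
    rw [← Finset.sum_const_zero (s := (Finset.univ : Finset (Fin N)))]
    refine tendsto_finsetSum _ fun i _ => ?_
    rw [← mul_zero (c i)]
    refine Tendsto.const_mul _ ?_
    have h1 := (he.comp (fun m : ℕ => (i, m)) fun x y h => by simpa using h).inner_products_summable
      (x := f)
    have h2 := h1.tendsto_atTop_zero
    rw [tendsto_zero_iff_norm_tendsto_zero]
    have h3 := h2.sqrt
    simp only [Real.sqrt_zero, Function.comp_def] at h3
    refine h3.congr fun m => ?_
    rw [Real.sqrt_sq (norm_nonneg _), norm_inner_symm]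
  have hev : ∀ᶠ m in atTop, ∀ f ∈ F, ‖(inner ℂ f (∑ i : Fin N, c i • e (i, m)) : ℂ)‖ < ε :=
    (Filter.eventually_all_finset F).2 fun f _ => (htend f).eventually (gt_mem_nhds hε)
  obtain ⟨m, hm⟩ := hev.exists
  have hem : Orthonormal ℂ fun i => e (i, m) :=
    he.comp (fun i : Fin N => (i, m)) fun x y h => by simpa using h
  refine ⟨∑ i : Fin N, c i • e (i, m), ?_, hm, ?_⟩
  · have h1 : (inner ℂ (∑ i : Fin N, c i • e (i, m)) (∑ i : Fin N, c i • e (i, m)) : ℂ) = 1 := by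
      rw [hem.inner_sum]
      rw [Finset.sum_range] at hc
      have : ∀ i : Fin N, (starRingEnd ℂ) (c i) * c i = ((‖c i‖ ^ 2 : ℝ) : ℂ) := fun i => by
        rw [mul_comm, Complex.mul_conj, Complex.normSq_eq_norm_sq]
      simp only [this]
      rw [← Complex.ofReal_sum, hc, Complex.ofReal_one]
    rw [inner_self_eq_norm_sq_to_K] at h1
    have h2 : ‖∑ i : Fin N, c i • e (i, m)‖ ^ 2 = 1 :=
      Complex.ofReal_inj.1 (by push_cast; exact h1)
    exact (pow_eq_one_iff_of_nonneg (norm_nonneg _) two_ne_zero).1 h2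
  · have h1 : (inner ℂ (∑ i : Fin N, c i • e (i, m)) (D (∑ i : Fin N, c i • e (i, m))) : ℂ)
        = ∑ i ∈ Finset.range N, ∑ k ∈ Finset.range N, (starRingEnd ℂ) (c i) * c k * a i k := by
      rw [Finset.sum_range, sum_inner]
      refine Finset.sum_congr rfl fun i _ => ?_
      rw [Finset.sum_range, map_sum, inner_sum]
      refine Finset.sum_congr rfl fun k _ => ?_
      rw [map_smul, inner_smul_left, inner_smul_right, ha]
      ring
    rw [h1, sub_self, norm_zero]
    exact hε

/-- All coefficients of the unit vector have modulus at most `1`, so each of the `(2n)²` entries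
contributes an error of at most `ρ`. -/
theorem exists_mem_weakRange_near {n : ℕ} (hn : 1 ≤ n) {D : H →L[ℂ] H} {e : Fin (2 * n) × ℕ → H}
    (he : Orthonormal ℂ e) {a : ℕ → ℕ → ℂ}
    (ha : ∀ (i k : Fin (2 * n)) (m : ℕ), inner ℂ (e (i, m)) (D (e (k, m))) = a i k) {ρ : ℝ}
    (haρ : ∀ i < 2 * n, ∀ k < 2 * n, ‖a i k - alternatingSign i k / 2‖ ≤ ρ)
    {s t : ℂ} (hst : 2 * ‖s‖ ^ 2 + (2 * n - 2) * ‖t‖ ^ 2 = 1) :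
    ∃ z ∈ weakRange D, ‖z - (-2 * ((starRingEnd ℂ) s * s)
        + (2 * n - 2) * ((starRingEnd ℂ) t * t - 2 * ((starRingEnd ℂ) t * s))) / 2‖
      ≤ (2 * n) ^ 2 * ρ := by
  have hc : ∑ i ∈ Finset.range (2 * n), ‖outerInner n s t i‖ ^ 2 = 1 := by
    have h1 := sum_range_outerInner hn (fun z => ((‖z‖ ^ 2 : ℝ) : ℂ)) s t
    rw [← Complex.ofReal_sum] at h1
    have h2 : (((∑ i ∈ Finset.range (2 * n), ‖outerInner n s t i‖ ^ 2 : ℝ)) : ℂ)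
        = ((2 * ‖s‖ ^ 2 + (2 * n - 2) * ‖t‖ ^ 2 : ℝ) : ℂ) := by
      rw [h1]; push_cast; ring
    rw [Complex.ofReal_inj] at h2
    rw [h2, hst]
  have hc1 : ∀ i ∈ Finset.range (2 * n), ‖outerInner n s t i‖ ≤ 1 := fun i hi => by
    have h1 := Finset.single_le_sum (f := fun i => ‖outerInner n s t i‖ ^ 2)
      (fun i _ => by positivity) hi
    rw [hc] at h1
    exact (sq_le_one_iff₀ (norm_nonneg _)).1 h1
  refine ⟨_, sum_mem_weakRange he ha hc, ?_⟩
  rw [← sum_alternatingSign_outerInner hn, Finset.sum_div, ← Finset.sum_sub_distrib]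
  refine (norm_sum_le _ _).trans ?_
  calc _ ≤ ∑ _i ∈ Finset.range (2 * n), ∑ _k ∈ Finset.range (2 * n), ρ := by
        refine Finset.sum_le_sum fun i hi => ?_
        rw [Finset.sum_div, ← Finset.sum_sub_distrib]
        refine (norm_sum_le _ _).trans (Finset.sum_le_sum fun k hk => ?_)
        rw [mul_div_assoc, ← mul_sub, norm_mul, norm_mul, RCLike.norm_conj]
        have h1 := haρ i (Finset.mem_range.1 hi) k (Finset.mem_range.1 hk)
        calc _ ≤ 1 * 1 * ‖a i k - alternatingSign i k / 2‖ := by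
              gcongr
              exacts [hc1 i hi, hc1 k hk]
          _ ≤ ρ := by linarith
    _ = (2 * n) ^ 2 * ρ := by simp; ring

/-- A point outside `S` is strictly separated from it by some `Re (p ·)` with `|p| = 1`. For a point
of the disc the support in direction `p` is a contradiction. For a point of the segment, the end
`±√n/2` on the proper side contradicts this if `|Re p| ≥ 1/2`; otherwise the support for the disc
does, because `|Re (p t)| ≤ |t|/2` is then small enough. -/
theorem convexHull_subset_of_supports {n : ℕ} (hn : 2 ≤ n) {ε τ : ℝ} (hτ : τ ≤ ε / 2)
    {S : Set ℂ} (hS : Convex ℝ S) (hSc : IsClosed S)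
    (h1 : ∀ p : ℂ, ‖p‖ = 1 → ∃ z ∈ S, (p * z).re ≤ -(√((n : ℝ) - 1) / 2) + τ)
    (h2 : ∃ z ∈ S, ‖z - (√(n : ℝ) / 2 : ℝ)‖ ≤ τ) (h3 : ∃ z ∈ S, ‖z - (-(√(n : ℝ) / 2) : ℝ)‖ ≤ τ) :
    convexHull ℝ
      ((fun t : ℝ => (t : ℂ)) '' Set.Icc (-(√(n : ℝ) / 2) + ε) (√(n : ℝ) / 2 - ε) ∪
        {l : ℂ | ‖l‖ ≤ √((n : ℝ) - 1) / 2 - ε}) ⊆ S := by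
  have hn' : (2 : ℝ) ≤ n := by exact_mod_cast hn
  refine convexHull_min (fun z hz => ?_) hS
  by_contra hzS
  obtain ⟨f, u, hfz, hfS⟩ := geometric_hahn_banach_point_closed hS hSc hzS
  set p₀ : ℂ := ⟨f 1, -f Complex.I⟩ with hp₀
  have hf : ∀ w, f w = (p₀ * w).re := fun w => by
    have : w = w.re • (1 : ℂ) + w.im • Complex.I := by
      apply Complex.ext <;> simp
    conv_lhs => rw [this]
    rw [map_add, map_smul, map_smul, Complex.mul_re, hp₀]
    simp only [smul_eq_mul]
    ring
  have hlt : ∀ w ∈ S, f z < f w := fun w hw => hfz.trans (hfS w hw)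
  have hp0 : p₀ ≠ 0 := by
    rintro h
    obtain ⟨w, hw, -⟩ := h2
    have := hlt w hw
    rw [hf, hf, h] at this
    simp at this
  have hpn : 0 < ‖p₀‖ := norm_pos_iff.2 hp0
  set p : ℂ := ((‖p₀‖⁻¹ : ℝ) : ℂ) * p₀ with hp
  have hp1 : ‖p‖ = 1 := by
    rw [hp, norm_mul, Complex.norm_real, norm_inv, norm_norm, inv_mul_cancel₀ hpn.ne']
  have hlt' : ∀ w ∈ S, (p * z).re < (p * w).re := fun w hw => by
    have := hlt w hw
    rw [hf, hf] at this
    rw [hp, mul_assoc, mul_assoc, Complex.re_ofReal_mul, Complex.re_ofReal_mul]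
    exact mul_lt_mul_of_pos_left this (inv_pos.2 hpn)
  have hre : ∀ w : ℂ, -‖w‖ ≤ (p * w).re := fun w => by
    have := (abs_le.1 (Complex.abs_re_le_norm (p * w))).1
    rwa [norm_mul, hp1, one_mul] at this
  obtain ⟨w₁, hw₁, hw₁'⟩ := h1 p hp1
  have hz1 := hlt' w₁ hw₁
  rcases hz with ⟨t, ht, rfl⟩ | hz
  · have hnear : ∀ (w : ℂ) (r : ℝ), ‖w - (r : ℂ)‖ ≤ τ → (p * w).re ≤ p.re * r + τ := by
      intro w r hw
      have h4 : (p * w).re = p.re * r + (p * (w - r)).re := by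
        simp only [Complex.mul_re, Complex.sub_re, Complex.sub_im, Complex.ofReal_re,
          Complex.ofReal_im]
        ring
      have h5 := (abs_le.1 (Complex.abs_re_le_norm (p * (w - r)))).2
      rw [norm_mul, hp1, one_mul] at h5
      linarith
    obtain ⟨w₂, hw₂, hw₂'⟩ := h2
    obtain ⟨w₃, hw₃, hw₃'⟩ := h3
    have hz2 := (hlt' w₂ hw₂).trans_le (hnear _ _ hw₂')
    have hz3 := (hlt' w₃ hw₃).trans_le (hnear _ _ hw₃')
    have hpt : (p * (t : ℂ)).re = p.re * t := by simp
    rw [hpt] at hz1 hz2 hz3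
    have hre1 := abs_le.1 ((Complex.abs_re_le_norm p).trans_eq hp1)
    obtain ⟨ht1, ht2⟩ := ht
    set q := √(n : ℝ) with hq
    set r := √((n : ℝ) - 1) with hr
    have hq2 : q ^ 2 = n := Real.sq_sqrt (by linarith)
    have hr2 : r ^ 2 = n - 1 := Real.sq_sqrt (by linarith)
    have hq0 : 0 ≤ q := Real.sqrt_nonneg _
    have hr0 : 0 ≤ r := Real.sqrt_nonneg _
    have hr1 : 1 ≤ r := by nlinarith
    -- This is `n ≤ (9/4)(n - 1)`, true for `n ≥ 2`. It gives `q/4 < r/2`, so for `|Re p| < 1/2` the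
    -- segment stays within the support of the disc.
    have hqr : q ≤ 3 / 2 * r :=
      (pow_le_pow_iff_left₀ hq0 (by positivity) two_ne_zero).1 (by nlinarith)
    have hε : 0 ≤ q / 2 - ε := by linarith
    have hε0 : 0 ≤ ε := by linarith [(norm_nonneg _).trans hw₂']
    rcases le_total p.re 0 with hneg | hpos
    · have h6 : p.re * (q / 2 - ε) ≤ p.re * t := mul_le_mul_of_nonpos_left ht2 hneg
      by_cases hc : p.re ≤ -(1 / 2)
      · have h7 : (p.re + 1 / 2) * ε ≤ 0 := mul_nonpos_of_nonpos_of_nonneg (by linarith) hε0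
        linarith
      · have h7 : 0 ≤ (p.re + 1 / 2) * (q / 2 - ε) := mul_nonneg (by linarith) hε
        linarith
    · have h6 : p.re * (-(q / 2) + ε) ≤ p.re * t := mul_le_mul_of_nonneg_left ht1 hpos
      by_cases hc : 1 / 2 ≤ p.re
      · have h7 : 0 ≤ (p.re - 1 / 2) * ε := mul_nonneg (by linarith) hε0
        linarith
      · have h7 : (p.re - 1 / 2) * (q / 2 - ε) ≤ 0 :=
          mul_nonpos_of_nonpos_of_nonneg (by linarith) hε
        linarith
  · have h4 := hre z
    change ‖z‖ ≤ _ at hz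
    have hτ0 : 0 ≤ τ := by
      obtain ⟨w, -, hw⟩ := h2
      exact (norm_nonneg _).trans hw
    linarith

/-- Only boundary points of the ellipse are needed: its two vertices on the real axis, and for each
direction `p` one point whose support value is that of the inscribed disc. -/
theorem convexHull_subset_weakRange {n : ℕ} (hn : 2 ≤ n) {ε ρ : ℝ}
    (hρ : (2 * n) ^ 2 * ρ ≤ ε / 2) {D : H →L[ℂ] H} [CompleteSpace H]
    {e : Fin (2 * n) × ℕ → H} (he : Orthonormal ℂ e) {a : ℕ → ℕ → ℂ}
    (ha : ∀ (i k : Fin (2 * n)) (m : ℕ), inner ℂ (e (i, m)) (D (e (k, m))) = a i k)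
    (haρ : ∀ i < 2 * n, ∀ k < 2 * n, ‖a i k - alternatingSign i k / 2‖ ≤ ρ) :
    convexHull ℝ
      ((fun t : ℝ => (t : ℂ)) '' Set.Icc (-(√(n : ℝ) / 2) + ε) (√(n : ℝ) / 2 - ε) ∪
        {l : ℂ | ‖l‖ ≤ √((n : ℝ) - 1) / 2 - ε}) ⊆ weakRange D := by
  have hn' : (2 : ℝ) ≤ n := by exact_mod_cast hn
  have key := fun s t => exists_mem_weakRange_near (s := s) (t := t) (by omega) he ha haρ
  have hr2 : √((n : ℝ) - 1) ^ 2 = n - 1 := Real.sq_sqrt (by linarith)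
  have hr0 : 0 < √((n : ℝ) - 1) := Real.sqrt_pos.2 (by linarith)
  have hsharp : ∀ l : ℝ, l ^ 2 = n → ∃ z ∈ weakRange D, ‖z - ((l / 2 : ℝ) : ℂ)‖ ≤ (2 * n) ^ 2 * ρ := by
    intro l hl
    set N : ℝ := n - 1
    have hN : 0 < N := by simp only [N]; linarith
    have hq : 0 < 2 * N ^ 2 + 2 * N * (1 + l) ^ 2 := by positivity
    set κ := √((2 * N ^ 2 + 2 * N * (1 + l) ^ 2)⁻¹) with hκ
    have hκ2 : κ ^ 2 * (2 * N ^ 2 + 2 * N * (1 + l) ^ 2) = 1 := by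
      rw [hκ, Real.sq_sqrt (by positivity), inv_mul_cancel₀ hq.ne']
    have hlN : N = l ^ 2 - 1 := by rw [hl]
    -- The eigenvector of the symmetric part of the `2 × 2` matrix for the eigenvalue `l = ±√n`
    -- satisfies `t = -(1 + l) s / N`; `κ` normalises it.
    obtain ⟨z, hz, hz'⟩ := key ((N * κ : ℝ) : ℂ) ((-(1 + l) * κ : ℝ) : ℂ) (by
      rw [Complex.norm_real, Complex.norm_real, Real.norm_eq_abs, Real.norm_eq_abs, sq_abs, sq_abs]
      refine Eq.trans ?_ hκ2
      simp only [N]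
      ring)
    refine ⟨z, hz, hz'.trans' (le_of_eq ?_)⟩
    congr 2
    have h1 : (2 * (n : ℂ) - 2) = ((2 * N : ℝ) : ℂ) := by simp only [N]; push_cast; ring
    have h2 : (-2 * (N * κ * (N * κ)) + 2 * N * (-(1 + l) * κ * (-(1 + l) * κ)
        - 2 * (-(1 + l) * κ * (N * κ)))) / 2 = l / 2 := by
      linear_combination (l * hκ2 + κ ^ 2 * 2 * N * (1 + l) * hlN) / 2
    rw [h1, Complex.conj_ofReal, Complex.conj_ofReal, ← h2]
    push_cast
    ring
  refine convexHull_subset_of_supports hn hρ (convex_weakRange D)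
    (isClosed_weakRange D) (fun p hp => ?_) (hsharp _ (Real.sq_sqrt (by linarith)))
    (by simpa [neg_div] using hsharp (-√(n : ℝ)) (by rw [neg_sq, Real.sq_sqrt (by linarith)]))
  set r := √((n : ℝ) - 1)
  -- Outer and inner entries each carry half of the mass, so the diagonal terms `-|x|²` and `|y|²`
  -- cancel and only the off-diagonal term `-(r/2) p̄` remains.
  obtain ⟨z, hz, hz'⟩ := key (1 / 2) (p * ((1 / (2 * r) : ℝ) : ℂ)) (by
    rw [norm_mul, hp, Complex.norm_real, Real.norm_eq_abs, mul_pow, sq_abs]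
    have : (2 * (n : ℝ) - 2) = 2 * r ^ 2 := by rw [hr2]; ring
    rw [this]
    norm_num
    field_simp
    norm_num)
  refine ⟨z, hz, ?_⟩
  have hpp : (starRingEnd ℂ) p * p = 1 := by
    rw [mul_comm, Complex.mul_conj, Complex.normSq_eq_norm_sq, hp]; simp
  have h1 : (2 * (n : ℂ) - 2) = ((2 * r ^ 2 : ℝ) : ℂ) := by rw [hr2]; push_cast; ring
  have hr' : (r : ℂ) ≠ 0 := by exact_mod_cast hr0.ne'
  have h2 : (-2 * ((starRingEnd ℂ) (1 / 2 : ℂ) * (1 / 2)) + (2 * (n : ℂ) - 2) *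
      ((starRingEnd ℂ) (p * ((1 / (2 * r) : ℝ) : ℂ)) * (p * ((1 / (2 * r) : ℝ) : ℂ)) -
        2 * ((starRingEnd ℂ) (p * ((1 / (2 * r) : ℝ) : ℂ)) * (1 / 2)))) / 2
      = -((r / 2 : ℝ) : ℂ) * (starRingEnd ℂ) p := by
    have h3 : (starRingEnd ℂ) (1 / 2 : ℂ) = 1 / 2 := by
      rw [show (1 / 2 : ℂ) = ((1 / 2 : ℝ) : ℂ) by norm_num, Complex.conj_ofReal]
    rw [h1, map_mul, Complex.conj_ofReal, h3,
      show (starRingEnd ℂ) p * ((1 / (2 * r) : ℝ) : ℂ) * (p * ((1 / (2 * r) : ℝ) : ℂ))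
        = ((starRingEnd ℂ) p * p) * ((1 / (2 * r) : ℝ) : ℂ) ^ 2 by ring, hpp]
    push_cast
    field_simp
    ring
  rw [h2] at hz'
  have h4 : (p * z).re = -(r / 2) + (p * (z - -((r / 2 : ℝ) : ℂ) * (starRingEnd ℂ) p)).re := by
    have h5 : p * (z - -((r / 2 : ℝ) : ℂ) * (starRingEnd ℂ) p)
        = p * z + ((r / 2 : ℝ) : ℂ) * ((starRingEnd ℂ) p * p) := by ring
    rw [h5, hpp, mul_one, Complex.add_re, Complex.ofReal_re]
    ring
  rw [h4]
  have h6 := (abs_le.1 (Complex.abs_re_le_norm (p * (z - -((r / 2 : ℝ) : ℂ) * (starRingEnd ℂ) p)))).2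
  rw [norm_mul, hp, one_mul] at h6
  linarith

end Hilb

end

noncomputable section

namespace OpenBook

/-! ### Orthonormal charts of planes -/

/-- The chart `v ↦ p + v₁ b₀ + v₂ b₁` of the plane through `p` with normal `b₂`. -/
def planeChart (b : OrthonormalBasis (Fin 3) ℝ E3) (p : E3) (v : ℝ × ℝ) : E3 :=
  p + v.1 • b 0 + v.2 • b 1

theorem inner_planeChart_sub (b : OrthonormalBasis (Fin 3) ℝ E3) (p x : E3) (v : ℝ × ℝ) :
    inner ℝ (b 0) (x - planeChart b p v) = inner ℝ (b 0) (x - p) - v.1 ∧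
    inner ℝ (b 1) (x - planeChart b p v) = inner ℝ (b 1) (x - p) - v.2 ∧
    inner ℝ (b 2) (x - planeChart b p v) = inner ℝ (b 2) (x - p) := by
  have h := fun i j => orthonormal_iff_ite.1 b.orthonormal i j
  have e : x - planeChart b p v = (x - p) - v.1 • b 0 - v.2 • b 1 := by
    rw [planeChart]; abel
  rw [e]
  simp [inner_sub_right, inner_smul_right, h]

theorem norm_sub_planeChart_sq (b : OrthonormalBasis (Fin 3) ℝ E3) (p x : E3) (v : ℝ × ℝ) :
    ‖x - planeChart b p v‖ ^ 2 = (v.1 - inner ℝ (b 0) (x - p)) ^ 2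
      + (v.2 - inner ℝ (b 1) (x - p)) ^ 2 + inner ℝ (b 2) (x - p) ^ 2 := by
  obtain ⟨h0, h1, h2⟩ := inner_planeChart_sub b p x v
  rw [← b.sum_sq_norm_inner_right, Fin.sum_univ_three, h0, h1, h2]
  simp only [Real.norm_eq_abs, sq_abs]
  ring

theorem range_planeChart (b : OrthonormalBasis (Fin 3) ℝ E3) (p : E3) :
    range (planeChart b p) = {x | inner ℝ (b 2) (x - p) = 0} := by
  ext x
  constructor
  · rintro ⟨v, rfl⟩
    have := (inner_planeChart_sub b p (planeChart b p v) v).2.2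
    rw [sub_self, inner_zero_right] at this
    exact this.symm
  · intro hx
    change inner ℝ (b 2) (x - p) = 0 at hx
    refine ⟨(inner ℝ (b 0) (x - p), inner ℝ (b 1) (x - p)), ?_⟩
    have := norm_sub_planeChart_sq b p x (inner ℝ (b 0) (x - p), inner ℝ (b 1) (x - p))
    simp only [hx, sub_self] at this
    rw [eq_comm, ← sub_eq_zero, ← norm_eq_zero]
    simpa using this

theorem continuous_planeChart (b : OrthonormalBasis (Fin 3) ℝ E3) (p : E3) :
    Continuous (planeChart b p) := by
  unfold planeChart
  fun_prop

/-- The measurable identification of `ℝ²` with its two norms. -/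
def euclideanEquivProd : EuclideanSpace ℝ (Fin 2) ≃ᵐ ℝ × ℝ :=
  (MeasurableEquiv.toLp 2 (Fin 2 → ℝ)).symm.trans MeasurableEquiv.finTwoArrow

theorem measurePreserving_euclideanEquivProd :
    MeasurePreserving euclideanEquivProd volume volume :=
  (volume_preserving_finTwoArrow ℝ).comp
    (EuclideanSpace.volume_preserving_symm_measurableEquiv_toLp (Fin 2))

/-- The product `ℝ × ℝ` carries the maximum norm, so the chart is an isometry only after the passage
to the Euclidean plane. This transports the Hausdorff measure to Lebesgue measure. -/
theorem isometry_planeChart_comp (b : OrthonormalBasis (Fin 3) ℝ E3) (p : E3) :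
    Isometry (planeChart b p ∘ euclideanEquivProd) := by
  refine Isometry.of_dist_eq fun v w => ?_
  have h : ∀ v : EuclideanSpace ℝ (Fin 2), euclideanEquivProd v = (v 0, v 1) := fun v => rfl
  have h0 := norm_sub_planeChart_sq b p (planeChart b p (euclideanEquivProd v))
    (euclideanEquivProd w)
  have h1 : planeChart b p (euclideanEquivProd v) - p = v 0 • b 0 + v 1 • b 1 := by
    rw [planeChart, h]; simp only; abel
  have h2 := fun i j => orthonormal_iff_ite.1 b.orthonormal i j
  rw [h1] at h0
  simp only [h, inner_add_right, inner_smul_right, h2] at h0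
  simp at h0
  rw [dist_eq_norm, dist_eq_norm, ← sq_eq_sq₀ (norm_nonneg _) (norm_nonneg _), Function.comp_apply,
    Function.comp_apply, h, h, h0, EuclideanSpace.norm_sq_eq, Fin.sum_univ_two]
  simp only [PiLp.sub_apply, Real.norm_eq_abs, sq_abs]
  ring

theorem map_planeChart (b : OrthonormalBasis (Fin 3) ℝ E3) (p : E3) :
    (volume : Measure (ℝ × ℝ)).map (planeChart b p)
      = (μHE[2] : Measure E3).restrict (range (planeChart b p)) := by
  have h1 := (isometry_planeChart_comp b p).map_euclideanHausdorffMeasure (d := 2)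
  rw [EuclideanSpace.euclideanHausdorffMeasure_eq_volume,
    euclideanEquivProd.surjective.range_comp] at h1
  rw [← h1, ← Measure.map_map (continuous_planeChart b p).measurable euclideanEquivProd.measurable,
    measurePreserving_euclideanEquivProd.map_eq]

theorem measurableEmbedding_planeChart (b : OrthonormalBasis (Fin 3) ℝ E3) (p : E3) :
    MeasurableEmbedding (planeChart b p) := by
  have h1 := (isometry_planeChart_comp b p).isClosedEmbedding.measurableEmbedding
  have h2 := h1.comp euclideanEquivProd.symm.measurableEmbedding
  have : (planeChart b p ∘ euclideanEquivProd) ∘ euclideanEquivProd.symm = planeChart b p := by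
    ext1 v; simp
  rwa [this] at h2

theorem setLIntegral_planeChart (b : OrthonormalBasis (Fin 3) ℝ E3) (p : E3) {S : Set E3}
    (hS : S ⊆ range (planeChart b p)) (g : E3 → ENNReal) :
    ∫⁻ x in S, g x ∂(μHE[2] : Measure E3) = ∫⁻ v in planeChart b p ⁻¹' S, g (planeChart b p v) := by
  have he := measurableEmbedding_planeChart b p
  rw [← he.lintegral_map, ← he.restrict_map, map_planeChart, Measure.restrict_restrict_of_subset hS]

theorem setIntegral_planeChart (b : OrthonormalBasis (Fin 3) ℝ E3) (p : E3) {S : Set E3}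
    (hS : S ⊆ range (planeChart b p)) {F : Type*} [NormedAddCommGroup F] [NormedSpace ℝ F]
    (g : E3 → F) :
    ∫ x in S, g x ∂(μHE[2] : Measure E3) = ∫ v in planeChart b p ⁻¹' S, g (planeChart b p v) := by
  have he := measurableEmbedding_planeChart b p
  rw [← he.integral_map, ← he.restrict_map, map_planeChart, Measure.restrict_restrict_of_subset hS]

theorem hausdorff_planeChart (b : OrthonormalBasis (Fin 3) ℝ E3) (p : E3) {S : Set E3}
    (hS : S ⊆ range (planeChart b p)) :
    (μHE[2] : Measure E3) S = volume (planeChart b p ⁻¹' S) := by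
  have he := measurableEmbedding_planeChart b p
  rw [← he.map_apply, map_planeChart, Measure.restrict_eq_self _ hS]

theorem hausdorff_lt_top_of_isBounded (b : OrthonormalBasis (Fin 3) ℝ E3) (p : E3) {S : Set E3}
    (hS : S ⊆ range (planeChart b p)) (hb : Bornology.IsBounded S) :
    (μHE[2] : Measure E3) S < ⊤ := by
  rw [hausdorff_planeChart b p hS]
  obtain ⟨R, hR⟩ := hb.subset_closedBall p
  refine (measure_mono (t := Metric.closedBall (0 : ℝ × ℝ) R) fun v hv => ?_).trans_lt
    (measure_closedBall_lt_top)
  have h1 := hR hv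
  rw [Metric.mem_closedBall, dist_comm, dist_eq_norm] at h1
  have h2 := norm_sub_planeChart_sq b p p v
  simp only [sub_self, inner_zero_right, sub_zero] at h2
  have h3 : 0 ≤ R := (norm_nonneg _).trans h1
  rw [mem_closedBall_zero_iff, Prod.norm_def]
  refine max_le (abs_le_of_sq_le_sq ?_ h3) (abs_le_of_sq_le_sq ?_ h3) <;>
    nlinarith [norm_nonneg (p - planeChart b p v), sq_nonneg v.1, sq_nonneg v.2]

theorem exists_orthonormalBasis_of_unit {n : E3} (hn : ‖n‖ = 1) :
    ∃ b : OrthonormalBasis (Fin 3) ℝ E3, b 2 = n := by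
  have h : Orthonormal ℝ (({2} : Set (Fin 3)).domRestrict fun _ => n) := by
    refine ⟨fun i => hn, fun i j hij => absurd (Subsingleton.elim i j) hij⟩
  obtain ⟨b, hb⟩ := h.exists_orthonormalBasis_extension_of_card_eq (by simp)
  exact ⟨b, hb 2 rfl⟩

theorem exists_orthonormalBasis_of_pair {e n : E3} (he : ‖e‖ = 1) (hn : ‖n‖ = 1)
    (hen : inner ℝ e n = 0) : ∃ b : OrthonormalBasis (Fin 3) ℝ E3, b 0 = e ∧ b 2 = n := by
  have h : Orthonormal ℝ (({0, 2} : Set (Fin 3)).domRestrict fun i => if i = 0 then e else n) := by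
    constructor
    · rintro ⟨i, rfl | rfl⟩
      exacts [he, hn]
    · rintro ⟨i, rfl | rfl⟩ ⟨j, rfl | rfl⟩ hij
      exacts [absurd rfl hij, hen, (real_inner_comm _ _).trans hen, absurd rfl hij]
  obtain ⟨b, hb⟩ := h.exists_orthonormalBasis_extension_of_card_eq (by simp)
  exact ⟨b, by simpa using hb 0 (by simp), by simpa using hb 2 (by simp)⟩

theorem exists_planeChart {n : E3} (hn : ‖n‖ = 1) (c : ℝ) :
    ∃ (b : OrthonormalBasis (Fin 3) ℝ E3) (p : E3), b 2 = n ∧ inner ℝ n p = c ∧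
      range (planeChart b p) = {x | inner ℝ n x = c} := by
  obtain ⟨b, hb⟩ := exists_orthonormalBasis_of_unit hn
  have hc : inner ℝ n (c • n) = c := by rw [inner_smul_right, real_inner_self_eq_norm_sq, hn]; simp
  refine ⟨b, c • n, hb, hc, ?_⟩
  rw [range_planeChart, hb]
  ext x
  change inner ℝ n (x - c • n) = 0 ↔ inner ℝ n x = c
  rw [inner_sub_right, hc, sub_eq_zero]

/-- A chart of the plane `⟪n, ·⟫ = c` in which the height above a second, nonparallel plane is a
multiple of the first coordinate. -/
theorem exists_adapted_planeChart {n m : E3} (hn : ‖n‖ = 1) (hm : ‖m‖ = 1) (h1 : m ≠ n)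
    (h2 : m ≠ -n) (c d : ℝ) :
    ∃ (b : OrthonormalBasis (Fin 3) ℝ E3) (p : E3) (s : ℝ), 0 < s ∧ b 2 = n ∧ inner ℝ n p = c ∧
      range (planeChart b p) = {x | inner ℝ n x = c} ∧
      ∀ v, inner ℝ m (planeChart b p v) - d = s * v.1 := by
  -- The part of `m` tangent to the plane, nonzero since `m ≠ ±n`, is the direction of the first
  -- coordinate and its length is the factor `s`.
  set w := m - (inner ℝ n m : ℝ) • n with hw
  have hnn : inner ℝ n n = (1 : ℝ) := by rw [real_inner_self_eq_norm_sq, hn]; simp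
  have hmm : inner ℝ m m = (1 : ℝ) := by rw [real_inner_self_eq_norm_sq, hm]; simp
  have hw0 : w ≠ 0 := by
    intro h
    have h3 : m = (inner ℝ n m : ℝ) • n := sub_eq_zero.1 h
    have h4 : |(inner ℝ n m : ℝ)| = 1 := by
      have := congrArg norm h3
      rw [norm_smul, hn, hm, mul_one, Real.norm_eq_abs] at this
      exact this.symm
    rcases eq_or_eq_neg_of_abs_eq h4 with h5 | h5
    · rw [h5, one_smul] at h3; exact h1 h3
    · rw [h5, neg_one_smul] at h3; exact h2 h3
  have hs : 0 < ‖w‖ := norm_pos_iff.2 hw0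
  set e := ‖w‖⁻¹ • w with he
  have he1 : ‖e‖ = 1 := by rw [he, norm_smul, norm_inv, norm_norm, inv_mul_cancel₀ hs.ne']
  have hwn : inner ℝ w n = 0 := by
    rw [hw, inner_sub_left, inner_smul_left, hnn, real_inner_comm]; simp
  have hen : inner ℝ e n = 0 := by rw [he, inner_smul_left, hwn, mul_zero]
  obtain ⟨b, hb0, hb2⟩ := exists_orthonormalBasis_of_pair he1 hn hen
  have hme : inner ℝ m e = ‖w‖ := by
    have h3 : m = w + (inner ℝ n m : ℝ) • n := by rw [hw]; abel
    have hne : inner ℝ n e = 0 := (real_inner_comm _ _).trans hen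
    have hwe : inner ℝ w e = ‖w‖ := by
      rw [he, inner_smul_right, real_inner_self_eq_norm_sq]
      field_simp
    rw [h3, inner_add_left, inner_smul_left, hne, mul_zero, add_zero, hwe]
  have hb1 : inner ℝ m (b 1) = 0 := by
    have hij := fun i j => orthonormal_iff_ite.1 b.orthonormal i j
    have h3 : m = ‖w‖ • b 0 + (inner ℝ n m : ℝ) • b 2 := by
      rw [hb0, hb2, he, smul_smul, mul_inv_cancel₀ hs.ne', one_smul, hw]; abel
    rw [h3, inner_add_left, inner_smul_left, inner_smul_left, hij, hij]
    simp
  obtain ⟨q, hq⟩ : ∃ q, q = c • n := ⟨_, rfl⟩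
  clear_value e
  -- The origin of the chart is moved within the plane onto the line where the two planes meet.
  obtain ⟨p, hp⟩ : ∃ p, p = q + (-(inner ℝ m q - d) / ‖w‖) • e := ⟨_, rfl⟩
  have hne : inner ℝ n e = 0 := by rw [real_inner_comm]; exact hen
  have hnp : inner ℝ n p = c := by
    rw [hp, inner_add_right, inner_smul_right, hne, hq, inner_smul_right, hnn]; ring
  refine ⟨b, p, ‖w‖, hs, hb2, hnp, ?_, fun v => ?_⟩
  · rw [range_planeChart, hb2]
    ext x
    change inner ℝ n (x - p) = 0 ↔ inner ℝ n x = c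
    rw [inner_sub_right, hnp, sub_eq_zero]
  · rw [planeChart, inner_add_right, inner_add_right, inner_smul_right, inner_smul_right, hb0, hme,
      hb1, hp, inner_add_right, inner_smul_right, hme]
    field_simp
    ring

end OpenBook

end

noncomputable section

/-! ### The Schur test -/

section Schur

variable {α β : Type*} [MeasurableSpace α] [MeasurableSpace β]

theorem sq_lintegral_mul_le {μ : Measure α} {f g : α → ENNReal} (hf : AEMeasurable f μ)
    (hg : AEMeasurable g μ) :
    (∫⁻ x, f x * g x ∂μ) ^ 2 ≤ (∫⁻ x, f x ^ 2 ∂μ) * ∫⁻ x, g x ^ 2 ∂μ := by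
  have h := ENNReal.lintegral_mul_le_Lp_mul_Lq μ Real.HolderConjugate.two_two hf hg
  have h2 : ∀ a : ENNReal, (a ^ (1 / 2 : ℝ)) ^ 2 = a := fun a => by
    rw [← ENNReal.rpow_natCast, ← ENNReal.rpow_mul]; norm_num
  simp only [ENNReal.rpow_ofNat] at h
  calc _ ≤ _ := pow_le_pow_left' h 2
    _ = _ := by rw [mul_pow, h2, h2]

/-- The Schur test. -/
theorem lintegral_sq_lintegral_le_of_schur {μ : Measure α} {ν : Measure β} [SFinite μ] [SFinite ν]
    {K : α → β → ENNReal} (hK : Measurable (Function.uncurry K)) {u : β → ENNReal}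
    {w : α → ENNReal} (hu : Measurable u) (hw : Measurable w) {A B : ENNReal}
    (hu0 : ∀ᵐ y ∂ν, u y ≠ 0) (hut : ∀ y, u y ≠ ⊤)
    (hrow : ∀ᵐ x ∂μ, ∫⁻ y, K x y * u y ^ 2 ∂ν ≤ A * w x)
    (hcol : ∀ᵐ y ∂ν, ∫⁻ x, K x y * w x ∂μ ≤ B * u y ^ 2) {f : β → ENNReal} (hf : Measurable f) :
    ∫⁻ x, (∫⁻ y, K x y * f y ∂ν) ^ 2 ∂μ ≤ A * B * ∫⁻ y, f y ^ 2 ∂ν := by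
  have hKx : ∀ x, Measurable (K x) := fun x => hK.of_uncurry_left
  have hfu : Measurable fun y => f y / u y := hf.div hu
  have h1 : ∀ x, (∫⁻ y, K x y * f y ∂ν) ^ 2
      ≤ (∫⁻ y, K x y * u y ^ 2 ∂ν) * ∫⁻ y, K x y * (f y / u y) ^ 2 ∂ν := by
    intro x
    -- With `K x` as a density, the Cauchy–Schwarz inequality for `u` and `f / u` gives the weighted
    -- estimate directly.
    have h2 : ∫⁻ y, K x y * f y ∂ν = ∫⁻ y, u y * (f y / u y) ∂ν.withDensity (K x) := by
      refine Eq.trans (lintegral_congr_ae ?_)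
        (lintegral_withDensity_eq_lintegral_mul ν (hKx x) (hu.mul hfu)).symm
      filter_upwards [hu0] with y hy
      simp only [Pi.mul_apply]
      rw [ENNReal.mul_div_cancel hy (hut y)]
    rw [h2]
    refine (sq_lintegral_mul_le hu.aemeasurable hfu.aemeasurable).trans (le_of_eq ?_)
    rw [lintegral_withDensity_eq_lintegral_mul _ (hKx x) (hu.pow_const 2),
      lintegral_withDensity_eq_lintegral_mul _ (hKx x) (hfu.pow_const 2)]
    rfl
  have hmeas : Measurable (Function.uncurry fun x y => A * w x * (K x y * (f y / u y) ^ 2)) :=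
    ((measurable_const.mul (hw.comp measurable_fst))).mul
      (hK.mul ((hfu.comp measurable_snd).pow_const 2))
  calc _ ≤ ∫⁻ x, ∫⁻ y, A * w x * (K x y * (f y / u y) ^ 2) ∂ν ∂μ := by
        refine lintegral_mono_ae ?_
        filter_upwards [hrow] with x hx
        refine ((h1 x).trans ?_).trans_eq
          (lintegral_const_mul (A * w x) ((hKx x).mul (hfu.pow_const 2))).symm
        exact mul_le_mul_left hx _
    _ = ∫⁻ y, ∫⁻ x, A * w x * (K x y * (f y / u y) ^ 2) ∂μ ∂ν :=
        lintegral_lintegral_swap hmeas.aemeasurable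
    _ ≤ ∫⁻ y, A * B * f y ^ 2 ∂ν := by
        refine lintegral_mono_ae ?_
        filter_upwards [hcol, hu0] with y hy hy0
        have h3 : ∀ x, A * w x * (K x y * (f y / u y) ^ 2)
            = A * (f y / u y) ^ 2 * (K x y * w x) := fun x => by ring
        have hKy : Measurable fun x => K x y := hK.of_uncurry_right
        simp only [h3]
        refine (lintegral_const_mul _ (hKy.mul hw)).trans_le ?_
        calc _ ≤ A * (f y / u y) ^ 2 * (B * u y ^ 2) := mul_le_mul_right hy _
          _ = A * B * (u y * (f y / u y)) ^ 2 := by ring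
          _ = _ := by rw [ENNReal.mul_div_cancel hy0 (hut y)]
    _ = _ := lintegral_const_mul _ (hf.pow_const 2)

end Schur

/-! ### Scaling and two integrals over the plane -/

theorem lintegral_comp_inv_smul_prod (g : ℝ × ℝ → ENNReal) {d : ℝ} (hd : 0 < d) :
    ∫⁻ v : ℝ × ℝ, g (d⁻¹ • v) = ENNReal.ofReal (d ^ 2) * ∫⁻ v, g v := by
  have h1 : MeasurableEmbedding fun v : ℝ × ℝ => d⁻¹ • v :=
    (Homeomorph.smulOfNeZero d⁻¹ (inv_ne_zero hd.ne')).measurableEmbedding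
  rw [← h1.lintegral_map, Measure.map_addHaar_smul _ (inv_ne_zero hd.ne'), lintegral_smul_measure]
  have : |((d⁻¹) ^ Module.finrank ℝ (ℝ × ℝ))⁻¹| = d ^ 2 := by
    rw [Module.finrank_prod, Module.finrank_self, inv_pow, inv_inv, abs_of_nonneg (by positivity)]
  rw [this, smul_eq_mul]

theorem one_add_norm_sq_le (v : ℝ × ℝ) : (1 + ‖v‖) ^ 2 ≤ 2 * (v.1 ^ 2 + v.2 ^ 2 + 1) := by
  have h : ‖v‖ ^ 2 ≤ v.1 ^ 2 + v.2 ^ 2 := by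
    rw [Prod.norm_def]
    rcases max_cases ‖v.1‖ ‖v.2‖ with ⟨h, -⟩ | ⟨h, -⟩ <;> rw [h, Real.norm_eq_abs, sq_abs] <;>
      nlinarith [sq_nonneg v.1, sq_nonneg v.2]
  nlinarith [sq_nonneg (1 - ‖v‖)]

theorem lintegral_one_add_sq_rpow_lt_top {r : ℝ} (hr : 1 < r) :
    ∫⁻ v : ℝ × ℝ, ENNReal.ofReal ((v.1 ^ 2 + v.2 ^ 2 + 1) ^ (-r)) < ⊤ := by
  have h1 := finite_integral_one_add_norm (μ := (volume : Measure (ℝ × ℝ))) (r := 2 * r)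
    (by rw [Module.finrank_prod, Module.finrank_self]; norm_num; linarith)
  have h2 : ∀ v : ℝ × ℝ, ENNReal.ofReal ((v.1 ^ 2 + v.2 ^ 2 + 1) ^ (-r))
      ≤ ENNReal.ofReal (2 ^ r) * ENNReal.ofReal ((1 + ‖v‖) ^ (-(2 * r))) := fun v => by
    rw [← ENNReal.ofReal_mul (by positivity)]
    refine ENNReal.ofReal_le_ofReal ?_
    have h3 := one_add_norm_sq_le v
    have hq : 0 < v.1 ^ 2 + v.2 ^ 2 + 1 := by positivity
    have h4 : (1 + ‖v‖) ^ (-(2 * r)) = ((1 + ‖v‖) ^ 2) ^ (-r) := by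
      rw [← Real.rpow_natCast, ← Real.rpow_mul (by positivity)]; norm_num
    calc _ = (2 : ℝ) ^ r * (2 * (v.1 ^ 2 + v.2 ^ 2 + 1)) ^ (-r) := by
          rw [Real.mul_rpow (by norm_num) hq.le, ← mul_assoc, ← Real.rpow_add (by norm_num)]
          simp
      _ ≤ _ := by
          rw [h4]
          refine mul_le_mul_of_nonneg_left ?_ (by positivity)
          exact Real.rpow_le_rpow_of_nonpos (by positivity) h3 (by linarith)
  refine (lintegral_mono h2).trans_lt ?_
  rw [lintegral_const_mul' _ _ ENNReal.ofReal_ne_top]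
  exact ENNReal.mul_lt_top ENNReal.ofReal_lt_top h1

theorem lintegral_one_add_sq_rpow_translate (a b r : ℝ) :
    ∫⁻ v : ℝ × ℝ, ENNReal.ofReal (((v.1 - a) ^ 2 + (v.2 - b) ^ 2 + 1) ^ (-r))
      = ∫⁻ v : ℝ × ℝ, ENNReal.ofReal ((v.1 ^ 2 + v.2 ^ 2 + 1) ^ (-r)) :=
  lintegral_sub_right_eq_self
    (fun v : ℝ × ℝ => ENNReal.ofReal ((v.1 ^ 2 + v.2 ^ 2 + 1) ^ (-r))) (a, b)

theorem sq_add_sq_add_sq_rpow_scale {d : ℝ} (hd : 0 < d) (x y r : ℝ) :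
    (x ^ 2 + y ^ 2 + d ^ 2) ^ (-r)
      = d ^ (-(2 * r)) * ((d⁻¹ * x) ^ 2 + (d⁻¹ * y) ^ 2 + 1) ^ (-r) := by
  have h1 : x ^ 2 + y ^ 2 + d ^ 2 = d ^ 2 * ((d⁻¹ * x) ^ 2 + (d⁻¹ * y) ^ 2 + 1) := by
    field_simp
  rw [h1, Real.mul_rpow (by positivity) (by positivity), ← Real.rpow_natCast, ← Real.rpow_mul hd.le]
  norm_num

theorem lintegral_sq_add_sq_rpow {d : ℝ} (hd : 0 < d) (a b r : ℝ) :
    ∫⁻ v : ℝ × ℝ, ENNReal.ofReal (((v.1 - a) ^ 2 + (v.2 - b) ^ 2 + d ^ 2) ^ (-r))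
      = ENNReal.ofReal (d ^ (2 - 2 * r)) *
        ∫⁻ v : ℝ × ℝ, ENNReal.ofReal ((v.1 ^ 2 + v.2 ^ 2 + 1) ^ (-r)) := by
  obtain ⟨g, hg⟩ : ∃ g : ℝ × ℝ → ENNReal, g = fun z =>
    ENNReal.ofReal (((z.1 - d⁻¹ * a) ^ 2 + (z.2 - d⁻¹ * b) ^ 2 + 1) ^ (-r)) := ⟨_, rfl⟩
  have h1 : ∀ v : ℝ × ℝ, ENNReal.ofReal (((v.1 - a) ^ 2 + (v.2 - b) ^ 2 + d ^ 2) ^ (-r))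
      = ENNReal.ofReal (d ^ (-(2 * r))) * g (d⁻¹ • v) := fun v => by
    rw [hg, sq_add_sq_add_sq_rpow_scale hd, ENNReal.ofReal_mul (by positivity)]
    simp only [Prod.smul_fst, Prod.smul_snd, smul_eq_mul, mul_sub]
  simp only [h1]
  rw [lintegral_const_mul' _ _ ENNReal.ofReal_ne_top, lintegral_comp_inv_smul_prod _ hd, hg,
    lintegral_one_add_sq_rpow_translate, ← mul_assoc, ← ENNReal.ofReal_mul (by positivity)]
  congr 2
  rw [← Real.rpow_natCast, ← Real.rpow_add hd]
  congr 1
  push_cast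
  ring

/-- For `|v.1| ≥ 1` the singular weight is at most `1` and the rest is a translate of an integrable
function. In the strip `|v.1| ≤ 1` the dependence on `v.1 - a` can be dropped, which leaves a
product of two one-dimensional integrals. Both bounds are uniform in `a` and `b`. -/
theorem exists_lintegral_one_add_sq_mul_rpow_le :
    ∃ C : ENNReal, C ≠ ⊤ ∧ ∀ a b : ℝ, ∫⁻ v : ℝ × ℝ,
      ENNReal.ofReal (((v.1 - a) ^ 2 + (v.2 - b) ^ 2 + 1) ^ (-(3 / 2) : ℝ) * |v.1| ^ (-(1 / 2) : ℝ))
        ≤ C := by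
  set J := ∫⁻ v : ℝ × ℝ, ENNReal.ofReal ((v.1 ^ 2 + v.2 ^ 2 + 1) ^ (-(3 / 2) : ℝ))
  have hJ : J < ⊤ := lintegral_one_add_sq_rpow_lt_top (by norm_num)
  set I₁ := ∫⁻ x : ℝ in Icc (-1) 1, ENNReal.ofReal (|x| ^ (-(1 / 2) : ℝ))
  set I₂ := ∫⁻ y : ℝ, ENNReal.ofReal ((y ^ 2 + 1) ^ (-(3 / 2) : ℝ))
  have hI₁ : I₁ < ⊤ := by
    have h0 : IntegrableOn (fun x : ℝ => |x| ^ (-(1 / 2) : ℝ)) (Icc 0 1) := by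
      have h1 : IntervalIntegrable (fun x : ℝ => x ^ (-(1 / 2) : ℝ)) volume 0 1 :=
        intervalIntegral.intervalIntegrable_rpow' (by norm_num)
      rw [intervalIntegrable_iff_integrableOn_Icc_of_le zero_le_one] at h1
      exact h1.congr_fun (fun x hx => by simp only [abs_of_nonneg hx.1]) measurableSet_Icc
    have h2 : IntegrableOn (fun x : ℝ => |x| ^ (-(1 / 2) : ℝ)) (Icc (-1) 1) := by
      have h3 : IntegrableOn (fun x : ℝ => |x| ^ (-(1 / 2) : ℝ)) (Icc (-1) 0) := by
        have h4 := (h0.comp_neg)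
        simp only [abs_neg, Set.neg_Icc, neg_zero] at h4
        exact h4
      rw [← Icc_union_Icc_eq_Icc (b := (0 : ℝ)) (by norm_num) (by norm_num)]
      exact h3.union h0
    exact (hasFiniteIntegral_iff_ofReal (ae_of_all _ fun x => by positivity)).1 h2.2
  have hI₂ : I₂ < ⊤ := by
    have h1 := finite_integral_one_add_norm (μ := (volume : Measure ℝ)) (r := 2) (by norm_num)
    have h3 : ∫⁻ y : ℝ, ENNReal.ofReal 2 * ENNReal.ofReal ((1 + ‖y‖) ^ (-2 : ℝ)) < ⊤ := by
      rw [lintegral_const_mul' _ _ ENNReal.ofReal_ne_top]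
      exact ENNReal.mul_lt_top ENNReal.ofReal_lt_top h1
    refine (lintegral_mono fun y => ?_).trans_lt h3
    rw [← ENNReal.ofReal_mul (by norm_num)]
    refine ENNReal.ofReal_le_ofReal ?_
    have h2 : (y ^ 2 + 1) ^ (-(3 / 2) : ℝ) ≤ (y ^ 2 + 1) ^ (-1 : ℝ) :=
      Real.rpow_le_rpow_of_exponent_le (by nlinarith [sq_nonneg y]) (by norm_num)
    refine h2.trans ?_
    rw [Real.rpow_neg (by positivity), Real.rpow_neg (by positivity), Real.rpow_one,
      Real.rpow_ofNat, ← div_eq_mul_inv, le_div_iff₀ (by positivity), inv_mul_le_iff₀ (by positivity),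
      Real.norm_eq_abs]
    nlinarith [sq_nonneg (1 - |y|), sq_abs y]
  refine ⟨J + I₁ * I₂, by finiteness, fun a b => ?_⟩
  have hpt : ∀ v : ℝ × ℝ,
      ENNReal.ofReal (((v.1 - a) ^ 2 + (v.2 - b) ^ 2 + 1) ^ (-(3 / 2) : ℝ) * |v.1| ^ (-(1 / 2) : ℝ))
      ≤ ENNReal.ofReal (((v.1 - a) ^ 2 + (v.2 - b) ^ 2 + 1) ^ (-(3 / 2) : ℝ))
        + (Icc (-1 : ℝ) 1).indicator (fun x => ENNReal.ofReal (|x| ^ (-(1 / 2) : ℝ))) v.1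
          * ENNReal.ofReal (((v.2 - b) ^ 2 + 1) ^ (-(3 / 2) : ℝ)) := by
    intro v
    by_cases hv : v.1 ∈ Icc (-1 : ℝ) 1
    · rw [indicator_of_mem hv]
      refine le_add_left ?_
      rw [mul_comm, ENNReal.ofReal_mul (by positivity)]
      refine mul_le_mul_right (ENNReal.ofReal_le_ofReal ?_) _
      exact Real.rpow_le_rpow_of_nonpos (by positivity) (by nlinarith [sq_nonneg (v.1 - a)])
        (by norm_num)
    · refine le_add_right (ENNReal.ofReal_le_ofReal ?_)
      refine mul_le_of_le_one_right (by positivity) ?_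
      have h1 : 1 ≤ |v.1| := by
        by_contra h
        exact hv (abs_le.1 (not_le.1 h).le)
      exact Real.rpow_le_one_of_one_le_of_nonpos h1 (by norm_num)
  refine (lintegral_mono hpt).trans ?_
  rw [lintegral_add_left (by fun_prop), lintegral_one_add_sq_rpow_translate]
  refine add_le_add le_rfl (le_of_eq ?_)
  rw [Measure.volume_eq_prod]
  refine (lintegral_prod_mul (f := (Icc (-1 : ℝ) 1).indicator
    fun x => ENNReal.ofReal (|x| ^ (-(1 / 2) : ℝ)))
    (g := fun y => ENNReal.ofReal (((y - b) ^ 2 + 1) ^ (-(3 / 2) : ℝ))) ?_ (by fun_prop)).trans ?_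
  rotate_left
  · rw [lintegral_indicator measurableSet_Icc]
    congr 1
    exact lintegral_sub_right_eq_self
      (fun y : ℝ => ENNReal.ofReal ((y ^ 2 + 1) ^ (-(3 / 2) : ℝ))) b
  · exact (Measurable.indicator (by fun_prop) measurableSet_Icc).aemeasurable

/-- By scaling with `d`: the kernel gives `d ^ (-3)`, the weight `d ^ (-1/2)` and the area element
`d ^ 2`. -/
theorem exists_lintegral_sq_add_sq_mul_rpow_le :
    ∃ C : ENNReal, C ≠ ⊤ ∧ ∀ d : ℝ, 0 < d → ∀ a b : ℝ, ∫⁻ v : ℝ × ℝ,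
      ENNReal.ofReal (((v.1 - a) ^ 2 + (v.2 - b) ^ 2 + d ^ 2) ^ (-(3 / 2) : ℝ)
        * |v.1| ^ (-(1 / 2) : ℝ)) ≤ C * ENNReal.ofReal (d ^ (-(3 / 2) : ℝ)) := by
  obtain ⟨C, hC, h⟩ := exists_lintegral_one_add_sq_mul_rpow_le
  refine ⟨C, hC, fun d hd a b => ?_⟩
  obtain ⟨g, hg⟩ : ∃ g : ℝ × ℝ → ENNReal, g = fun z =>
    ENNReal.ofReal (((z.1 - d⁻¹ * a) ^ 2 + (z.2 - d⁻¹ * b) ^ 2 + 1) ^ (-(3 / 2) : ℝ)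
      * |z.1| ^ (-(1 / 2) : ℝ)) := ⟨_, rfl⟩
  have h1 : ∀ v : ℝ × ℝ, ENNReal.ofReal (((v.1 - a) ^ 2 + (v.2 - b) ^ 2 + d ^ 2) ^ (-(3 / 2) : ℝ)
        * |v.1| ^ (-(1 / 2) : ℝ))
      = ENNReal.ofReal (d ^ (-(7 / 2) : ℝ)) * g (d⁻¹ • v) := fun v => by
    rw [hg, sq_add_sq_add_sq_rpow_scale hd, ← ENNReal.ofReal_mul (by positivity)]
    simp only [Prod.smul_fst, Prod.smul_snd, smul_eq_mul, mul_sub]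
    congr 1
    rw [abs_mul, abs_of_pos (inv_pos.2 hd), Real.mul_rpow (by positivity) (by positivity),
      Real.inv_rpow hd.le, ← Real.rpow_neg hd.le,
      show (-(7 / 2) : ℝ) = -(2 * (3 / 2)) + -(1 / 2) by norm_num, Real.rpow_add hd]
    have : d ^ (-(1 / 2) : ℝ) * d ^ (- -(1 / 2) : ℝ) = 1 := by
      rw [← Real.rpow_add hd]; norm_num
    linear_combination (-(d ^ (-(2 * (3 / 2)) : ℝ) * ((d⁻¹ * v.1 - d⁻¹ * a) ^ 2
      + (d⁻¹ * v.2 - d⁻¹ * b) ^ 2 + 1) ^ (-(3 / 2) : ℝ) * |v.1| ^ (-(1 / 2) : ℝ))) * this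
  simp only [h1]
  rw [lintegral_const_mul' _ _ ENNReal.ofReal_ne_top, lintegral_comp_inv_smul_prod _ hd,
    ← mul_assoc, ← ENNReal.ofReal_mul (by positivity), mul_comm, hg]
  refine (mul_le_mul' (h _ _) le_rfl).trans (le_of_eq ?_)
  congr 2
  rw [← Real.rpow_natCast, ← Real.rpow_add hd]
  norm_num

end

noncomputable section

/-! ### Integral operators on `L²` -/

section KernelOperator

variable {α : Type*} [MeasurableSpace α] {μ : Measure α}

theorem sq_eLpNorm_two {F : Type*} [NormedAddCommGroup F] (f : α → F) :
    eLpNorm f 2 μ ^ 2 = ∫⁻ x, ‖f x‖ₑ ^ 2 ∂μ := by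
  rw [eLpNorm_eq_lintegral_rpow_enorm_toReal (by norm_num) (by norm_num), ENNReal.toReal_ofNat,
    ← ENNReal.rpow_natCast, ← ENNReal.rpow_mul]
  norm_num

theorem lintegral_enorm_sq_lt_top (φ : Lp ℂ 2 μ) : ∫⁻ x, ‖φ x‖ₑ ^ 2 ∂μ < ⊤ := by
  rw [← sq_eLpNorm_two]
  exact ENNReal.pow_lt_top (Lp.eLpNorm_lt_top φ)

/-- `k` is the kernel of an absolutely bounded operator on `L²`. -/
def AbsBounded (μ : Measure α) (k : α → α → ℝ) : Prop :=
  ∃ C : ENNReal, C ≠ ⊤ ∧ ∀ f : α → ENNReal, Measurable f →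
    ∫⁻ x, (∫⁻ y, ‖k x y‖ₑ * f y ∂μ) ^ 2 ∂μ ≤ C * ∫⁻ y, f y ^ 2 ∂μ

theorem aemeasurable_lintegral_kernel [SFinite μ] {k : α → α → ℝ}
    (hk : AEStronglyMeasurable (Function.uncurry k) (μ.prod μ)) (φ : Lp ℂ 2 μ) :
    AEMeasurable (fun x => ∫⁻ y, ‖k x y‖ₑ * ‖φ y‖ₑ ∂μ) μ := by
  have h1 : AEMeasurable (fun p : α × α => ‖k p.1 p.2‖ₑ * ‖φ p.2‖ₑ) (μ.prod μ) :=
    hk.enorm.mul ((Lp.stronglyMeasurable φ).enorm.comp measurable_snd).aemeasurable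
  exact h1.lintegral_prod_right'

/-- Absolute boundedness does two things at once: for almost all `x` it makes the integral converge
absolutely, and it bounds the result in `L²`. -/
theorem exists_kernelOperator [SFinite μ] {k : α → α → ℝ}
    (hk : AEStronglyMeasurable (Function.uncurry k) (μ.prod μ)) (hB : AbsBounded μ k) :
    ∃ T : Lp ℂ 2 μ →L[ℂ] Lp ℂ 2 μ, ∀ φ : Lp ℂ 2 μ, ∀ᵐ x ∂μ,
      Integrable (fun y => k x y • φ y) μ ∧ T φ x = ∫ y, k x y • φ y ∂μ := by
  obtain ⟨C, hC, hB⟩ := hB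
  have hbd : ∀ φ : Lp ℂ 2 μ, ∫⁻ x, (∫⁻ y, ‖k x y‖ₑ * ‖φ y‖ₑ ∂μ) ^ 2 ∂μ
      ≤ C * ∫⁻ y, ‖φ y‖ₑ ^ 2 ∂μ := fun φ => hB _ (Lp.stronglyMeasurable φ).enorm
  have hint : ∀ φ : Lp ℂ 2 μ, ∀ᵐ x ∂μ, Integrable (fun y => k x y • φ y) μ := by
    intro φ
    have h1 : ∀ᵐ x ∂μ, (∫⁻ y, ‖k x y‖ₑ * ‖φ y‖ₑ ∂μ) ^ 2 < ⊤ :=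
      ae_lt_top' ((aemeasurable_lintegral_kernel hk φ).pow_const 2)
        ((hbd φ).trans_lt (ENNReal.mul_lt_top hC.lt_top (lintegral_enorm_sq_lt_top φ))).ne
    filter_upwards [h1, hk.prodMk_left] with x hx hkx
    refine ⟨hkx.smul (Lp.stronglyMeasurable φ).aestronglyMeasurable, ?_⟩
    have h2 := (ENNReal.pow_lt_top_iff.1 hx).resolve_right (by norm_num)
    simpa only [HasFiniteIntegral, enorm_smul] using h2
  have hmeas : ∀ φ : Lp ℂ 2 μ, AEStronglyMeasurable (fun x => ∫ y, k x y • φ y ∂μ) μ := fun φ =>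
    (hk.smul ((Lp.stronglyMeasurable φ).comp_measurable measurable_snd).aestronglyMeasurable
      : AEStronglyMeasurable (fun p : α × α => k p.1 p.2 • φ p.2) (μ.prod μ)).integral_prod_right'
  have hnorm : ∀ φ : Lp ℂ 2 μ, eLpNorm (fun x => ∫ y, k x y • φ y ∂μ) 2 μ
      ≤ C ^ (1 / 2 : ℝ) * eLpNorm φ 2 μ := by
    intro φ
    have h1 : eLpNorm (fun x => ∫ y, k x y • φ y ∂μ) 2 μ ^ 2
        ≤ (C ^ (1 / 2 : ℝ) * eLpNorm φ 2 μ) ^ 2 := by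
      rw [mul_pow, sq_eLpNorm_two, sq_eLpNorm_two, ← ENNReal.rpow_natCast, ← ENNReal.rpow_mul]
      norm_num
      refine (lintegral_mono fun x => ?_).trans (hbd φ)
      refine pow_le_pow_left' ((enorm_integral_le_lintegral_enorm _).trans (le_of_eq ?_)) 2
      exact lintegral_congr fun y => by rw [← Complex.real_smul, enorm_smul]
    exact (ENNReal.pow_le_pow_left_iff two_ne_zero).1 h1
  have hmem : ∀ φ : Lp ℂ 2 μ, MemLp (fun x => ∫ y, k x y • φ y ∂μ) 2 μ := fun φ =>
    ⟨hmeas φ, (hnorm φ).trans_lt (ENNReal.mul_lt_top (ENNReal.rpow_lt_top_of_nonneg (by norm_num) hC)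
      (Lp.eLpNorm_lt_top φ))⟩
  let T₀ : Lp ℂ 2 μ →ₗ[ℂ] Lp ℂ 2 μ :=
    { toFun := fun φ => (hmem φ).toLp _
      map_add' := fun φ ψ => by
        rw [← MemLp.toLp_add]
        refine MemLp.toLp_congr _ _ ?_
        filter_upwards [hint φ, hint ψ] with x h1 h2
        rw [Pi.add_apply, ← integral_add h1 h2]
        refine integral_congr_ae ?_
        filter_upwards [Lp.coeFn_add φ ψ] with y hy
        rw [hy, Pi.add_apply, smul_add]
      map_smul' := fun c φ => by
        rw [RingHom.id_apply, ← MemLp.toLp_const_smul]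
        refine MemLp.toLp_congr _ _ (ae_of_all _ fun x => ?_)
        rw [Pi.smul_apply, ← integral_smul]
        refine integral_congr_ae ?_
        filter_upwards [Lp.coeFn_smul c φ] with y hy
        rw [hy, Pi.smul_apply, smul_comm] }
  refine ⟨T₀.mkContinuous (C ^ (1 / 2 : ℝ)).toReal fun φ => ?_, fun φ => ?_⟩
  · change ‖(hmem φ).toLp _‖ ≤ _
    rw [Lp.norm_toLp, Lp.norm_def, ← ENNReal.toReal_mul]
    exact ENNReal.toReal_mono (ENNReal.mul_ne_top (ENNReal.rpow_ne_top_of_nonneg (by norm_num) hC)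
      (Lp.eLpNorm_ne_top φ)) (hnorm φ)
  · filter_upwards [hint φ, (hmem φ).coeFn_toLp] with x h1 h2
    exact ⟨h1, h2⟩

/-- By Fubini. The double integral converges absolutely since the function `x ↦ ∫ |k x y| |ψ y|` is
in `L²` and can be paired with `|φ|` by Cauchy–Schwarz. -/
theorem kernelOperator_eq_adjoint [SFinite μ] {k : α → α → ℝ}
    (hk : AEStronglyMeasurable (Function.uncurry k) (μ.prod μ)) (hB : AbsBounded μ k)
    {T T' : Lp ℂ 2 μ →L[ℂ] Lp ℂ 2 μ} (hT : ∀ φ, ∀ᵐ x ∂μ, T φ x = ∫ y, k x y • φ y ∂μ)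
    (hT' : ∀ φ, ∀ᵐ x ∂μ, T' φ x = ∫ y, k y x • φ y ∂μ) : T' = T.adjoint := by
  obtain ⟨C, hC, hB⟩ := hB
  rw [ContinuousLinearMap.eq_adjoint_iff]
  intro φ ψ
  have hm1 : AEStronglyMeasurable (fun p : α × α => (starRingEnd ℂ) (φ p.1)) (μ.prod μ) :=
    (Complex.continuous_conj.comp_stronglyMeasurable
      ((Lp.stronglyMeasurable φ).comp_measurable measurable_fst)).aestronglyMeasurable
  have hm2 : AEStronglyMeasurable (fun p : α × α => ψ p.2) (μ.prod μ) :=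
    ((Lp.stronglyMeasurable ψ).comp_measurable measurable_snd).aestronglyMeasurable
  have hG : Integrable (fun p : α × α => k p.1 p.2 • (ψ p.2 * (starRingEnd ℂ) (φ p.1)))
      (μ.prod μ) := by
    have hmG : AEStronglyMeasurable
        (fun p : α × α => k p.1 p.2 • (ψ p.2 * (starRingEnd ℂ) (φ p.1))) (μ.prod μ) :=
      hk.smul (hm2.mul hm1)
    refine ⟨hmG, ?_⟩
    rw [HasFiniteIntegral, lintegral_prod _ hmG.enorm]
    have h1 : ∀ᵐ x ∂μ, ∫⁻ y, ‖k x y • (ψ y * (starRingEnd ℂ) (φ x))‖ₑ ∂μ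
        = (∫⁻ y, ‖k x y‖ₑ * ‖ψ y‖ₑ ∂μ) * ‖φ x‖ₑ := by
      refine ae_of_all _ fun x => ?_
      rw [← lintegral_mul_const' _ _ enorm_ne_top]
      refine lintegral_congr fun y => ?_
      rw [enorm_smul, enorm_mul, RCLike.enorm_conj, mul_assoc]
    rw [lintegral_congr_ae h1]
    have h2 := sq_lintegral_mul_le (aemeasurable_lintegral_kernel hk ψ)
      (Lp.stronglyMeasurable φ).enorm.aemeasurable
    have h3 := h2.trans_lt (ENNReal.mul_lt_top ((hB _
      (Lp.stronglyMeasurable ψ).enorm).trans_lt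
        (ENNReal.mul_lt_top hC.lt_top (lintegral_enorm_sq_lt_top ψ)))
      (lintegral_enorm_sq_lt_top φ))
    exact (ENNReal.pow_lt_top_iff.1 h3).resolve_right (by norm_num)
  rw [L2.inner_def, L2.inner_def]
  calc ∫ x, inner ℂ (T' φ x) (ψ x) ∂μ
      = ∫ y, ∫ x, k x y • (ψ y * (starRingEnd ℂ) (φ x)) ∂μ ∂μ := by
        refine integral_congr_ae ?_
        filter_upwards [hT' φ] with y hy
        rw [RCLike.inner_apply, hy, ← integral_conj, ← integral_const_mul]
        refine integral_congr_ae (ae_of_all _ fun x => ?_)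
        simp only [Complex.real_smul, map_mul, Complex.conj_ofReal]
        ring
    _ = ∫ x, ∫ y, k x y • (ψ y * (starRingEnd ℂ) (φ x)) ∂μ ∂μ :=
        (integral_integral_swap hG).symm
    _ = ∫ x, inner ℂ (φ x) (T ψ x) ∂μ := by
        refine integral_congr_ae ?_
        filter_upwards [hT ψ] with x hx
        rw [RCLike.inner_apply, hx, ← integral_mul_const]
        refine integral_congr_ae (ae_of_all _ fun y => ?_)
        simp only [Complex.real_smul]
        ring

end KernelOperator

/-! ### The double-layer kernel of a pair of plane sets -/

namespace OpenBook

/-- The absolute value of the double-layer kernel, up to the factor `4π`, for a plane with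
normal `n`. -/
def planarKernel (n x y : E3) : ENNReal := ENNReal.ofReal (|inner ℝ n (x - y)| / ‖x - y‖ ^ 3)

theorem measurable_planarKernel (n : E3) : Measurable (Function.uncurry (planarKernel n)) := by
  unfold planarKernel Function.uncurry
  fun_prop

theorem measurable_planarKernel_swap (n : E3) :
    Measurable (Function.uncurry fun y x => planarKernel n x y) := by
  unfold planarKernel Function.uncurry
  fun_prop

theorem sq_rpow_neg_three_halves {r : ℝ} (hr : 0 ≤ r) : (r ^ 2) ^ (-(3 / 2) : ℝ) = (r ^ 3)⁻¹ := by
  rw [← Real.rpow_natCast, ← Real.rpow_mul hr, ← Real.rpow_natCast r 3, ← Real.rpow_neg hr]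
  norm_num

theorem ofReal_rpow_neg_quarter_sq {r : ℝ} (hr : 0 ≤ r) :
    ENNReal.ofReal (r ^ (-(1 / 4) : ℝ)) ^ 2 = ENNReal.ofReal (r ^ (-(1 / 2) : ℝ)) := by
  rw [← ENNReal.ofReal_pow (by positivity), ← Real.rpow_natCast, ← Real.rpow_mul hr]
  norm_num

theorem abs_inner_unit_le {n : E3} (hn : ‖n‖ = 1) (v : E3) : |inner ℝ n v| ≤ ‖v‖ := by
  simpa [hn] using abs_real_inner_le_norm n v

/-- Seen from `x` at distance `t` from the plane of `T`, the kernel is `t (|v - a|² + t²) ^ (-3/2)`,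
and in the adapted chart the distance to the other plane is `s |v.1|`. The preceding integral gives
`t · t ^ (-3/2) = t ^ (-1/2)`, which fixes the weights of the Schur test. -/
theorem lintegral_planarKernel_row {m n : E3} (hm : ‖m‖ = 1) (hn : ‖n‖ = 1) (h1 : m ≠ n)
    (h2 : m ≠ -n) (c d : ℝ) {T : Set E3} (hT : T ⊆ {x | inner ℝ n x = c}) :
    ∃ A : ENNReal, A ≠ ⊤ ∧ ∀ x, ∫⁻ y in T, planarKernel n x y *
      ENNReal.ofReal (|inner ℝ m y - d| ^ (-(1 / 4) : ℝ)) ^ 2 ∂(μHE[2] : Measure E3)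
        ≤ A * ENNReal.ofReal (|inner ℝ n x - c| ^ (-(1 / 2) : ℝ)) := by
  obtain ⟨b, p, s, hs, hb, hp, hrange, hv⟩ := exists_adapted_planeChart hn hm h1 h2 c d
  obtain ⟨C, hC, hJ⟩ := exists_lintegral_sq_add_sq_mul_rpow_le
  refine ⟨ENNReal.ofReal (s ^ (-(1 / 2) : ℝ)) * C, by finiteness, fun x => ?_⟩
  set t := |inner ℝ n x - c| with ht
  have hinner : ∀ v, inner ℝ n (x - planeChart b p v) = inner ℝ n x - c := fun v => by
    have h3 : planeChart b p v ∈ {x | inner ℝ n x = c} := hrange ▸ mem_range_self v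
    rw [inner_sub_right, h3]
  refine (lintegral_mono_set hT).trans ?_
  rw [← hrange, setLIntegral_planeChart b p subset_rfl, preimage_range, Measure.restrict_univ]
  -- A point in the plane of `T` has to be treated apart: there the right-hand side is `0`, because
  -- `0 ^ (-1/2) = 0` by convention, but the kernel vanishes as well.
  rcases (abs_nonneg (inner ℝ n x - c)).eq_or_lt with h0 | h0
  · have : ∀ v, planarKernel n x (planeChart b p v) = 0 := fun v => by
      rw [planarKernel, hinner, ← h0]; simp
    simp [this]
  · have hpt : ∀ v, planarKernel n x (planeChart b p v) *
        ENNReal.ofReal (|inner ℝ m (planeChart b p v) - d| ^ (-(1 / 4) : ℝ)) ^ 2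
        = ENNReal.ofReal (t * s ^ (-(1 / 2) : ℝ)) * ENNReal.ofReal
          (((v.1 - inner ℝ (b 0) (x - p)) ^ 2 + (v.2 - inner ℝ (b 1) (x - p)) ^ 2 + t ^ 2)
            ^ (-(3 / 2) : ℝ) * |v.1| ^ (-(1 / 2) : ℝ)) := fun v => by
      have h3 := norm_sub_planeChart_sq b p x v
      rw [hb, inner_sub_right (n : E3) x p, hp, ← sq_abs (inner ℝ n x - c), ← ht] at h3
      rw [← h3, sq_rpow_neg_three_halves (norm_nonneg _), planarKernel, hinner, hv,
        ofReal_rpow_neg_quarter_sq (abs_nonneg _), ← ENNReal.ofReal_mul (by positivity),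
        ← ENNReal.ofReal_mul (by positivity), abs_mul, abs_of_pos hs,
        Real.mul_rpow hs.le (abs_nonneg _)]
      congr 1
      rw [div_eq_mul_inv, ← ht]
      ring
    rw [lintegral_congr hpt, lintegral_const_mul' _ _ ENNReal.ofReal_ne_top]
    refine (mul_le_mul_right (hJ t h0 _ _) _).trans (le_of_eq ?_)
    rw [mul_comm t, ENNReal.ofReal_mul (by positivity), mul_assoc, mul_assoc, mul_left_comm _ C,
      ← ENNReal.ofReal_mul (by positivity)]
    congr 3
    nth_rewrite 1 [← Real.rpow_one t]
    rw [← Real.rpow_add h0]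
    congr 1
    norm_num

/-- For `y` in the plane of `T`, the weight at `x` is `|n · (x - y)| ^ (-1/2)`. Its product with the
kernel is at most `|x - y| ^ (1/2 - 3)`, and the integral of `|x - y| ^ (-5/2)` over a plane at
distance `r` is a multiple of `r ^ (-1/2)`. -/
theorem lintegral_planarKernel_column {m n : E3} (hm : ‖m‖ = 1) (hn : ‖n‖ = 1) (c d : ℝ)
    {S : Set E3} (hS : S ⊆ {x | inner ℝ m x = d}) :
    ∃ B : ENNReal, B ≠ ⊤ ∧ ∀ y, inner ℝ n y = c → inner ℝ m y ≠ d →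
      ∫⁻ x in S, planarKernel n x y *
        ENNReal.ofReal (|inner ℝ n x - c| ^ (-(1 / 2) : ℝ)) ∂(μHE[2] : Measure E3)
        ≤ B * ENNReal.ofReal (|inner ℝ m y - d| ^ (-(1 / 4) : ℝ)) ^ 2 := by
  obtain ⟨b, p, hb, hp, hrange⟩ := exists_planeChart hm d
  have hJ := lintegral_one_add_sq_rpow_lt_top (r := 5 / 4) (by norm_num)
  refine ⟨_, hJ.ne, fun y hy hyd => ?_⟩
  set r := |inner ℝ m y - d| with hr
  have hr0 : 0 < r := abs_pos.2 (sub_ne_zero.2 hyd)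
  refine (lintegral_mono_set hS).trans ?_
  rw [← hrange, setLIntegral_planeChart b p subset_rfl, preimage_range, Measure.restrict_univ]
  refine (lintegral_mono fun v => ?_).trans_eq ((lintegral_sq_add_sq_rpow hr0
    (inner ℝ (b 0) (y - p)) (inner ℝ (b 1) (y - p)) (5 / 4)).trans ?_)
  · set x := planeChart b p v
    have h3 := norm_sub_planeChart_sq b p y v
    rw [hb, inner_sub_right (m : E3) y p, hp, ← sq_abs (inner ℝ m y - d), ← hr] at h3
    rw [← h3, norm_sub_rev, planarKernel, ← ENNReal.ofReal_mul (by positivity)]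
    refine ENNReal.ofReal_le_ofReal ?_
    have hc : inner ℝ n x - c = inner ℝ n (x - y) := by rw [inner_sub_right, hy]
    rw [hc]
    have hle := abs_inner_unit_le hn (x - y)
    set t := |inner ℝ n (x - y)|
    have ht0 : 0 ≤ t := abs_nonneg _
    have hρ0 : 0 < ‖x - y‖ := by
      rw [norm_sub_rev]
      have : 0 < ‖y - x‖ ^ 2 := by rw [h3]; positivity
      exact lt_of_pow_lt_pow_left₀ 2 (norm_nonneg _) (by simpa using this)
    set ρ := ‖x - y‖
    have h4 : t * t ^ (-(1 / 2) : ℝ) ≤ ρ ^ (1 / 2 : ℝ) := by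
      rcases ht0.eq_or_lt with h0 | h0
      · rw [← h0, zero_mul]; positivity
      · nth_rewrite 1 [← Real.rpow_one t]
        rw [← Real.rpow_add h0]
        norm_num
        exact Real.rpow_le_rpow ht0 hle (by norm_num)
    calc t / ρ ^ 3 * t ^ (-(1 / 2) : ℝ) = t * t ^ (-(1 / 2) : ℝ) * (ρ ^ 3)⁻¹ := by ring
      _ ≤ ρ ^ (1 / 2 : ℝ) * (ρ ^ 3)⁻¹ := by gcongr
      _ = (ρ ^ 2) ^ (-(5 / 4) : ℝ) := by
        rw [← Real.rpow_natCast ρ 3, ← Real.rpow_neg hρ0.le, ← Real.rpow_add hρ0,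
          ← Real.rpow_natCast, ← Real.rpow_mul hρ0.le]
        norm_num
  · rw [ofReal_rpow_neg_quarter_sq hr0.le, mul_comm]
    norm_num

/-- Two nonparallel planes meet in a line, which is `{v.1 = 0}` in the adapted chart. -/
theorem ae_inner_ne {m n : E3} (hm : ‖m‖ = 1) (hn : ‖n‖ = 1) (h1 : m ≠ n) (h2 : m ≠ -n) (c d : ℝ)
    {T : Set E3} (hT : T ⊆ {x | inner ℝ n x = c}) (hTm : MeasurableSet T) :
    ∀ᵐ y ∂(μHE[2] : Measure E3).restrict T, inner ℝ m y ≠ d := by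
  obtain ⟨b, p, s, hs, hb, hp, hrange, hv⟩ := exists_adapted_planeChart hn hm h1 h2 c d
  rw [ae_restrict_iff' hTm]
  refine measure_mono_null (t := {y | inner ℝ n y = c} ∩ {y | inner ℝ m y = d}) ?_ ?_
  · intro y hy
    by_contra h
    exact hy fun hyT hyd => h ⟨hT hyT, hyd⟩
  · rw [hausdorff_planeChart b p (by rw [hrange]; exact inter_subset_left)]
    refine measure_mono_null (t := ({0} : Set ℝ) ×ˢ (univ : Set ℝ)) ?_ ?_
    · rintro v ⟨-, hv2⟩
      have h3 := hv v
      have h4 : inner ℝ m (planeChart b p v) = d := hv2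
      rw [h4, sub_self] at h3
      have : v.1 = 0 := by
        rcases mul_eq_zero.1 h3.symm with h | h
        · exact absurd h hs.ne'
        · exact h
      exact ⟨this, mem_univ _⟩
    · rw [Measure.volume_eq_prod, Measure.prod_prod]
      simp

/-- `planarKernel n` and its transpose are absolutely bounded between `L²(S)` and `L²(T)`. -/
def PlanarBound (n : E3) (S T : Set E3) : Prop :=
  ∃ C : ENNReal, C ≠ ⊤ ∧
    (∀ f : E3 → ENNReal, Measurable f →
      ∫⁻ x in S, (∫⁻ y in T, planarKernel n x y * f y ∂(μHE[2] : Measure E3)) ^ 2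
        ∂(μHE[2] : Measure E3) ≤ C * ∫⁻ y in T, f y ^ 2 ∂(μHE[2] : Measure E3)) ∧
    (∀ f : E3 → ENNReal, Measurable f →
      ∫⁻ y in T, (∫⁻ x in S, planarKernel n x y * f x ∂(μHE[2] : Measure E3)) ^ 2
        ∂(μHE[2] : Measure E3) ≤ C * ∫⁻ x in S, f x ^ 2 ∂(μHE[2] : Measure E3))

section

variable {m n : E3} {S T : Set E3}

/-- The row and the column condition exchange their roles under transposition, so one pair of
weights serves the kernel and its transpose. -/
theorem planarBound_of_schur [SFinite ((μHE[2] : Measure E3).restrict S)]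
    [SFinite ((μHE[2] : Measure E3).restrict T)] {u w : E3 → ENNReal} (hu : Measurable u)
    (hw : Measurable w) {A B : ENNReal} (hA : A ≠ ⊤) (hB : B ≠ ⊤) (hut : ∀ y, u y ≠ ⊤)
    (hwt : ∀ y, w y ≠ ⊤)
    (hu0 : ∀ᵐ y ∂(μHE[2] : Measure E3).restrict T, u y ≠ 0)
    (hw0 : ∀ᵐ y ∂(μHE[2] : Measure E3).restrict S, w y ≠ 0)
    (hrow : ∀ᵐ x ∂(μHE[2] : Measure E3).restrict S,
      ∫⁻ y in T, planarKernel n x y * u y ^ 2 ∂(μHE[2] : Measure E3) ≤ A * w x ^ 2)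
    (hcol : ∀ᵐ y ∂(μHE[2] : Measure E3).restrict T,
      ∫⁻ x in S, planarKernel n x y * w x ^ 2 ∂(μHE[2] : Measure E3) ≤ B * u y ^ 2) :
    PlanarBound n S T := by
  refine ⟨A * B, ENNReal.mul_ne_top hA hB, fun f hf => ?_, fun f hf => ?_⟩
  · exact lintegral_sq_lintegral_le_of_schur (K := planarKernel n)
      (measurable_planarKernel n) hu (hw.pow_const 2) hu0 hut hrow hcol hf
  · rw [mul_comm A B]
    exact lintegral_sq_lintegral_le_of_schur (K := fun y x => planarKernel n x y)
      (measurable_planarKernel_swap n) hw (hu.pow_const 2) hw0 hwt hcol hrow hf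

/-- This is the case of parallel planes at distance `|e|`. If `e = 0` the kernel vanishes; otherwise
`|x - y| ≥ |e|` bounds it by `|e| ^ (-2)`. -/
theorem planarBound_of_const {e : ℝ} (hn : ‖n‖ = 1) (hSm : MeasurableSet S) (hTm : MeasurableSet T)
    (hSf : (μHE[2] : Measure E3) S ≠ ⊤) (hTf : (μHE[2] : Measure E3) T ≠ ⊤)
    (he : ∀ x ∈ S, ∀ y ∈ T, inner ℝ n (x - y) = e) : PlanarBound n S T := by
  have : IsFiniteMeasure ((μHE[2] : Measure E3).restrict S) := ⟨by simpa using hSf.lt_top⟩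
  have : IsFiniteMeasure ((μHE[2] : Measure E3).restrict T) := ⟨by simpa using hTf.lt_top⟩
  obtain ⟨M, hM, hKe⟩ : ∃ M : ENNReal, M ≠ ⊤ ∧ ∀ x ∈ S, ∀ y ∈ T, planarKernel n x y ≤ M := by
    refine ⟨ENNReal.ofReal ((|e| ^ 2)⁻¹), ENNReal.ofReal_ne_top, fun x hx y hy => ?_⟩
    rw [planarKernel, he x hx y hy]
    refine ENNReal.ofReal_le_ofReal ?_
    have h1 := abs_inner_unit_le hn (x - y)
    rw [he x hx y hy] at h1
    rcases (abs_nonneg e).eq_or_lt with h0 | h0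
    · rw [← h0]; simp
    · calc _ ≤ |e| / |e| ^ 3 := by gcongr
        _ = _ := by field_simp
  refine planarBound_of_schur (u := fun _ => 1) (w := fun _ => 1) measurable_const measurable_const
    (ENNReal.mul_ne_top hM hTf) (ENNReal.mul_ne_top hM hSf) (by simp) (by simp) (by simp) (by simp)
    ((ae_restrict_iff' hSm).2 (ae_of_all _ fun x hx => ?_))
    ((ae_restrict_iff' hTm).2 (ae_of_all _ fun y hy => ?_))
  · simp only [one_pow, mul_one]
    rw [← setLIntegral_const]
    exact setLIntegral_mono' hTm fun y hy => hKe x hx y hy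
  · simp only [one_pow, mul_one]
    rw [← setLIntegral_const]
    exact setLIntegral_mono' hSm fun x hx => hKe x hx y hy

/-- The kernel of the double-layer operator between two bounded plane sets is that of an operator
that is absolutely bounded on `L²`, and so is the transposed kernel. -/
theorem planarBound (hm : ‖m‖ = 1) (hn : ‖n‖ = 1) (c d : ℝ)
    (hS : S ⊆ {x | inner ℝ m x = d}) (hT : T ⊆ {x | inner ℝ n x = c}) (hSm : MeasurableSet S)
    (hTm : MeasurableSet T) (hSf : (μHE[2] : Measure E3) S ≠ ⊤) (hTf : (μHE[2] : Measure E3) T ≠ ⊤) :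
    PlanarBound n S T := by
  by_cases h1 : m = n
  · subst h1
    refine planarBound_of_const (e := d - c) hn hSm hTm hSf hTf fun x hx y hy => ?_
    have h1 : inner ℝ m x = d := hS hx
    have h2 : inner ℝ m y = c := hT hy
    rw [inner_sub_right, h1, h2]
  by_cases h2 : m = -n
  · subst h2
    refine planarBound_of_const (e := -d - c) hn hSm hTm hSf hTf fun x hx y hy => ?_
    have h1 : inner ℝ (-n) x = d := hS hx
    have h2 : inner ℝ n y = c := hT hy
    rw [inner_neg_left] at h1
    rw [inner_sub_right, h2]
    linarith
  have : IsFiniteMeasure ((μHE[2] : Measure E3).restrict S) := ⟨by simpa using hSf.lt_top⟩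
  have : IsFiniteMeasure ((μHE[2] : Measure E3).restrict T) := ⟨by simpa using hTf.lt_top⟩
  have h1' : n ≠ m := fun h => h1 h.symm
  have h2' : n ≠ -m := fun h => h2 (by rw [h, neg_neg])
  obtain ⟨A, hA, hrow⟩ := lintegral_planarKernel_row hm hn h1 h2 c d hT
  obtain ⟨B, hB, hcol⟩ := lintegral_planarKernel_column hm hn c d hS
  simp only [← ofReal_rpow_neg_quarter_sq (abs_nonneg _)] at hrow hcol
  have hu : ∀ (q : E3) (e : ℝ), Measurable fun y : E3 =>
      ENNReal.ofReal (|inner ℝ q y - e| ^ (-(1 / 4) : ℝ)) := fun q e => by fun_prop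
  have hne := ae_inner_ne hm hn h1 h2 c d hT hTm
  have hne' := ae_inner_ne hn hm h1' h2' d c hS hSm
  have hpos : ∀ {q : E3} {e : ℝ} {y : E3}, inner ℝ q y ≠ e →
      ENNReal.ofReal (|inner ℝ q y - e| ^ (-(1 / 4) : ℝ)) ≠ 0 := fun {q e y} h => by
    have := abs_pos.2 (sub_ne_zero.2 h)
    exact (ENNReal.ofReal_pos.2 (by positivity)).ne'
  refine planarBound_of_schur (hu m d) (hu n c) hA hB (fun _ => ENNReal.ofReal_ne_top)
    (fun _ => ENNReal.ofReal_ne_top) (hne.mono fun y hy => hpos hy)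
    (hne'.mono fun y hy => hpos hy) (ae_of_all _ hrow) ?_
  filter_upwards [hne, ae_restrict_mem hTm] with y hy hyT
  exact hcol y (hT hyT) hy

end

end OpenBook

end

noncomputable section

namespace OpenBook

/-! ### The outward normal near a flat point of a surface -/

/-- The union of the bounded components of the complement of `Γ`. -/
def enclosed (Γ : Set E3) : Set E3 :=
  {x | x ∈ Γᶜ ∧ Bornology.IsBounded (connectedComponentIn Γᶜ x)}

theorem mem_enclosed_iff_of_isPreconnected {Γ P : Set E3} (hP : IsPreconnected P) (hPΓ : P ⊆ Γᶜ)
    {x y : E3} (hx : x ∈ P) (hy : y ∈ P) : x ∈ enclosed Γ ↔ y ∈ enclosed Γ := by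
  have h : connectedComponentIn Γᶜ x = connectedComponentIn Γᶜ y :=
    connectedComponentIn_eq (hP.subset_connectedComponentIn hx hPΓ hy)
  constructor
  · rintro ⟨-, h1⟩
    exact ⟨hPΓ hy, h ▸ h1⟩
  · rintro ⟨-, h1⟩
    exact ⟨hPΓ hx, h ▸ h1⟩

theorem eventually_add_smul_mem {y v : E3} {P : E3 → Prop} (h : ∀ᶠ x in 𝓝 y, P x) :
    ∀ᶠ t : ℝ in 𝓝[>] 0, P (y + t • v) := by
  have hc : Tendsto (fun t : ℝ => y + t • v) (𝓝[>] 0) (𝓝 y) := by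
    have : Continuous fun t : ℝ => y + t • v := by fun_prop
    simpa using (this.tendsto 0).mono_left nhdsWithin_le_nhds
  exact hc.eventually h

theorem IsOutwardUnitNormal.eventually_mem {Ω : Set E3} {y ν v : E3}
    (h : IsOutwardUnitNormal Ω y ν) (hv : inner ℝ v ν < 0) :
    ∀ᶠ t : ℝ in 𝓝[>] 0, y + t • v ∈ Ω := by
  have hv0 : v ≠ 0 := by rintro rfl; simp at hv
  have hvn : 0 < ‖v‖ := norm_pos_iff.2 hv0
  have h1 := eventually_add_smul_mem (v := v) (h.2 (-(inner ℝ v ν) / (2 * ‖v‖)) (by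
    have : 0 < -(inner ℝ v ν : ℝ) := by linarith
    positivity))
  filter_upwards [h1, self_mem_nhdsWithin] with t ht ht0
  have ht0' : 0 < t := ht0
  refine ht.1 ?_
  rw [add_sub_cancel_left, inner_smul_left, norm_smul, Real.norm_of_nonneg ht0'.le]
  have : -(inner ℝ v ν) / (2 * ‖v‖) * (t * ‖v‖) = -(inner ℝ v ν) * t / 2 := by field_simp
  rw [this, conj_trivial]
  nlinarith

theorem IsOutwardUnitNormal.eventually_notMem {Ω : Set E3} {y ν v : E3}
    (h : IsOutwardUnitNormal Ω y ν) (hv : 0 < inner ℝ v ν) :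
    ∀ᶠ t : ℝ in 𝓝[>] 0, y + t • v ∉ Ω := by
  have hv0 : v ≠ 0 := by rintro rfl; simp at hv
  have hvn : 0 < ‖v‖ := norm_pos_iff.2 hv0
  have h1 := eventually_add_smul_mem (v := v) (h.2 ((inner ℝ v ν) / (2 * ‖v‖)) (by positivity))
  filter_upwards [h1, self_mem_nhdsWithin] with t ht ht0
  have ht0' : 0 < t := ht0
  refine ht.2 ?_
  rw [add_sub_cancel_left, inner_smul_left, norm_smul, Real.norm_of_nonneg ht0'.le]
  have : (inner ℝ v ν) / (2 * ‖v‖) * (t * ‖v‖) = (inner ℝ v ν) * t / 2 := by field_simp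
  rw [this, conj_trivial]
  nlinarith

/-- The point of the proof is uniqueness: if `ν` were another outward unit normal, the direction `n
- ν` would point out of the set by `n` and into it by `ν`. -/
theorem outwardNormal_eq_of_sides {Ω : Set E3} {y n : E3} (hn : ‖n‖ = 1)
    (hin : ∀ᶠ x in 𝓝 y, inner ℝ n (x - y) < 0 → x ∈ Ω)
    (hout : ∀ᶠ x in 𝓝 y, 0 < inner ℝ n (x - y) → x ∉ Ω) : outwardNormal Ω y = n := by
  have hI : IsOutwardUnitNormal Ω y n := by
    refine ⟨hn, fun ε hε => ?_⟩
    filter_upwards [hin, hout] with x h1 h2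
    have : 0 ≤ ε * ‖x - y‖ := by positivity
    rw [real_inner_comm]
    exact ⟨fun h => h1 (by linarith), fun h => h2 (by linarith)⟩
  have hex : ∃ ν, IsOutwardUnitNormal Ω y ν := ⟨n, hI⟩
  rw [outwardNormal, dif_pos hex]
  have hν := hex.choose_spec
  set ν := hex.choose
  by_contra hne
  have h1 : inner ℝ n ν < 1 := (inner_lt_one_iff_real_of_norm_eq_one hn hν.1).2 fun h => hne h.symm
  have hnn : inner ℝ n n = (1 : ℝ) := by rw [real_inner_self_eq_norm_sq, hn]; simp
  have hνν : inner ℝ ν ν = (1 : ℝ) := by rw [real_inner_self_eq_norm_sq, hν.1]; simp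
  have h2 := hν.eventually_mem (v := n - ν) (by rw [inner_sub_left, hνν]; linarith)
  have h3 := hI.eventually_notMem (v := n - ν) (by
    rw [inner_sub_left, hnn, real_inner_comm]; linarith)
  obtain ⟨t, ht1, ht2⟩ := (h2.and h3).exists
  exact ht2 ht1

/-- Near `y`, `Γ` is the plane through `y` with normal `n`. -/
def FlatAt (Γ : Set E3) (y n : E3) (r : ℝ) : Prop :=
  ‖n‖ = 1 ∧ ∀ x ∈ Metric.ball y r, x ∈ Γ ↔ inner ℝ n (x - y) = 0

theorem FlatAt.mem_enclosed_iff {Γ : Set E3} {y n : E3} {r : ℝ} (h : FlatAt Γ y n r) {x z : E3}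
    (hx : x ∈ Metric.ball y r) (hz : z ∈ Metric.ball y r) (hx0 : 0 < inner ℝ n (x - y))
    (hz0 : 0 < inner ℝ n (z - y)) : x ∈ enclosed Γ ↔ z ∈ enclosed Γ := by
  refine mem_enclosed_iff_of_isPreconnected (P := Metric.ball y r ∩ {x | 0 < inner ℝ n (x - y)})
    ?_ ?_ ⟨hx, hx0⟩ ⟨hz, hz0⟩
  · refine ((convex_ball y r).inter ?_).isPreconnected
    intro u hu v hv a b ha hb hab
    change 0 < inner ℝ n (u - y) at hu
    change 0 < inner ℝ n (v - y) at hv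
    change 0 < inner ℝ n (a • u + b • v - y)
    have : a • u + b • v - y = a • (u - y) + b • (v - y) := by
      rw [smul_sub, smul_sub, sub_add_sub_comm, ← add_smul, hab, one_smul]
    rw [this, inner_add_right, inner_smul_right, inner_smul_right]
    rcases ha.eq_or_lt with h0 | h0
    · have : b = 1 := by linarith
      rw [← h0, this]; linarith
    · have := mul_pos h0 hu
      have := mul_nonneg hb hv.le
      linarith
  · rintro u ⟨hu, hu0⟩ huΓ
    have h1 := (h.2 u hu).1 huΓ
    change 0 < inner ℝ n (u - y) at hu0
    linarith

theorem FlatAt.neg {Γ : Set E3} {y n : E3} {r : ℝ} (h : FlatAt Γ y n r) : FlatAt Γ y (-n) r :=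
  ⟨by rw [norm_neg, h.1], fun x hx => by rw [h.2 x hx, inner_neg_left, neg_eq_zero]⟩

/-- Each of the two open half-balls lies entirely inside or entirely outside of the enclosed set. If
they differ, the normal is `n` or `-n` throughout; if they agree, there is no outward normal and the
default `0` occurs. Boundedness and measurability need no more than this, so the side need not be
known. -/
theorem FlatAt.exists_outwardNormal {Γ : Set E3} {y n : E3} {r : ℝ} (hr : 0 < r)
    (h : FlatAt Γ y n r) : ∃ N : E3, (N = n ∨ N = -n ∨ N = 0) ∧
      ∀ z ∈ Metric.ball y r, z ∈ Γ → outwardNormal (enclosed Γ) z = N := by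
  have hn := h.1
  have hnn : inner ℝ n n = (1 : ℝ) := by rw [real_inner_self_eq_norm_sq, hn]; simp
  have hside : ∀ m : E3, FlatAt Γ y m r → (∀ x ∈ Metric.ball y r, 0 < inner ℝ m (x - y) →
      x ∈ enclosed Γ) ∨ (∀ x ∈ Metric.ball y r, 0 < inner ℝ m (x - y) → x ∉ enclosed Γ) := by
    intro m hm
    have hmm : inner ℝ m m = (1 : ℝ) := by rw [real_inner_self_eq_norm_sq, hm.1]; simp
    have hw : y + (r / 2) • m ∈ Metric.ball y r := by
      rw [mem_ball_iff_norm, add_sub_cancel_left, norm_smul, hm.1, Real.norm_of_nonneg (by positivity)]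
      linarith
    have hw0 : 0 < inner ℝ m (y + (r / 2) • m - y) := by
      rw [add_sub_cancel_left, inner_smul_right, hmm]; linarith
    by_cases hc : y + (r / 2) • m ∈ enclosed Γ
    · exact Or.inl fun x hx hx0 => (hm.mem_enclosed_iff hx hw hx0 hw0).2 hc
    · exact Or.inr fun x hx hx0 hx1 => hc ((hm.mem_enclosed_iff hx hw hx0 hw0).1 hx1)
  have hinner : ∀ z ∈ Metric.ball y r, z ∈ Γ → ∀ x, inner ℝ n (x - z) = inner ℝ n (x - y) := by
    intro z hz hzΓ x
    have h1 := (h.2 z hz).1 hzΓ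
    have : x - z = (x - y) - (z - y) := by abel
    rw [this, inner_sub_right, h1, sub_zero]
  have hnear : ∀ z ∈ Metric.ball y r, ∀ᶠ x in 𝓝 z, x ∈ Metric.ball y r := fun z hz =>
    Metric.isOpen_ball.mem_nhds hz
  have hneg : ∀ x, inner ℝ (-n) (x - y) = -inner ℝ n (x - y) := fun x => inner_neg_left _ _
  rcases hside n h with hp | hp <;> rcases hside (-n) h.neg with hm | hm
  · refine ⟨0, Or.inr (Or.inr rfl), fun z hz hzΓ => ?_⟩
    rw [outwardNormal, dif_neg]
    rintro ⟨ν, hν⟩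
    have hνν : inner ℝ ν ν = (1 : ℝ) := by rw [real_inner_self_eq_norm_sq, hν.1]; simp
    -- An outward direction that is not tangent to the plane is needed, for points of the plane
    -- itself are not in the enclosed set.
    obtain ⟨v, hv1, hv2⟩ : ∃ v : E3, 0 < inner ℝ v ν ∧ inner ℝ n v ≠ 0 := by
      by_cases h0 : inner ℝ n ν = 0
      · refine ⟨ν + n, ?_, ?_⟩
        · rw [inner_add_left, hνν, h0]; norm_num
        · rw [inner_add_right, h0, hnn]; norm_num
      · exact ⟨ν, by rw [hνν]; norm_num, h0⟩
    obtain ⟨t, ⟨ht1, ht2⟩, ht3⟩ := ((hν.eventually_notMem hv1).and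
      (eventually_add_smul_mem (v := v) (hnear z hz)) |>.and self_mem_nhdsWithin).exists
    have ht3' : 0 < t := ht3
    have h1 : inner ℝ n (z + t • v - y) = t * inner ℝ n v := by
      rw [← hinner z hz hzΓ, add_sub_cancel_left, inner_smul_right]
    have h2 : t * inner ℝ n v ≠ 0 := mul_ne_zero ht3'.ne' hv2
    rcases lt_or_gt_of_ne h2 with h3 | h3
    · exact ht1 (hm _ ht2 (by rw [hneg, h1]; linarith))
    · exact ht1 (hp _ ht2 (by rw [h1]; linarith))
  · refine ⟨-n, Or.inr (Or.inl rfl), fun z hz hzΓ =>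
      outwardNormal_eq_of_sides h.neg.1 ?_ ?_⟩
    · filter_upwards [hnear z hz] with x hx hx0
      rw [inner_neg_left, hinner z hz hzΓ] at hx0
      exact hp x hx (by linarith)
    · filter_upwards [hnear z hz] with x hx hx0
      rw [inner_neg_left, hinner z hz hzΓ] at hx0
      exact hm x hx (by rw [hneg]; exact hx0)
  · refine ⟨n, Or.inl rfl, fun z hz hzΓ => outwardNormal_eq_of_sides hn ?_ ?_⟩
    · filter_upwards [hnear z hz] with x hx hx0
      rw [hinner z hz hzΓ] at hx0
      exact hm x hx (by rw [hneg]; linarith)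
    · filter_upwards [hnear z hz] with x hx hx0
      rw [hinner z hz hzΓ] at hx0
      exact hp x hx hx0
  · refine ⟨0, Or.inr (Or.inr rfl), fun z hz hzΓ => ?_⟩
    rw [outwardNormal, dif_neg]
    rintro ⟨ν, hν⟩
    have hνν : inner ℝ ν ν = (1 : ℝ) := by rw [real_inner_self_eq_norm_sq, hν.1]; simp
    obtain ⟨t, ht1, ht2⟩ := ((hν.eventually_mem (v := -ν) (by
      rw [inner_neg_left, hνν]; norm_num)).and
      (eventually_add_smul_mem (v := -ν) (hnear z hz))).exists
    rcases lt_trichotomy (inner ℝ n (z + t • -ν - y)) 0 with h3 | h3 | h3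
    · exact hm _ ht2 (by rw [hneg]; linarith) ht1
    · exact ht1.1 ((h.2 _ ht2).2 h3)
    · exact hp _ ht2 h3 ht1

/-! ### Surfaces made of finitely many plane convex pieces -/

section Pieces

variable {ι : Type*} [Fintype ι] {S : ι → Set E3} {n : ι → E3} {c : ι → ℝ}

/-- `S` is a finite family of compact convex subsets of the planes `⟪n i, ·⟫ = c i`. -/
structure PlanarPieces (S : ι → Set E3) (n : ι → E3) (c : ι → ℝ) : Prop where
  isCompact : ∀ i, IsCompact (S i)
  convex : ∀ i, Convex ℝ (S i)
  norm_eq_one : ∀ i, ‖n i‖ = 1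
  subset : ∀ i, S i ⊆ {x | inner ℝ (n i) x = c i}

namespace PlanarPieces

omit [Fintype ι] in
theorem hausdorff_ne_top (h : PlanarPieces S n c) (i : ι) : (μHE[2] : Measure E3) (S i) ≠ ⊤ := by
  obtain ⟨b, p, -, -, hr⟩ := exists_planeChart (h.norm_eq_one i) (c i)
  exact (hausdorff_lt_top_of_isBounded b p (hr ▸ h.subset i) (h.isCompact i).isBounded).ne

theorem isFiniteMeasure (h : PlanarPieces S n c) :
    IsFiniteMeasure ((μHE[2] : Measure E3).restrict (⋃ i, S i)) := by
  refine ⟨?_⟩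
  rw [Measure.restrict_apply_univ]
  exact (measure_iUnion_fintype_le _ _).trans_lt (ENNReal.sum_lt_top.2 fun i _ =>
    (h.hausdorff_ne_top i).lt_top)

omit [Fintype ι] in
-- In the chart the piece is a convex set, and the boundary of a convex set is Lebesgue null.
theorem ae_exists_ball_subset (h : PlanarPieces S n c) (i : ι) :
    ∀ᵐ y ∂(μHE[2] : Measure E3).restrict (S i), ∃ r > 0, ∀ x ∈ Metric.ball y r,
      inner ℝ (n i) x = c i → x ∈ S i := by
  obtain ⟨b, p, hb, hp, hr⟩ := exists_planeChart (h.norm_eq_one i) (c i)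
  have hconv : Convex ℝ (planeChart b p ⁻¹' S i) := by
    intro v hv w hw s t hs ht hst
    have h1 := h.convex i hv hw hs ht hst
    have h2 : planeChart b p (s • v + t • w) = s • planeChart b p v + t • planeChart b p w := by
      have h3 : p = s • p + t • p := by rw [← add_smul, hst, one_smul]
      simp only [planeChart, Prod.fst_add, Prod.snd_add, Prod.smul_fst, Prod.smul_snd, smul_eq_mul]
      nth_rewrite 1 [h3]
      module
    change planeChart b p (s • v + t • w) ∈ S i
    rw [h2]
    exact h1
  rw [ae_restrict_iff' (h.isCompact i).isClosed.measurableSet]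
  refine measure_mono_null (t := planeChart b p '' frontier (planeChart b p ⁻¹' S i)) ?_ ?_
  · intro y hy
    by_contra hyf
    refine hy fun hyS => ?_
    have hyr : y ∈ range (planeChart b p) := hr ▸ h.subset i hyS
    obtain ⟨v, rfl⟩ := hyr
    have hv : v ∈ interior (planeChart b p ⁻¹' S i) := by
      by_contra hv
      exact hyf ⟨v, ⟨subset_closure hyS, hv⟩, rfl⟩
    obtain ⟨r, hr0, hball⟩ := Metric.isOpen_iff.1 isOpen_interior v hv
    refine ⟨r, hr0, fun x hx hxc => ?_⟩
    have hxr : x ∈ range (planeChart b p) := hr ▸ hxc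
    obtain ⟨w, rfl⟩ := hxr
    suffices hw : w ∈ Metric.ball v r from (interior_subset (hball hw) : w ∈ planeChart b p ⁻¹' S i)
    have h1 : ‖planeChart b p w - planeChart b p v‖ ^ 2 = (v.1 - w.1) ^ 2 + (v.2 - w.2) ^ 2 := by
      obtain ⟨e0, e1, e2⟩ := inner_planeChart_sub b p (planeChart b p w) w
      rw [norm_sub_planeChart_sq, ← e2]
      rw [sub_self, inner_zero_right] at e0 e1 ⊢
      rw [show inner ℝ (b 0) (planeChart b p w - p) = w.1 by linarith,
        show inner ℝ (b 1) (planeChart b p w - p) = w.2 by linarith]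
      ring
    rw [mem_ball_iff_norm] at hx
    rw [Metric.mem_ball, Prod.dist_eq, Real.dist_eq, Real.dist_eq]
    refine max_lt (abs_lt_of_sq_lt_sq ?_ hr0.le) (abs_lt_of_sq_lt_sq ?_ hr0.le) <;>
      nlinarith [norm_nonneg (planeChart b p w - planeChart b p v), sq_nonneg (v.1 - w.1),
        sq_nonneg (v.2 - w.2)]
  · rw [hausdorff_planeChart b p (image_subset_range _ _),
      preimage_image_eq _ (measurableEmbedding_planeChart b p).injective]
    exact hconv.addHaar_frontier volume

/-- Almost every point of a piece is a relative interior point and avoids the lines in which the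
nonparallel planes of other pieces meet its plane. Any other piece through such a point is coplanar
and does no harm; pieces not containing the point are at a positive distance. -/
theorem ae_flatAt (h : PlanarPieces S n c) (i : ι) :
    ∀ᵐ y ∂(μHE[2] : Measure E3).restrict (S i), ∃ r > 0, FlatAt (⋃ j, S j) y (n i) r := by
  have hmi := (h.isCompact i).isClosed.measurableSet
  have h1 : ∀ j, ∀ᵐ y ∂(μHE[2] : Measure E3).restrict (S i),
      y ∈ S j → S j ⊆ {x | inner ℝ (n i) x = c i} := by
    intro j
    by_cases e1 : n j = n i
    · filter_upwards [ae_restrict_mem hmi] with y hyi hyj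
      have h2 : inner ℝ (n j) y = c j := h.subset j hyj
      have h3 : inner ℝ (n i) y = c i := h.subset i hyi
      intro x hx
      have h4 : inner ℝ (n j) x = c j := h.subset j hx
      change inner ℝ (n i) x = c i
      rw [← h3, ← e1, h2, h4]
    by_cases e2 : n j = -n i
    · filter_upwards [ae_restrict_mem hmi] with y hyi hyj
      have h2 : inner ℝ (n j) y = c j := h.subset j hyj
      have h3 : inner ℝ (n i) y = c i := h.subset i hyi
      intro x hx
      have h4 : inner ℝ (n j) x = c j := h.subset j hx
      change inner ℝ (n i) x = c i
      rw [e2, inner_neg_left] at h2 h4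
      linarith
    · filter_upwards [ae_inner_ne (h.norm_eq_one j) (h.norm_eq_one i) e1 e2 (c i) (c j)
        (h.subset i) hmi] with y hy hyj
      exact absurd (h.subset j hyj) hy
  filter_upwards [ae_all_iff.2 h1, h.ae_exists_ball_subset i, ae_restrict_mem hmi] with y hy hb hyi
  obtain ⟨r₁, hr₁, hb⟩ := hb
  have h2 : ∀ᶠ x in 𝓝 y, ∀ j, x ∈ S j → y ∈ S j := by
    rw [eventually_all]
    intro j
    by_cases hj : y ∈ S j
    · exact Eventually.of_forall fun _ _ => hj
    · filter_upwards [(h.isCompact j).isClosed.isOpen_compl.mem_nhds hj] with x hx hxj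
      exact absurd hxj hx
  obtain ⟨r₂, hr₂, hb₂⟩ := Metric.eventually_nhds_iff_ball.1 h2
  have hyc : inner ℝ (n i) y = c i := h.subset i hyi
  refine ⟨min r₁ r₂, lt_min hr₁ hr₂, h.norm_eq_one i, fun x hx => ?_⟩
  rw [inner_sub_right, hyc, sub_eq_zero]
  constructor
  · rintro hxΓ
    obtain ⟨j, hj⟩ := mem_iUnion.1 hxΓ
    exact hy j (hb₂ x (Metric.ball_subset_ball (min_le_right _ _) hx) j hj) hj
  · intro hxc
    exact mem_iUnion.2 ⟨i, hb x (Metric.ball_subset_ball (min_le_left _ _) hx) hxc⟩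

theorem isClosed_iUnion (h : PlanarPieces S n c) : IsClosed (⋃ i, S i) :=
  isClosed_iUnion_of_finite fun i => (h.isCompact i).isClosed

theorem ae_iUnion_iff {P : E3 → Prop} :
    (∀ᵐ y ∂(μHE[2] : Measure E3).restrict (⋃ i, S i), P y) ↔
      ∀ i, ∀ᵐ y ∂(μHE[2] : Measure E3).restrict (S i), P y :=
  ae_restrict_iUnion_iff _ _

/-- The normal is locally constant near the flat points of the surface; these form a relatively open
set of full measure. -/
theorem aestronglyMeasurable_outwardNormal (h : PlanarPieces S n c) :
    AEStronglyMeasurable (outwardNormal (enclosed (⋃ i, S i)))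
      ((μHE[2] : Measure E3).restrict (⋃ i, S i)) := by
  set Γ := ⋃ i, S i with hΓ
  set O : Set E3 := {x | ∃ y m r, FlatAt Γ y m r ∧ x ∈ Metric.ball y r} with hO
  have hOo : IsOpen O := by
    have : O = ⋃ (y : E3) (m : E3) (r : ℝ) (_ : FlatAt Γ y m r), Metric.ball y r := by
      ext x; simp [hO]
    rw [this]
    exact isOpen_iUnion fun y => isOpen_iUnion fun m => isOpen_iUnion fun r =>
      isOpen_iUnion fun _ => Metric.isOpen_ball
  have hcont : ContinuousOn (outwardNormal (enclosed Γ)) (Γ ∩ O) := by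
    rintro x ⟨hxΓ, y, m, r, hflat, hx⟩
    obtain ⟨N, -, hN⟩ := hflat.exists_outwardNormal (Metric.pos_of_mem_ball hx)
    refine ContinuousWithinAt.congr_of_eventuallyEq (f := fun _ => N) continuousWithinAt_const ?_
      (hN x hx hxΓ)
    filter_upwards [self_mem_nhdsWithin, mem_nhdsWithin_of_mem_nhds
      (Metric.isOpen_ball.mem_nhds hx)] with z hz hzb
    exact hN z hzb hz.1
  have hm : MeasurableSet (Γ ∩ O) := h.isClosed_iUnion.measurableSet.inter hOo.measurableSet
  have hae : (Γ ∩ O : Set E3) =ᵐ[(μHE[2] : Measure E3)] Γ := by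
    have h1 : ∀ᵐ y ∂(μHE[2] : Measure E3).restrict Γ, y ∈ O := by
      rw [ae_iUnion_iff]
      intro i
      filter_upwards [h.ae_flatAt i] with y hy
      obtain ⟨r, hr, hf⟩ := hy
      exact ⟨y, n i, r, hf, Metric.mem_ball_self hr⟩
    rw [ae_restrict_iff' h.isClosed_iUnion.measurableSet] at h1
    filter_upwards [h1] with y hy
    exact propext ⟨fun h => h.1, fun h => ⟨h, hy h⟩⟩
  rw [← Measure.restrict_congr_set hae]
  exact hcont.aestronglyMeasurable hm

theorem aestronglyMeasurable_dlKernel (h : PlanarPieces S n c) :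
    AEStronglyMeasurable (Function.uncurry (dlKernel (enclosed (⋃ i, S i))))
      (((μHE[2] : Measure E3).restrict (⋃ i, S i)).prod
        ((μHE[2] : Measure E3).restrict (⋃ i, S i))) := by
  have := h.isFiniteMeasure
  have h1 := h.aestronglyMeasurable_outwardNormal.comp_snd
    (μ := (μHE[2] : Measure E3).restrict (⋃ i, S i))
  have h2 : AEStronglyMeasurable (fun p : E3 × E3 => p.1 - p.2)
      (((μHE[2] : Measure E3).restrict (⋃ i, S i)).prod
        ((μHE[2] : Measure E3).restrict (⋃ i, S i))) :=
    (by fun_prop : Continuous fun p : E3 × E3 => p.1 - p.2).aestronglyMeasurable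
  have h3 : AEMeasurable (fun p : E3 × E3 => 4 * Real.pi * ‖p.1 - p.2‖ ^ 3)
      (((μHE[2] : Measure E3).restrict (⋃ i, S i)).prod
        ((μHE[2] : Measure E3).restrict (⋃ i, S i))) :=
    (by fun_prop : Measurable fun p : E3 × E3 => 4 * Real.pi * ‖p.1 - p.2‖ ^ 3).aemeasurable
  exact ((h2.inner (𝕜 := ℝ) h1).aemeasurable.div h3).aestronglyMeasurable

/-- Almost everywhere the normal is `±n i` or `0`, so the absolute value of the kernel is controlled
without knowledge of its sign. -/
theorem ae_enorm_dlKernel_le (h : PlanarPieces S n c) (i : ι) :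
    ∀ᵐ y ∂(μHE[2] : Measure E3).restrict (S i), ∀ x,
      ‖dlKernel (enclosed (⋃ i, S i)) x y‖ₑ ≤ planarKernel (n i) x y := by
  filter_upwards [h.ae_flatAt i, ae_restrict_mem (h.isCompact i).isClosed.measurableSet] with y hy
    hyi x
  obtain ⟨r, hr, hf⟩ := hy
  obtain ⟨N, hN, hNy⟩ := hf.exists_outwardNormal hr
  rw [dlKernel, hNy y (Metric.mem_ball_self hr) (mem_iUnion.2 ⟨i, hyi⟩), planarKernel,
    ← ofReal_norm]
  refine ENNReal.ofReal_le_ofReal ?_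
  have h1 : |inner ℝ (x - y) N| ≤ |inner ℝ (n i) (x - y)| := by
    rcases hN with rfl | rfl | rfl
    · rw [real_inner_comm]
    · rw [inner_neg_right, abs_neg, real_inner_comm]
    · simp
  have h2 : 1 ≤ 4 * Real.pi := by nlinarith [Real.pi_gt_three]
  rw [Real.norm_eq_abs, abs_div, abs_of_nonneg (show 0 ≤ 4 * Real.pi * ‖x - y‖ ^ 3 by positivity)]
  rcases (norm_nonneg (x - y)).eq_or_lt with h0 | h0
  · rw [← h0]; simp
  · calc _ ≤ |inner ℝ (n i) (x - y)| / (4 * Real.pi * ‖x - y‖ ^ 3) := by gcongr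
      _ ≤ |inner ℝ (n i) (x - y)| / (1 * ‖x - y‖ ^ 3) := by gcongr
      _ = _ := by rw [one_mul]

omit [Fintype ι] in
theorem planarBound (h : PlanarPieces S n c) (i j : ι) : PlanarBound (n j) (S i) (S j) :=
  OpenBook.planarBound (h.norm_eq_one i) (h.norm_eq_one j) _ _ (h.subset i) (h.subset j)
    (h.isCompact i).isClosed.measurableSet (h.isCompact j).isClosed.measurableSet
    (h.hausdorff_ne_top i) (h.hausdorff_ne_top j)

/-- Bounds between the pieces of a surface give a bound on the surface. -/
theorem absBounded_of_pieces {k : E3 → E3 → ℝ} {K : ι → ι → E3 → E3 → ENNReal}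
    (hK : ∀ i j, Measurable (Function.uncurry (K i j)))
    (hfin : ∀ j, (μHE[2] : Measure E3) (S j) ≠ ⊤)
    (hle : ∀ i, ∀ᵐ x ∂(μHE[2] : Measure E3).restrict (S i), ∀ j,
      ∀ᵐ y ∂(μHE[2] : Measure E3).restrict (S j), ‖k x y‖ₑ ≤ K i j x y)
    (hB : ∀ i j, ∃ C : ENNReal, C ≠ ⊤ ∧ ∀ f : E3 → ENNReal, Measurable f →
      ∫⁻ x in S i, (∫⁻ y in S j, K i j x y * f y ∂(μHE[2] : Measure E3)) ^ 2
        ∂(μHE[2] : Measure E3) ≤ C * ∫⁻ y in S j, f y ^ 2 ∂(μHE[2] : Measure E3)) :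
    AbsBounded ((μHE[2] : Measure E3).restrict (⋃ i, S i)) k := by
  choose C hC hB using hB
  refine ⟨∑ i, (Fintype.card ι : ENNReal) * ∑ j, C i j, ?_, fun f hf => ?_⟩
  · exact (ENNReal.sum_lt_top.2 fun i _ => ENNReal.mul_lt_top (by finiteness)
      (ENNReal.sum_lt_top.2 fun j _ => (hC i j).lt_top)).ne
  have hfinm : ∀ j, IsFiniteMeasure ((μHE[2] : Measure E3).restrict (S j)) := fun j =>
    ⟨by simpa using (hfin j).lt_top⟩
  refine (lintegral_iUnion_le _ _).trans ?_
  rw [tsum_fintype, Finset.sum_mul]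
  refine Finset.sum_le_sum fun i _ => ?_
  calc _ ≤ ∫⁻ x in S i, (Fintype.card ι : ENNReal) * ∑ j,
          (∫⁻ y in S j, K i j x y * f y ∂(μHE[2] : Measure E3)) ^ 2 ∂(μHE[2] : Measure E3) := by
        refine lintegral_mono_ae ?_
        filter_upwards [hle i] with x hx
        have h1 : ∫⁻ y in ⋃ i, S i, ‖k x y‖ₑ * f y ∂(μHE[2] : Measure E3)
            ≤ ∑ j, ∫⁻ y in S j, K i j x y * f y ∂(μHE[2] : Measure E3) := by
          refine (lintegral_iUnion_le _ _).trans ?_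
          rw [tsum_fintype]
          refine Finset.sum_le_sum fun j _ => lintegral_mono_ae ?_
          filter_upwards [hx j] with y hy
          exact mul_le_mul_left hy _
        refine (pow_le_pow_left' h1 2).trans ?_
        -- The square of a sum over the pieces is at most their number times the sum of the squares.
        have h2 := ENNReal.rpow_sum_le_const_mul_sum_rpow Finset.univ
          (fun j => ∫⁻ y in S j, K i j x y * f y ∂(μHE[2] : Measure E3)) (p := 2) (by norm_num)
        norm_num at h2
        exact h2
    _ = (Fintype.card ι : ENNReal) * ∑ j, ∫⁻ x in S i,
          (∫⁻ y in S j, K i j x y * f y ∂(μHE[2] : Measure E3)) ^ 2 ∂(μHE[2] : Measure E3) := by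
        have hmeas : ∀ j, Measurable fun x =>
            (∫⁻ y in S j, K i j x y * f y ∂(μHE[2] : Measure E3)) ^ 2 := fun j => by
          have h3 : Measurable (Function.uncurry fun x y => K i j x y * f y) :=
            (hK i j).mul (hf.comp measurable_snd)
          exact (h3.lintegral_prod_right').pow_const 2
        rw [lintegral_const_mul' _ _ (by finiteness), lintegral_finsetSum _ fun j _ => hmeas j]
    _ ≤ (Fintype.card ι : ENNReal) * ∑ j, C i j *
          ∫⁻ y in ⋃ i, S i, f y ^ 2 ∂(μHE[2] : Measure E3) := by
        refine mul_le_mul_right (Finset.sum_le_sum fun j _ => (hB i j f hf).trans ?_) _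
        exact mul_le_mul_right (lintegral_mono_set (subset_iUnion S j)) _
    _ = _ := by rw [mul_assoc, Finset.sum_mul]

theorem absBounded_dlKernel (h : PlanarPieces S n c) :
    AbsBounded ((μHE[2] : Measure E3).restrict (⋃ i, S i)) (dlKernel (enclosed (⋃ i, S i))) :=
  absBounded_of_pieces (K := fun _ j => planarKernel (n j)) (fun _ j => measurable_planarKernel (n j))
    h.hausdorff_ne_top
    (fun _ => ae_of_all _ fun x j => (h.ae_enorm_dlKernel_le j).mono fun _ hy => hy x)
    fun i j => by
      obtain ⟨C, hC, h1, -⟩ := h.planarBound i j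
      exact ⟨C, hC, h1⟩

theorem absBounded_dlKernel_swap (h : PlanarPieces S n c) :
    AbsBounded ((μHE[2] : Measure E3).restrict (⋃ i, S i))
      (fun x y => dlKernel (enclosed (⋃ i, S i)) y x) :=
  absBounded_of_pieces (K := fun i _ x y => planarKernel (n i) y x)
    (fun i _ => measurable_planarKernel_swap (n i)) h.hausdorff_ne_top
    (fun i => (h.ae_enorm_dlKernel_le i).mono fun _ hx _ => ae_of_all _ fun y => hx y)
    fun i j => by
      obtain ⟨C, hC, -, h1⟩ := h.planarBound j i
      exact ⟨C, hC, h1⟩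

theorem exists_operators (h : PlanarPieces S n c) {Γ : Set E3} (hΓ : Γ = ⋃ i, S i) :
    ∃ D D' : Lp ℂ 2 ((μHE[2] : Measure E3).restrict Γ) →L[ℂ]
        Lp ℂ 2 ((μHE[2] : Measure E3).restrict Γ),
      (∀ φ, ∀ᵐ x ∂(μHE[2] : Measure E3).restrict Γ,
        Integrable (fun y => dlKernel (enclosed Γ) x y • φ y) ((μHE[2] : Measure E3).restrict Γ) ∧
          D φ x = ∫ y, dlKernel (enclosed Γ) x y • φ y ∂(μHE[2] : Measure E3).restrict Γ) ∧
      (∀ φ, ∀ᵐ x ∂(μHE[2] : Measure E3).restrict Γ,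
        Integrable (fun y => dlKernel (enclosed Γ) y x • φ y) ((μHE[2] : Measure E3).restrict Γ) ∧
          D' φ x = ∫ y, dlKernel (enclosed Γ) y x • φ y ∂(μHE[2] : Measure E3).restrict Γ) ∧
      D' = D.adjoint := by
  subst hΓ
  have := h.isFiniteMeasure
  have hk := h.aestronglyMeasurable_dlKernel
  obtain ⟨D, hD⟩ := exists_kernelOperator hk h.absBounded_dlKernel
  obtain ⟨D', hD'⟩ := exists_kernelOperator hk.prod_swap h.absBounded_dlKernel_swap
  exact ⟨D, D', hD, hD', kernelOperator_eq_adjoint hk h.absBounded_dlKernel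
    (fun φ => (hD φ).mono fun _ h => h.2) fun φ => (hD' φ).mono fun _ h => h.2⟩

end PlanarPieces

end Pieces

end OpenBook

end

noncomputable section
namespace OpenBook

/-! ### The cross-section of a page in the frame of the page -/

/-- The parameters of a page: `S` and `C` are the sine and cosine of half the angle of the page, `c`
is the distance of the lower outer edge from the spine, and `a`, `b` measure how far the front and
the back of the page are tilted. -/
structure PageShape (S C c a b : ℝ) : Prop where
  S_pos : 0 < S
  C_pos : 0 < C
  sq : S ^ 2 + C ^ 2 = 1
  cos_pos : 0 < C ^ 2 - S ^ 2
  c_pos : 0 < c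
  c_lt : c < C
  a_nonneg : 0 ≤ a
  b_nonneg : 0 ≤ b
  a_lt : a * (C ^ 2 - S ^ 2) < c
  b_lt : b * (C ^ 2 - S ^ 2) < c

/-- The page, in cartesian coordinates `p` (distance from the spine along the middle of the page),
`q` (distance from the middle of the page) and `h` (depth). -/
structure PageRegion (S C c a b p q h : ℝ) : Prop where
  front : 0 ≤ S * p + C * q + a * S * h
  back : 0 ≤ S * p - C * q + b * S * h
  left : 0 ≤ 2 * S * C * p + (C ^ 2 - S ^ 2) * q
  right : 0 ≤ 2 * S * C * p - (C ^ 2 - S ^ 2) * q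
  outer : p + (C - c) * h ≤ C
  h_nonneg : 0 ≤ h
  h_le : h ≤ 1

variable {S C c a b p q h : ℝ}

theorem PageShape.symm (H : PageShape S C c a b) : PageShape S C c b a :=
  ⟨H.1, H.2, H.3, H.4, H.5, H.6, H.8, H.7, H.10, H.9⟩

theorem PageRegion.symm (H : PageRegion S C c a b p q h) : PageRegion S C c b a p (-q) h :=
  ⟨by linarith [H.back], by linarith [H.front], by linarith [H.right], by linarith [H.left],
    H.outer, H.h_nonneg, H.h_le⟩

theorem PageRegion.p_nonneg (H : PageShape S C c a b) (R : PageRegion S C c a b p q h) : 0 ≤ p := by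
  have h1 := mul_pos H.S_pos H.C_pos
  have h2 := R.left
  have h3 := R.right
  by_contra hp
  nlinarith [mul_pos h1 (not_le.1 hp |> neg_pos.2)]

/-- The horizontal line at depth `h` cuts the face in a segment. If `s` is the relative position of
the point in it, the weights of the four vertices are the products of `1 - s`, `s` with `1 - h`,
`h`. -/
theorem PageRegion.exists_front_weights (H : PageShape S C c a b) (R : PageRegion S C c a b p q h)
    (hf : S * p + C * q + a * S * h = 0) :
    ∃ w₁ w₂ w₃ w₄ : ℝ, 0 ≤ w₁ ∧ 0 ≤ w₂ ∧ 0 ≤ w₃ ∧ 0 ≤ w₄ ∧ w₁ + w₂ + w₃ + w₄ = 1 ∧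
      p = w₂ * C + w₃ * (a * (C ^ 2 - S ^ 2)) + w₄ * c ∧
      q = w₂ * (-S) + w₃ * (-(a * (2 * S * C))) + w₄ * (-(S * (a + c) / C)) ∧
      h = w₃ + w₄ := by
  have hC := H.C_pos
  have hS := H.S_pos
  have hh := R.h_nonneg
  have hh1 := R.h_le
  set K := C ^ 2 - S ^ 2 with hK
  have hden : 0 < (1 - h) * C + h * (c - a * K) := by
    rcases hh.eq_or_lt with h0 | h0
    · rw [← h0]; linarith
    · have := mul_pos h0 (sub_pos.2 H.a_lt)
      have := mul_nonneg (sub_nonneg.2 hh1) hC.le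
      linarith
  set d := (1 - h) * C + h * (c - a * K) with hd
  have hlow : 0 ≤ p - h * (a * K) := by
    -- On the front plane the condition for the left wall turns into the lower bound for `p`; the
    -- outer wall gives the upper one.
    have h1 : C * (2 * S * C * p + K * q) = S * (p - h * (a * K)) := by
      have h3 : 2 * C ^ 2 - K = 1 := by linarith [H.sq]
      linear_combination K * hf + S * p * h3
    have h2 := mul_nonneg hC.le R.left
    rw [h1] at h2
    exact nonneg_of_mul_nonneg_right h2 hS
  have hup : p - h * (a * K) ≤ d := by linarith [R.outer]
  obtain ⟨s, hs⟩ : ∃ s, s = (p - h * (a * K)) / d := ⟨_, rfl⟩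
  have hs0 : 0 ≤ s := hs ▸ div_nonneg hlow hden.le
  have hs1 : s ≤ 1 := hs ▸ (div_le_one hden).2 hup
  have hsd : s * d = p - h * (a * K) := by rw [hs]; field_simp
  have hp : p = s * (1 - h) * C + (1 - s) * h * (a * K) + s * h * c := by rw [hd] at hsd; linarith
  refine ⟨(1 - s) * (1 - h), s * (1 - h), (1 - s) * h, s * h,
    mul_nonneg (by linarith) (by linarith), mul_nonneg hs0 (by linarith),
    mul_nonneg (by linarith) hh, mul_nonneg hs0 hh, by ring, hp, ?_, by ring⟩
  have hq : q = -(S * p + a * S * h) / C := by field_simp; linarith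
  rw [hq, hp]
  field_simp
  have h3 : K = 2 * C ^ 2 - 1 := by linarith [H.sq]
  rw [h3]
  ring

/-- Again the depth and the relative position in a horizontal segment serve as coordinates; the
segment now runs from the front wall to the back wall. -/
theorem PageRegion.exists_end_weights (H : PageShape S C c a b) (R : PageRegion S C c a b p q h)
    (hf : p + (C - c) * h = C) :
    ∃ w₁ w₂ w₃ w₄ : ℝ, 0 ≤ w₁ ∧ 0 ≤ w₂ ∧ 0 ≤ w₃ ∧ 0 ≤ w₄ ∧ w₁ + w₂ + w₃ + w₄ = 1 ∧
      p = w₁ * C + w₂ * C + w₃ * c + w₄ * c ∧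
      q = w₁ * (-S) + w₂ * S + w₃ * (-(S * (a + c) / C)) + w₄ * (S * (b + c) / C) ∧
      h = w₃ + w₄ := by
  have hC := H.C_pos
  have hS := H.S_pos
  have hh := R.h_nonneg
  have hh1 := R.h_le
  have hden : 0 < S * (2 * p + (a + b) * h) := by
    have : 0 < p := by nlinarith [H.c_lt, H.c_pos]
    have := mul_nonneg (add_nonneg H.a_nonneg H.b_nonneg) hh
    exact mul_pos hS (by linarith)
  set d := S * (2 * p + (a + b) * h) with hd
  obtain ⟨s, hs⟩ : ∃ s, s = (S * p + C * q + a * S * h) / d := ⟨_, rfl⟩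
  have hs0 : 0 ≤ s := hs ▸ div_nonneg R.front hden.le
  have hs1 : s ≤ 1 := hs ▸ (div_le_one hden).2 (by linarith [R.back])
  have hsd : s * d = S * p + C * q + a * S * h := by rw [hs]; field_simp
  have hp : p = (1 - h) * C + h * c := by linarith
  refine ⟨(1 - s) * (1 - h), s * (1 - h), (1 - s) * h, s * h,
    mul_nonneg (by linarith) (by linarith), mul_nonneg hs0 (by linarith),
    mul_nonneg (by linarith) hh, mul_nonneg hs0 hh, by ring, by rw [hp]; ring, ?_, by ring⟩
  have hq : q = (s * d - S * p - a * S * h) / C := by field_simp; linarith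
  rw [hq, hd, hp]
  field_simp
  ring

theorem PageRegion.exists_top_weights (H : PageShape S C c a b) (R : PageRegion S C c a b p q h)
    (hf : h = 0) :
    ∃ w₁ w₂ w₃ : ℝ, 0 ≤ w₁ ∧ 0 ≤ w₂ ∧ 0 ≤ w₃ ∧ w₁ + w₂ + w₃ = 1 ∧
      p = w₂ * C + w₃ * C ∧ q = w₂ * (-S) + w₃ * S := by
  have hC := H.C_pos
  have hS := H.S_pos
  have h1 := R.front
  have h2 := R.back
  have h3 := R.outer
  rw [hf] at h1 h2 h3
  simp only [mul_zero, add_zero] at h1 h2 h3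
  refine ⟨1 - p / C, (S * p - C * q) / (2 * S * C), (S * p + C * q) / (2 * S * C),
    sub_nonneg.2 ((div_le_one hC).2 h3), by positivity, by positivity, ?_, ?_, ?_⟩ <;>
  · field_simp
    ring

/-- These are barycentric coordinates in the triangle formed by the foot of the spine and the inner
and outer lower vertices of the front. Their signs come from the left wall, from `hneg` and from the
front wall. -/
theorem PageRegion.exists_bottom_weights_side (H : PageShape S C c a b)
    (R : PageRegion S C c a b p q 1) (hneg : c * q + S * (a + c) / C * p < 0) :
    ∃ w₁ w₂ w₃ : ℝ, 0 ≤ w₁ ∧ 0 ≤ w₂ ∧ 0 ≤ w₃ ∧ w₁ + w₂ + w₃ = 1 ∧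
      p = w₂ * (a * (C ^ 2 - S ^ 2)) + w₃ * c ∧
      q = w₂ * (-(a * (2 * S * C))) + w₃ * (-(S * (a + c) / C)) := by
  have hC := H.C_pos
  have hS := H.S_pos
  have hf := R.front
  have hl := R.left
  set K := C ^ 2 - S ^ 2 with hK
  have hKC : K = 2 * C ^ 2 - 1 := by linarith [H.sq]
  have hcK := sub_pos.2 H.a_lt
  -- For `a = 0` the triangle degenerates, and the front wall would contradict `hneg`.
  have ha : 0 < a := by
    refine H.a_nonneg.lt_of_ne fun h0 => ?_
    rw [← h0] at hneg hf
    have : c * q + S * (0 + c) / C * p = c / C * (S * p + C * q + 0 * S * 1) := by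
      field_simp
      ring
    rw [this] at hneg
    have := mul_nonneg (div_nonneg H.c_pos.le hC.le) hf
    linarith
  have hden : 0 < S * (c - a * K) := mul_pos hS hcK
  have hneg' : c * C * q + S * (a + c) * p < 0 := by
    have : c * C * q + S * (a + c) * p = C * (c * q + S * (a + c) / C * p) := by field_simp
    rw [this]
    exact mul_neg_of_pos_of_neg hC hneg
  -- The weights `v` and `u` solve the `2 × 2` linear system by Cramer's rule.
  obtain ⟨v, hv⟩ : ∃ v, v = C * (2 * S * C * p + K * q) / (S * (c - a * K)) := ⟨_, rfl⟩
  obtain ⟨u, hu⟩ : ∃ u, u = -(c * C * q + S * (a + c) * p) / (a * (S * (c - a * K))) := ⟨_, rfl⟩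
  have hv' : v * (S * (c - a * K)) = C * (2 * S * C * p + K * q) := by
    rw [hv, div_mul_cancel₀ _ hden.ne']
  have hu' : u * (a * (S * (c - a * K))) = -(c * C * q + S * (a + c) * p) := by
    rw [hu, div_mul_cancel₀ _ (mul_pos ha hden).ne']
  have hv0 : 0 ≤ v := hv ▸ div_nonneg (mul_nonneg hC.le hl) hden.le
  have hu0 : 0 ≤ u := hu ▸ div_nonneg (by linarith) (mul_nonneg ha.le hden.le)
  have hne : S * (c - a * K) ≠ 0 := hden.ne'
  have hpe : p = u * (a * K) + v * c := by
    refine mul_left_cancel₀ hne ?_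
    have : (S * (c - a * K)) * (u * (a * K) + v * c) =
      K * (u * (a * (S * (c - a * K)))) + c * (v * (S * (c - a * K))) := by ring
    rw [this, hv', hu', hKC]
    ring
  have hqe : C * q = u * (-(a * (2 * S * C))) * C + v * (-(S * (a + c))) := by
    refine mul_left_cancel₀ hne ?_
    have : (S * (c - a * K)) * (u * (-(a * (2 * S * C))) * C + v * (-(S * (a + c)))) =
      -(2 * S * C * C) * (u * (a * (S * (c - a * K)))) - S * (a + c) * (v * (S * (c - a * K))) := by
      ring
    rw [this, hv', hu', hKC]
    ring
  have huv : (1 - u - v) * (a * S) = S * p + C * q + a * S * 1 := by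
    rw [hqe, hpe, hKC]
    ring
  have huv0 : 0 ≤ 1 - u - v := by
    by_contra hlt
    have := mul_neg_of_neg_of_pos (not_le.1 hlt) (mul_pos ha hS)
    linarith
  refine ⟨1 - u - v, u, v, huv0, hu0, hv0, by ring, hpe, ?_⟩
  have : q = (u * (-(a * (2 * S * C))) * C + v * (-(S * (a + c)))) / C := by
    rw [← hqe]; field_simp
  rw [this]
  field_simp

theorem PageRegion.exists_bottom_weights_middle (H : PageShape S C c a b)
    (R : PageRegion S C c a b p q 1) (h₁ : 0 ≤ c * q + S * (a + c) / C * p)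
    (h₂ : 0 ≤ -(c * q) + S * (b + c) / C * p) :
    ∃ w₁ w₂ w₃ : ℝ, 0 ≤ w₁ ∧ 0 ≤ w₂ ∧ 0 ≤ w₃ ∧ w₁ + w₂ + w₃ = 1 ∧
      p = w₂ * c + w₃ * c ∧
      q = w₂ * (-(S * (a + c) / C)) + w₃ * (S * (b + c) / C) := by
  have hC := H.C_pos
  have hS := H.S_pos
  have hc := H.c_pos
  obtain ⟨d, hd⟩ : ∃ d, d = a + b + 2 * c := ⟨_, rfl⟩
  have hd0 : 0 < d := by linarith [H.a_nonneg, H.b_nonneg]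
  have ho := R.outer
  refine ⟨1 - p / c, (-(c * q) + S * (b + c) / C * p) / (c * S * d / C),
    (c * q + S * (a + c) / C * p) / (c * S * d / C),
    sub_nonneg.2 ((div_le_one hc).2 (by linarith)), by positivity, by positivity, ?_, ?_, ?_⟩ <;>
  · field_simp
    rw [hd]
    ring

/-- Away from the spine, the first page lies strictly on one side of the left wall. -/
theorem PageRegion.left_pos (H : PageShape S C c 0 b) (R : PageRegion S C c 0 b p q h)
    (hp : p ≠ 0 ∨ q ≠ 0) : 0 < 2 * S * C * p + (C ^ 2 - S ^ 2) * q := by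
  have hC := H.C_pos
  have hS := H.S_pos
  have h0 := R.p_nonneg H
  have hf : 0 ≤ S * p + C * q := by linarith [R.front]
  have hK := H.cos_pos
  have hid : C * (2 * S * C * p + (C ^ 2 - S ^ 2) * q) =
      (C ^ 2 - S ^ 2) * (S * p + C * q) + S * p := by
    linear_combination S * p * H.sq
  have hp' : 0 < p := by
    refine h0.lt_of_ne fun h1 => ?_
    have h2 := R.left
    have h3 := R.right
    rw [← h1] at h2 h3
    have : q = 0 := by
      have h4 : (C ^ 2 - S ^ 2) * q = 0 := by linarith
      exact (mul_eq_zero.1 h4).resolve_left hK.ne'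
    exact hp.elim (fun h => h h1.symm) fun h => h this
  have h5 : 0 < C * (2 * S * C * p + (C ^ 2 - S ^ 2) * q) := by
    rw [hid]
    have := mul_nonneg hK.le hf
    have := mul_pos hS hp'
    linarith
  exact pos_of_mul_pos_right h5 hC.le

section Vertices

variable (H : PageShape S C c a b)
include H

theorem pageRegion_spine (h0 : 0 ≤ h) (h1 : h ≤ 1) : PageRegion S C c a b 0 0 h := by
  have ha := mul_nonneg (mul_nonneg H.a_nonneg H.S_pos.le) h0
  have hb := mul_nonneg (mul_nonneg H.b_nonneg H.S_pos.le) h0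
  refine ⟨by linarith, by linarith, by linarith, by linarith, ?_, h0, h1⟩
  have : (C - c) * h ≤ (C - c) * 1 := mul_le_mul_of_nonneg_left h1 (by linarith [H.c_lt])
  linarith [H.c_pos]

theorem pageRegion_top : PageRegion S C c a b C (-S) 0 := by
  have hS := H.S_pos
  have hC := H.C_pos
  have hK := H.cos_pos
  refine ⟨by linarith, ?_, ?_, ?_, by linarith, le_rfl, zero_le_one⟩
  · nlinarith
  · nlinarith [mul_pos hS hK, mul_pos hS hS]
  · nlinarith [mul_pos hS hK, mul_pos hS (mul_pos hC hC)]

theorem pageRegion_inner : PageRegion S C c a b (a * (C ^ 2 - S ^ 2)) (-(a * (2 * S * C))) 1 := by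
  have hS := H.S_pos
  have hC := H.C_pos
  have hK := H.cos_pos
  have ha := H.a_nonneg
  have hb := H.b_nonneg
  refine ⟨?_, ?_, by nlinarith, ?_, by linarith [H.a_lt], zero_le_one, le_rfl⟩
  · have : S * (a * (C ^ 2 - S ^ 2)) + C * -(a * (2 * S * C)) + a * S * 1 = 0 := by
      linear_combination -a * S * H.sq
    rw [this]
  · have := mul_nonneg ha (mul_nonneg hS.le hK.le)
    have := mul_nonneg ha (mul_nonneg hC.le (mul_nonneg hS.le hC.le))
    have := mul_nonneg hb hS.le
    nlinarith
  · have := mul_nonneg ha (mul_nonneg (mul_pos hS hC).le hK.le)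
    nlinarith

theorem pageRegion_outer : PageRegion S C c a b c (-(S * (a + c) / C)) 1 := by
  have hS := H.S_pos
  have hC := H.C_pos
  have hK := H.cos_pos
  have ha := H.a_nonneg
  have hb := H.b_nonneg
  have hc := H.c_pos
  refine ⟨?_, ?_, ?_, ?_, by linarith, zero_le_one, le_rfl⟩
  · have : S * c + C * -(S * (a + c) / C) + a * S * 1 = 0 := by field_simp; ring
    rw [this]
  · have : S * c - C * -(S * (a + c) / C) + b * S * 1 = S * (2 * c + a + b) := by
      field_simp; ring
    rw [this]; positivity
  · have : 2 * S * C * c + (C ^ 2 - S ^ 2) * -(S * (a + c) / C) =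
        S / C * (c - a * (C ^ 2 - S ^ 2)) := by
      field_simp
      linear_combination c * H.sq
    rw [this]
    exact mul_nonneg (by positivity) (sub_nonneg.2 H.a_lt.le)
  · have : 0 ≤ (C ^ 2 - S ^ 2) * (S * (a + c) / C) := by positivity
    have : 0 ≤ 2 * S * C * c := by positivity
    linarith

end Vertices

end OpenBook
end

noncomputable section
namespace OpenBook

/-! ### Cylindrical frames -/

/-- The coordinate of `x` in the horizontal direction of angle `α`. -/
def radial (α : ℝ) (x : E3) : ℝ := Real.cos α * x 0 + Real.sin α * x 1

/-- The coordinate of `x` in the horizontal direction orthogonal to the angle `α`. -/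
def lateral (α : ℝ) (x : E3) : ℝ := -Real.sin α * x 0 + Real.cos α * x 1

/-- The depth of `x` below the top face. -/
def depth (x : E3) : ℝ := -x 2

/-- The point with given coordinates in the frame of angle `α`. -/
def framePt (α p q h : ℝ) : E3 :=
  !₂[p * Real.cos α - q * Real.sin α, p * Real.sin α + q * Real.cos α, -h]

theorem framePt_zero (α : ℝ) : framePt α 0 0 0 = 0 := by
  ext i; fin_cases i <;> simp [framePt]

@[simp] theorem radial_framePt (α p q h : ℝ) : radial α (framePt α p q h) = p := by
  simp only [radial, framePt, PiLp.toLp_apply, Matrix.cons_val_zero, Matrix.cons_val_one]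
  linear_combination p * Real.sin_sq_add_cos_sq α

@[simp] theorem lateral_framePt (α p q h : ℝ) : lateral α (framePt α p q h) = q := by
  simp only [lateral, framePt, PiLp.toLp_apply, Matrix.cons_val_zero, Matrix.cons_val_one]
  linear_combination q * Real.sin_sq_add_cos_sq α

@[simp] theorem depth_framePt (α p q h : ℝ) : depth (framePt α p q h) = h := by
  simp [depth, framePt]

theorem framePt_coords (α : ℝ) (x : E3) :
    framePt α (radial α x) (lateral α x) (depth x) = x := by
  have hs := Real.sin_sq_add_cos_sq α
  ext i
  fin_cases i
  · simp [framePt, radial, lateral]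
    linear_combination x 0 * hs
  · simp [framePt, radial, lateral]
    linear_combination x 1 * hs
  · simp [framePt, depth]

theorem radial_add (α β : ℝ) (x : E3) :
    radial (α + β) x = Real.cos β * radial α x + Real.sin β * lateral α x := by
  simp only [radial, lateral, Real.cos_add, Real.sin_add]; ring

theorem lateral_add (α β : ℝ) (x : E3) :
    lateral (α + β) x = -Real.sin β * radial α x + Real.cos β * lateral α x := by
  simp only [radial, lateral, Real.cos_add, Real.sin_add]; ring

theorem inner_framePt (α p q h : ℝ) (x : E3) :
    inner ℝ (framePt α p q h) x = p * radial α x + q * lateral α x + h * depth x := by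
  simp only [framePt, radial, lateral, depth, PiLp.inner_apply, Fin.sum_univ_three]
  simp
  ring

theorem norm_framePt_sq (α p q h : ℝ) : ‖framePt α p q h‖ ^ 2 = p ^ 2 + q ^ 2 + h ^ 2 := by
  rw [← real_inner_self_eq_norm_sq, inner_framePt]
  simp
  ring

theorem cyl_eq_framePt (α r β h : ℝ) :
    cyl r β h = framePt α (r * Real.cos (β - α)) (r * Real.sin (β - α)) (-h) := by
  rw [← framePt_coords α (cyl r β h)]
  congr 1
  · simp [radial, cyl, Real.cos_sub]; ring
  · simp [lateral, cyl, Real.sin_sub]; ring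

theorem continuous_radial (α : ℝ) : Continuous (radial α) := by unfold radial; fun_prop
theorem continuous_lateral (α : ℝ) : Continuous (lateral α) := by unfold lateral; fun_prop
theorem continuous_depth : Continuous depth := by unfold depth; fun_prop

theorem mem_convexHull_four {A₁ A₂ A₃ A₄ : E3} {w₁ w₂ w₃ w₄ : ℝ} (h₁ : 0 ≤ w₁) (h₂ : 0 ≤ w₂)
    (h₃ : 0 ≤ w₃) (h₄ : 0 ≤ w₄) (h : w₁ + w₂ + w₃ + w₄ = 1) :
    w₁ • A₁ + w₂ • A₂ + w₃ • A₃ + w₄ • A₄ ∈ convexHull ℝ ({A₁, A₂, A₃, A₄} : Set E3) := by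
  have := (convex_convexHull ℝ ({A₁, A₂, A₃, A₄} : Set E3)).sum_mem (t := Finset.univ)
    (w := ![w₁, w₂, w₃, w₄]) (z := ![A₁, A₂, A₃, A₄])
    (by intro i _; fin_cases i <;> simpa) (by simp [Fin.sum_univ_four, h])
    (by intro i _; apply subset_convexHull; fin_cases i <;> simp)
  simpa [Fin.sum_univ_four] using this

theorem mem_convexHull_three {A₁ A₂ A₃ : E3} {w₁ w₂ w₃ : ℝ} (h₁ : 0 ≤ w₁) (h₂ : 0 ≤ w₂)
    (h₃ : 0 ≤ w₃) (h : w₁ + w₂ + w₃ = 1) :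
    w₁ • A₁ + w₂ • A₂ + w₃ • A₃ ∈ convexHull ℝ ({A₁, A₂, A₃} : Set E3) := by
  have := (convex_convexHull ℝ ({A₁, A₂, A₃} : Set E3)).sum_mem (t := Finset.univ)
    (w := ![w₁, w₂, w₃]) (z := ![A₁, A₂, A₃])
    (by intro i _; fin_cases i <;> simpa) (by simp [Fin.sum_univ_three, h])
    (by intro i _; apply subset_convexHull; fin_cases i <;> simp)
  simpa [Fin.sum_univ_three] using this

theorem framePt_add (α p q h p' q' h' : ℝ) :
    framePt α (p + p') (q + q') (h + h') = framePt α p q h + framePt α p' q' h' := by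
  ext i; fin_cases i <;> simp [framePt] <;> ring

theorem framePt_smul (α w p q h : ℝ) :
    framePt α (w * p) (w * q) (w * h) = w • framePt α p q h := by
  ext i; fin_cases i <;> simp [framePt] <;> ring

theorem framePt_mem_convexHull_four {α p q h p₁ q₁ h₁ p₂ q₂ h₂ p₃ q₃ h₃ p₄ q₄ h₄ w₁ w₂ w₃ w₄ : ℝ}
    (hw₁ : 0 ≤ w₁) (hw₂ : 0 ≤ w₂) (hw₃ : 0 ≤ w₃) (hw₄ : 0 ≤ w₄) (hw : w₁ + w₂ + w₃ + w₄ = 1)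
    (hp : p = w₁ * p₁ + w₂ * p₂ + w₃ * p₃ + w₄ * p₄)
    (hq : q = w₁ * q₁ + w₂ * q₂ + w₃ * q₃ + w₄ * q₄)
    (hh : h = w₁ * h₁ + w₂ * h₂ + w₃ * h₃ + w₄ * h₄) :
    framePt α p q h ∈ convexHull ℝ ({framePt α p₁ q₁ h₁, framePt α p₂ q₂ h₂, framePt α p₃ q₃ h₃,
      framePt α p₄ q₄ h₄} : Set E3) := by
  rw [hp, hq, hh]
  simp only [framePt_add, framePt_smul]
  exact mem_convexHull_four hw₁ hw₂ hw₃ hw₄ hw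

theorem framePt_mem_convexHull_three {α p q h p₁ q₁ h₁ p₂ q₂ h₂ p₃ q₃ h₃ w₁ w₂ w₃ : ℝ}
    (hw₁ : 0 ≤ w₁) (hw₂ : 0 ≤ w₂) (hw₃ : 0 ≤ w₃) (hw : w₁ + w₂ + w₃ = 1)
    (hp : p = w₁ * p₁ + w₂ * p₂ + w₃ * p₃) (hq : q = w₁ * q₁ + w₂ * q₂ + w₃ * q₃)
    (hh : h = w₁ * h₁ + w₂ * h₂ + w₃ * h₃) :
    framePt α p q h ∈ convexHull ℝ ({framePt α p₁ q₁ h₁, framePt α p₂ q₂ h₂,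
      framePt α p₃ q₃ h₃} : Set E3) := by
  rw [hp, hq, hh]
  simp only [framePt_add, framePt_smul]
  exact mem_convexHull_three hw₁ hw₂ hw₃ hw

/-! ### The vertices of a page in its frame -/

variable {n : ℕ} {θ : ℝ}

/-- The angle of the middle of page `k`. -/
def midAngle (n : ℕ) (θ : ℝ) (k : ℕ) : ℝ := (2 * (k : ℝ) - 3 / 2) * pageAngle n θ

/-- The distance from the spine of the innermost lower vertex of the front of page `k`. -/
def frontShift (n : ℕ) (θ : ℝ) (k : ℕ) : ℝ := if k = 1 then 0 else r₂ n θ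

/-- The distance from the spine of the innermost lower vertex of the back of page `k`. -/
def backShift (n : ℕ) (θ : ℝ) (k : ℕ) : ℝ := if k = n then 0 else r₂ n θ

/-- The sine of half the angle of a page. -/
def halfSin (n : ℕ) (θ : ℝ) : ℝ := Real.sin (pageAngle n θ / 2)

/-- The cosine of half the angle of a page. -/
def halfCos (n : ℕ) (θ : ℝ) : ℝ := Real.cos (pageAngle n θ / 2)

/-- The distance from the spine of the lower outer edge of a page. -/
def lowerCos (n : ℕ) (θ : ℝ) : ℝ := Real.cos (pageAngle n θ / 2 + eta n θ)

theorem three_le_two_mul_sub_one (hn : 2 ≤ n) : (3 : ℝ) ≤ 2 * (n : ℝ) - 1 := by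
  have : (2 : ℝ) ≤ n := by exact_mod_cast hn
  linarith

theorem shift_cases_front (k : ℕ) : frontShift n θ k = 0 ∨ frontShift n θ k = r₂ n θ := by
  unfold frontShift; split_ifs <;> simp

theorem shift_cases_back (k : ℕ) : backShift n θ k = 0 ∨ backShift n θ k = r₂ n θ := by
  unfold backShift; split_ifs <;> simp

section Angles

variable (hn : 2 ≤ n) (hθ : 0 < θ) (hθπ : θ ≤ Real.pi)
include hn hθ

theorem pageAngle_pos : 0 < pageAngle n θ :=
  div_pos hθ (by linarith [three_le_two_mul_sub_one hn])

theorem eta_pos : 0 < eta n θ := by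
  have := pageAngle_pos hn hθ
  unfold eta
  positivity

theorem pageAngle_le : pageAngle n θ ≤ θ / 3 :=
  div_le_div_of_nonneg_left hθ.le (by norm_num) (three_le_two_mul_sub_one hn)

include hθπ

theorem eta_le : eta n θ ≤ pageAngle n θ / 4 := by
  have h1 := pageAngle_pos hn hθ
  unfold eta
  rw [div_le_iff₀ (by positivity)]
  nlinarith

theorem r₂_nonneg : 0 ≤ r₂ n θ := by
  have h1 := pageAngle_pos hn hθ
  have h2 := pageAngle_le hn hθ
  have h3 := eta_pos hn hθ
  have h4 := eta_le hn hθ hθπ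
  exact div_nonneg (Real.sin_nonneg_of_nonneg_of_le_pi h3.le (by linarith))
    (Real.sin_nonneg_of_nonneg_of_le_pi (by linarith) (by linarith))

theorem halfSin_pos : 0 < halfSin n θ :=
  Real.sin_pos_of_pos_of_lt_pi (by linarith [pageAngle_pos hn hθ])
    (by linarith [pageAngle_le hn hθ, pageAngle_pos hn hθ])

theorem halfCos_pos : 0 < halfCos n θ :=
  Real.cos_pos_of_mem_Ioo ⟨by linarith [pageAngle_pos hn hθ, Real.pi_pos],
    by linarith [pageAngle_le hn hθ, pageAngle_pos hn hθ]⟩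

theorem lowerCos_pos : 0 < lowerCos n θ := by
  have h1 := pageAngle_pos hn hθ
  have h2 := pageAngle_le hn hθ
  have h3 := eta_pos hn hθ
  have h4 := eta_le hn hθ hθπ
  exact Real.cos_pos_of_mem_Ioo ⟨by linarith [Real.pi_pos], by linarith⟩

theorem lowerCos_lt : lowerCos n θ < halfCos n θ := by
  have h1 := pageAngle_pos hn hθ
  have h2 := pageAngle_le hn hθ
  have h3 := eta_pos hn hθ
  have h4 := eta_le hn hθ hθπ
  exact Real.cos_lt_cos_of_nonneg_of_le_pi (by linarith) (by linarith) (by linarith)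

theorem r₂_mul_halfSin : r₂ n θ * halfSin n θ = Real.sin (eta n θ) :=
  div_mul_cancel₀ _ (halfSin_pos hn hθ hθπ).ne'

theorem halfCos_sq_sub_halfSin_sq_pos : 0 < halfCos n θ ^ 2 - halfSin n θ ^ 2 := by
  have h1 := pageAngle_pos hn hθ
  have h2 := pageAngle_le hn hθ
  unfold halfCos halfSin
  rw [← Real.cos_two_mul']
  exact Real.cos_pos_of_mem_Ioo ⟨by linarith [Real.pi_pos], by linarith⟩

/-- By the choice of `r₂`, a lower vertex at angle `θ_n/2 + η` from the middle of the page lies in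
the tilted plane of the face; the identity is the expansion of `sin η = sin ((θ_n/2 + η) - θ_n/2)`.
-/
theorem lowerCos_mul_halfSin : halfSin n θ * (r₂ n θ + lowerCos n θ) / halfCos n θ =
    Real.sin (pageAngle n θ / 2 + eta n θ) := by
  have hC := halfCos_pos hn hθ hθπ
  rw [div_eq_iff hC.ne', mul_add, mul_comm _ (r₂ n θ), r₂_mul_halfSin hn hθ hθπ]
  have : Real.sin (eta n θ) = Real.sin (pageAngle n θ / 2 + eta n θ - pageAngle n θ / 2) := by
    congr 1; ring
  rw [this, Real.sin_sub]
  unfold halfSin lowerCos halfCos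
  ring

/-- Multiplied by `sin (θ_n/2)`, the difference of the two sides is `cos (θ_n/2) sin (θ_n/2 - η)`,
which is positive because `η ≤ θ_n/4`. -/
theorem r₂_mul_lt : r₂ n θ * (halfCos n θ ^ 2 - halfSin n θ ^ 2) < lowerCos n θ := by
  have hC := halfCos_pos hn hθ hθπ
  have hS := halfSin_pos hn hθ hθπ
  have h1 := pageAngle_pos hn hθ
  have h2 := pageAngle_le hn hθ
  have h3 := eta_pos hn hθ
  have h4 := eta_le hn hθ hθπ
  have h5 : 0 < Real.sin (pageAngle n θ / 2 - eta n θ) :=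
    Real.sin_pos_of_pos_of_lt_pi (by linarith) (by linarith)
  have h6 : Real.sin (pageAngle n θ / 2 - eta n θ) =
      halfSin n θ * Real.cos (eta n θ) - halfCos n θ * Real.sin (eta n θ) := Real.sin_sub _ _
  have h7 : lowerCos n θ = halfCos n θ * Real.cos (eta n θ) - halfSin n θ * Real.sin (eta n θ) :=
    Real.cos_add _ _
  have h8 := Real.sin_sq_add_cos_sq (pageAngle n θ / 2)
  change halfSin n θ ^ 2 + halfCos n θ ^ 2 = 1 at h8
  refine lt_of_mul_lt_mul_right ?_ hS.le
  have h9 := mul_pos hC (h6 ▸ h5)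
  have h10 : r₂ n θ * (halfCos n θ ^ 2 - halfSin n θ ^ 2) * halfSin n θ =
    (halfCos n θ ^ 2 - halfSin n θ ^ 2) * Real.sin (eta n θ) := by
    rw [← r₂_mul_halfSin hn hθ hθπ]; ring
  rw [h10, h7]
  linarith

theorem pageShape (k : ℕ) : PageShape (halfSin n θ) (halfCos n θ) (lowerCos n θ)
    (frontShift n θ k) (backShift n θ k) := by
  have h0 := r₂_nonneg hn hθ hθπ
  have h1 := r₂_mul_lt hn hθ hθπ
  have h2 := lowerCos_pos hn hθ hθπ
  refine ⟨halfSin_pos hn hθ hθπ, halfCos_pos hn hθ hθπ, Real.sin_sq_add_cos_sq _,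
    halfCos_sq_sub_halfSin_sq_pos hn hθ hθπ, h2, lowerCos_lt hn hθ hθπ, ?_, ?_, ?_, ?_⟩
  · rcases shift_cases_front (n := n) (θ := θ) k with h | h <;> rw [h]; exact h0
  · rcases shift_cases_back (n := n) (θ := θ) k with h | h <;> rw [h]; exact h0
  · rcases shift_cases_front (n := n) (θ := θ) k with h | h <;> rw [h]
    · rwa [zero_mul]
    · exact h1
  · rcases shift_cases_back (n := n) (θ := θ) k with h | h <;> rw [h]
    · rwa [zero_mul]
    · exact h1

end Angles

theorem sin_pageAngle : Real.sin (pageAngle n θ) = 2 * halfSin n θ * halfCos n θ := by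
  rw [show pageAngle n θ = 2 * (pageAngle n θ / 2) by ring, Real.sin_two_mul]
  simp [halfSin, halfCos]

theorem cos_pageAngle : Real.cos (pageAngle n θ) = halfCos n θ ^ 2 - halfSin n θ ^ 2 := by
  rw [show pageAngle n θ = 2 * (pageAngle n θ / 2) by ring, Real.cos_two_mul']
  simp [halfSin, halfCos]

theorem yB_eq (k : ℕ) :
    yB n θ k = framePt (midAngle n θ k) (halfCos n θ) (-halfSin n θ) 0 := by
  rw [yB, cyl_eq_framePt (midAngle n θ k),
    show (2 * (k : ℝ) - 2) * pageAngle n θ - midAngle n θ k = -(pageAngle n θ / 2) by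
      unfold midAngle; ring, Real.cos_neg, Real.sin_neg]
  simp [halfSin, halfCos]

theorem yC_eq (k : ℕ) :
    yC n θ k = framePt (midAngle n θ k) (halfCos n θ) (halfSin n θ) 0 := by
  rw [yC, cyl_eq_framePt (midAngle n θ k),
    show (2 * (k : ℝ) - 1) * pageAngle n θ - midAngle n θ k = pageAngle n θ / 2 by
      unfold midAngle; ring]
  simp [halfSin, halfCos]

theorem yA_eq (k : ℕ) : yA = framePt (midAngle n θ k) 0 0 0 := (framePt_zero _).symm

theorem zA_one_eq (k : ℕ) : zA n θ 1 = framePt (midAngle n θ k) 0 0 1 := by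
  rw [zA, if_pos rfl, cyl_eq_framePt (midAngle n θ k)]
  simp

theorem zA_eq (k : ℕ) : zA n θ k = framePt (midAngle n θ k)
    (frontShift n θ k * (halfCos n θ ^ 2 - halfSin n θ ^ 2))
    (-(frontShift n θ k * (2 * halfSin n θ * halfCos n θ))) 1 := by
  by_cases hk : k = 1
  · subst hk
    rw [zA_one_eq 1, frontShift, if_pos rfl]
    simp
  · rw [zA, if_neg hk, frontShift, if_neg hk, cyl_eq_framePt (midAngle n θ k),
      show (2 * (k : ℝ) - 5 / 2) * pageAngle n θ - midAngle n θ k = -(pageAngle n θ) by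
        unfold midAngle; ring, Real.cos_neg, Real.sin_neg, sin_pageAngle, cos_pageAngle]
    simp

theorem zA_next_eq {k : ℕ} (hk0 : 1 ≤ k) : zA n θ (next n k) = framePt (midAngle n θ k)
    (backShift n θ k * (halfCos n θ ^ 2 - halfSin n θ ^ 2))
    (backShift n θ k * (2 * halfSin n θ * halfCos n θ)) 1 := by
  by_cases hk : k = n
  · rw [next, if_pos hk, zA_one_eq k, backShift, if_pos hk]
    simp
  · rw [next, if_neg hk, backShift, if_neg hk]
    rw [zA, if_neg (by omega), cyl_eq_framePt (midAngle n θ k),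
      show (2 * ((k + 1 : ℕ) : ℝ) - 5 / 2) * pageAngle n θ - midAngle n θ k = pageAngle n θ by
        unfold midAngle; push_cast; ring, sin_pageAngle, cos_pageAngle]
    simp

/-- The two clauses of the definition fit one formula: the front of the first page is vertical, and
`r₁` is chosen so that its lower outer vertex has the same distance `lowerCos` along the middle of
the page as the others. -/
theorem zB_eq (hn : 2 ≤ n) (hθ : 0 < θ) (hθπ : θ ≤ Real.pi) (k : ℕ) :
    zB n θ k = framePt (midAngle n θ k) (lowerCos n θ)
      (-(halfSin n θ * (frontShift n θ k + lowerCos n θ) / halfCos n θ)) 1 := by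
  have hC := halfCos_pos hn hθ hθπ
  by_cases hk : k = 1
  · rw [zB, if_pos hk, frontShift, if_pos hk, cyl_eq_framePt (midAngle n θ k),
      show (0 : ℝ) - midAngle n θ k = -(pageAngle n θ / 2) by
        rw [midAngle, hk]; push_cast; ring, Real.cos_neg, Real.sin_neg]
    change framePt _ (lowerCos n θ / halfCos n θ * halfCos n θ)
      (lowerCos n θ / halfCos n θ * -halfSin n θ) _ = _
    congr 1
    · field_simp
    · field_simp
      ring
    · norm_num
  · rw [zB, if_neg hk, frontShift, if_neg hk, lowerCos_mul_halfSin hn hθ hθπ,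
      cyl_eq_framePt (midAngle n θ k),
      show (2 * (k : ℝ) - 2) * pageAngle n θ - eta n θ - midAngle n θ k =
        -(pageAngle n θ / 2 + eta n θ) by unfold midAngle; ring, Real.cos_neg, Real.sin_neg]
    simp [lowerCos]

theorem zC_eq (hn : 2 ≤ n) (hθ : 0 < θ) (hθπ : θ ≤ Real.pi) (k : ℕ) :
    zC n θ k = framePt (midAngle n θ k) (lowerCos n θ)
      (halfSin n θ * (backShift n θ k + lowerCos n θ) / halfCos n θ) 1 := by
  have hC := halfCos_pos hn hθ hθπ
  by_cases hk : k = n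
  · rw [zC, if_pos hk, backShift, if_pos hk, cyl_eq_framePt (midAngle n θ k),
      show θ - midAngle n θ k = pageAngle n θ / 2 by
        have : (0 : ℝ) < 2 * (n : ℝ) - 1 := by linarith [three_le_two_mul_sub_one hn]
        rw [midAngle, hk, pageAngle]
        field_simp
        ring]
    change framePt _ (lowerCos n θ / halfCos n θ * halfCos n θ)
      (lowerCos n θ / halfCos n θ * halfSin n θ) _ = _
    congr 1
    · field_simp
    · field_simp
      ring
    · norm_num
  · rw [zC, if_neg hk, backShift, if_neg hk, lowerCos_mul_halfSin hn hθ hθπ,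
      cyl_eq_framePt (midAngle n θ k),
      show (2 * (k : ℝ) - 1) * pageAngle n θ + eta n θ - midAngle n θ k =
        pageAngle n θ / 2 + eta n θ by unfold midAngle; ring]
    simp [lowerCos]

end OpenBook
end

noncomputable section
namespace OpenBook

variable {n : ℕ} {θ : ℝ}

/-! ### The pages as convex polyhedra -/

/-- The convex hull of the faces of page `k` and the spine, described by its walls. -/
def page (n : ℕ) (θ : ℝ) (k : ℕ) : Set E3 :=
  {x | PageRegion (halfSin n θ) (halfCos n θ) (lowerCos n θ) (frontShift n θ k) (backShift n θ k)
    (radial (midAngle n θ k) x) (lateral (midAngle n θ k) x) (depth x)}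

/-- The faces of the polyhedron that belong to page `k`. -/
def pageBoundary (n : ℕ) (θ : ℝ) (k : ℕ) : Set E3 :=
  frontFace n θ k ∪ endFace n θ k ∪ backFace n θ k ∪ topFace n θ k ∪ bottomFace n θ k

theorem surface_eq : surface n θ = ⋃ k ∈ Finset.Icc 1 n, pageBoundary n θ k := rfl

/-- Affine form vanishing on the front of page `k`, positive inside. -/
def frontForm (n : ℕ) (θ : ℝ) (k : ℕ) (x : E3) : ℝ :=
  halfSin n θ * radial (midAngle n θ k) x + halfCos n θ * lateral (midAngle n θ k) x +
    frontShift n θ k * halfSin n θ * depth x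

/-- Affine form vanishing on the back of page `k`, positive inside. -/
def backForm (n : ℕ) (θ : ℝ) (k : ℕ) (x : E3) : ℝ :=
  halfSin n θ * radial (midAngle n θ k) x - halfCos n θ * lateral (midAngle n θ k) x +
    backShift n θ k * halfSin n θ * depth x

/-- Affine form equal to the cosine of half the page angle on the end of page `k`. -/
def endForm (n : ℕ) (θ : ℝ) (k : ℕ) (x : E3) : ℝ :=
  radial (midAngle n θ k) x + (halfCos n θ - lowerCos n θ) * depth x

/-- The distance from the vertical plane that bisects the angle between pages `k` and `k + 1`. -/
def gapForm (n : ℕ) (θ : ℝ) (k : ℕ) (x : E3) : ℝ := lateral (midAngle n θ k + pageAngle n θ) x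

theorem frontForm_eq (k : ℕ) (x : E3) : frontForm n θ k x = inner ℝ (framePt (midAngle n θ k)
    (halfSin n θ) (halfCos n θ) (frontShift n θ k * halfSin n θ)) x := by
  rw [inner_framePt, frontForm]

theorem backForm_eq (k : ℕ) (x : E3) : backForm n θ k x = inner ℝ (framePt (midAngle n θ k)
    (halfSin n θ) (-halfCos n θ) (backShift n θ k * halfSin n θ)) x := by
  rw [inner_framePt, backForm]; ring

theorem endForm_eq (k : ℕ) (x : E3) : endForm n θ k x = inner ℝ (framePt (midAngle n θ k)
    1 0 (halfCos n θ - lowerCos n θ)) x := by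
  rw [inner_framePt, endForm]; ring

theorem depth_eq (α : ℝ) (x : E3) : depth x = inner ℝ (framePt α 0 0 1) x := by
  rw [inner_framePt]; ring

theorem gapForm_eq (k : ℕ) (x : E3) : gapForm n θ k x =
    inner ℝ (framePt (midAngle n θ k + pageAngle n θ) 0 1 0) x := by
  rw [inner_framePt, gapForm]; ring

theorem gapForm_eq_right (k : ℕ) (x : E3) : -gapForm n θ k x =
    2 * halfSin n θ * halfCos n θ * radial (midAngle n θ k) x -
      (halfCos n θ ^ 2 - halfSin n θ ^ 2) * lateral (midAngle n θ k) x := by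
  rw [gapForm, lateral_add, sin_pageAngle, cos_pageAngle]; ring

theorem midAngle_succ (k : ℕ) :
    midAngle n θ (k + 1) = midAngle n θ k + pageAngle n θ + pageAngle n θ := by
  unfold midAngle; push_cast; ring

theorem gapForm_eq_left (k : ℕ) (x : E3) : gapForm n θ k x =
    2 * halfSin n θ * halfCos n θ * radial (midAngle n θ (k + 1)) x +
      (halfCos n θ ^ 2 - halfSin n θ ^ 2) * lateral (midAngle n θ (k + 1)) x := by
  rw [← sin_pageAngle, ← cos_pageAngle, gapForm,
    show midAngle n θ k + pageAngle n θ = midAngle n θ (k + 1) + -pageAngle n θ by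
      rw [midAngle_succ]; ring, lateral_add, Real.sin_neg, Real.cos_neg]
  ring

/-- Pages are numbered from `1`, so page `k + 1` lies between the planes with numbers `k` and `k +
1`. The planes `0` and `n`, before the first and after the last page, separate nothing but make all
pages alike. -/
theorem mem_page_iff {k : ℕ} {x : E3} : x ∈ page n θ (k + 1) ↔
    0 ≤ frontForm n θ (k + 1) x ∧ 0 ≤ backForm n θ (k + 1) x ∧ 0 ≤ gapForm n θ k x ∧
      gapForm n θ (k + 1) x ≤ 0 ∧ endForm n θ (k + 1) x ≤ halfCos n θ ∧ 0 ≤ depth x ∧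
      depth x ≤ 1 := by
  constructor
  · intro h
    exact ⟨h.front, h.back, by rw [gapForm_eq_left]; exact h.left,
      by have := h.right; rw [← gapForm_eq_right] at this; linarith, h.outer, h.h_nonneg, h.h_le⟩
  · rintro ⟨h1, h2, h3, h4, h5, h6, h7⟩
    exact ⟨h1, h2, by rwa [← gapForm_eq_left], by rw [← gapForm_eq_right]; linarith, h5, h6, h7⟩

theorem convex_inner_eq (m : E3) (c : ℝ) : Convex ℝ {x : E3 | inner ℝ m x = c} :=
  convex_hyperplane (f := fun x => inner ℝ m x)
    ⟨fun _ _ => inner_add_right _ _ _, fun _ _ => by rw [inner_smul_right]; rfl⟩ c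

theorem convex_le_inner (m : E3) (c : ℝ) : Convex ℝ {x : E3 | c ≤ inner ℝ m x} :=
  convex_halfSpace_ge (f := fun x => inner ℝ m x)
    ⟨fun _ _ => inner_add_right _ _ _, fun _ _ => by rw [inner_smul_right]; rfl⟩ c

theorem convex_inner_le (m : E3) (c : ℝ) : Convex ℝ {x : E3 | inner ℝ m x ≤ c} :=
  convex_halfSpace_le (f := fun x => inner ℝ m x)
    ⟨fun _ _ => inner_add_right _ _ _, fun _ _ => by rw [inner_smul_right]; rfl⟩ c

theorem page_eq (k : ℕ) : page n θ (k + 1) =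
    {x | 0 ≤ inner ℝ (framePt (midAngle n θ (k + 1)) (halfSin n θ) (halfCos n θ)
      (frontShift n θ (k + 1) * halfSin n θ)) x} ∩
    ({x | 0 ≤ inner ℝ (framePt (midAngle n θ (k + 1)) (halfSin n θ) (-halfCos n θ)
      (backShift n θ (k + 1) * halfSin n θ)) x} ∩
    ({x | 0 ≤ inner ℝ (framePt (midAngle n θ k + pageAngle n θ) 0 1 0) x} ∩
    ({x | inner ℝ (framePt (midAngle n θ (k + 1) + pageAngle n θ) 0 1 0) x ≤ 0} ∩
    ({x | inner ℝ (framePt (midAngle n θ (k + 1)) 1 0 (halfCos n θ - lowerCos n θ)) x ≤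
      halfCos n θ} ∩
    ({x | 0 ≤ inner ℝ (framePt 0 0 0 1) x} ∩ {x | inner ℝ (framePt 0 0 0 1) x ≤ 1}))))) := by
  ext x
  rw [mem_page_iff, frontForm_eq, backForm_eq, gapForm_eq, gapForm_eq, endForm_eq, depth_eq 0]
  rfl

theorem convex_page {k : ℕ} (hk : 1 ≤ k) : Convex ℝ (page n θ k) := by
  obtain ⟨k, rfl⟩ := Nat.exists_eq_add_of_le' hk
  rw [page_eq]
  exact (convex_le_inner _ _).inter ((convex_le_inner _ _).inter ((convex_le_inner _ _).inter
    ((convex_inner_le _ _).inter ((convex_inner_le _ _).inter ((convex_le_inner _ _).inter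
    (convex_inner_le _ _))))))

theorem isClosed_le_inner (m : E3) (c : ℝ) : IsClosed {x : E3 | c ≤ inner ℝ m x} :=
  isClosed_le continuous_const (by fun_prop)

theorem isClosed_inner_le (m : E3) (c : ℝ) : IsClosed {x : E3 | inner ℝ m x ≤ c} :=
  isClosed_le (by fun_prop) continuous_const

theorem isClosed_page {k : ℕ} (hk : 1 ≤ k) : IsClosed (page n θ k) := by
  obtain ⟨k, rfl⟩ := Nat.exists_eq_add_of_le' hk
  rw [page_eq]
  exact (isClosed_le_inner _ _).inter ((isClosed_le_inner _ _).inter ((isClosed_le_inner _ _).inter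
    ((isClosed_inner_le _ _).inter ((isClosed_inner_le _ _).inter ((isClosed_le_inner _ _).inter
    (isClosed_inner_le _ _))))))

theorem framePt_mem_page {k : ℕ} {p q h : ℝ} : framePt (midAngle n θ k) p q h ∈ page n θ k ↔
    PageRegion (halfSin n θ) (halfCos n θ) (lowerCos n θ) (frontShift n θ k) (backShift n θ k)
      p q h := by
  change PageRegion _ _ _ _ _ _ _ _ ↔ _
  rw [radial_framePt, lateral_framePt, depth_framePt]

theorem frontForm_framePt (k : ℕ) (p q h : ℝ) : frontForm n θ k (framePt (midAngle n θ k) p q h) =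
    halfSin n θ * p + halfCos n θ * q + frontShift n θ k * halfSin n θ * h := by
  simp [frontForm]

theorem backForm_framePt (k : ℕ) (p q h : ℝ) : backForm n θ k (framePt (midAngle n θ k) p q h) =
    halfSin n θ * p - halfCos n θ * q + backShift n θ k * halfSin n θ * h := by
  simp [backForm]

theorem endForm_framePt (k : ℕ) (p q h : ℝ) : endForm n θ k (framePt (midAngle n θ k) p q h) =
    p + (halfCos n θ - lowerCos n θ) * h := by
  simp [endForm]

theorem topFace_subset (k : ℕ) : topFace n θ k ⊆ {x | depth x = 0} := by
  simp only [depth_eq (midAngle n θ k)]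
  refine convexHull_min ?_ (convex_inner_eq _ _)
  simp only [insert_subset_iff, singleton_subset_iff]
  change inner ℝ _ _ = _ ∧ inner ℝ _ _ = _ ∧ inner ℝ _ _ = _
  simp only [← depth_eq]
  rw [yA_eq (n := n) (θ := θ) k, yB_eq, yC_eq]
  simp

variable (hn : 2 ≤ n) (hθ : 0 < θ) (hθπ : θ ≤ Real.pi)
include hn hθ hθπ

theorem isBounded_page (k : ℕ) : Bornology.IsBounded (page n θ k) := by
  have H := pageShape hn hθ hθπ k
  have hS := H.S_pos
  have hC := H.C_pos
  set M := halfSin n θ * (1 + frontShift n θ k + backShift n θ k) / halfCos n θ with hM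
  have hM0 : 0 ≤ M := by
    have := H.a_nonneg
    have := H.b_nonneg
    positivity
  refine (Metric.isBounded_closedBall (x := (0 : E3)) (r := √(2 + M ^ 2))).subset fun x hx => ?_
  have h0 := PageRegion.p_nonneg H hx
  have hx1 : PageRegion _ _ _ _ _ _ _ _ := hx
  have hh := hx1.h_nonneg
  have hh1 := hx1.h_le
  have h1 : radial (midAngle n θ k) x ≤ 1 := by
    have := mul_nonneg (sub_nonneg.2 H.c_lt.le) hh
    have hC1 : halfCos n θ ≤ 1 := Real.cos_le_one _
    linarith [hx1.outer]
  have hSp : halfSin n θ * radial (midAngle n θ k) x ≤ halfSin n θ * 1 :=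
    mul_le_mul_of_nonneg_left h1 hS.le
  have hSa : frontShift n θ k * halfSin n θ * depth x ≤ frontShift n θ k * halfSin n θ * 1 :=
    mul_le_mul_of_nonneg_left hh1 (mul_nonneg H.a_nonneg hS.le)
  have hSb : backShift n θ k * halfSin n θ * depth x ≤ backShift n θ k * halfSin n θ * 1 :=
    mul_le_mul_of_nonneg_left hh1 (mul_nonneg H.b_nonneg hS.le)
  have hSa' := mul_nonneg H.a_nonneg hS.le
  have hSb' := mul_nonneg H.b_nonneg hS.le
  have h2 : |lateral (midAngle n θ k) x| ≤ M := by
    rw [hM, le_div_iff₀ hC, ← abs_of_pos hC, ← abs_mul]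
    rw [abs_le]
    constructor
    · linarith [hx1.front]
    · linarith [hx1.back]
  rw [mem_closedBall_zero_iff]
  refine Real.le_sqrt_of_sq_le ?_
  rw [← framePt_coords (midAngle n θ k) x, norm_framePt_sq]
  have h3 := sq_le_sq' (by linarith [neg_abs_le (lateral (midAngle n θ k) x)])
    ((le_abs_self _).trans h2)
  nlinarith


theorem yA_mem_page (k : ℕ) : yA ∈ page n θ k := by
  rw [yA_eq (n := n) (θ := θ) k, framePt_mem_page]
  exact pageRegion_spine (pageShape hn hθ hθπ k) le_rfl zero_le_one

theorem yB_mem_page (k : ℕ) : yB n θ k ∈ page n θ k := by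
  rw [yB_eq, framePt_mem_page]
  exact pageRegion_top (pageShape hn hθ hθπ k)

theorem yC_mem_page (k : ℕ) : yC n θ k ∈ page n θ k := by
  rw [yC_eq, framePt_mem_page]
  simpa using (pageRegion_top (pageShape hn hθ hθπ k).symm).symm

theorem zA_one_mem_page (k : ℕ) : zA n θ 1 ∈ page n θ k := by
  rw [zA_one_eq k, framePt_mem_page]
  exact pageRegion_spine (pageShape hn hθ hθπ k) zero_le_one le_rfl

theorem zA_mem_page (k : ℕ) : zA n θ k ∈ page n θ k := by
  rw [zA_eq, framePt_mem_page]
  exact pageRegion_inner (pageShape hn hθ hθπ k)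

theorem zB_mem_page (k : ℕ) : zB n θ k ∈ page n θ k := by
  rw [zB_eq hn hθ hθπ, framePt_mem_page]
  exact pageRegion_outer (pageShape hn hθ hθπ k)

theorem zC_mem_page (k : ℕ) : zC n θ k ∈ page n θ k := by
  rw [zC_eq hn hθ hθπ, framePt_mem_page]
  simpa using (pageRegion_outer (pageShape hn hθ hθπ k).symm).symm

theorem zA_next_mem_page {k : ℕ} (hk : 1 ≤ k) : zA n θ (next n k) ∈ page n θ k := by
  rw [zA_next_eq hk, framePt_mem_page]
  simpa using (pageRegion_inner (pageShape hn hθ hθπ k).symm).symm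

theorem pageBoundary_subset_page {k : ℕ} (hk : 1 ≤ k) : pageBoundary n θ k ⊆ page n θ k := by
  have a1 := yA_mem_page hn hθ hθπ k
  have a2 := yB_mem_page hn hθ hθπ k
  have a3 := yC_mem_page hn hθ hθπ k
  have b0 := zA_one_mem_page hn hθ hθπ k
  have b1 := zA_mem_page hn hθ hθπ k
  have b2 := zB_mem_page hn hθ hθπ k
  have b3 := zC_mem_page hn hθ hθπ k
  have b4 := zA_next_mem_page hn hθ hθπ hk
  have hc := convex_page (n := n) (θ := θ) hk
  unfold pageBoundary frontFace endFace backFace topFace bottomFace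
  simp only [union_subset_iff]
  refine ⟨⟨⟨⟨?_, ?_⟩, ?_⟩, ?_⟩, ⟨?_, ?_⟩, ?_⟩ <;> refine convexHull_min ?_ hc <;>
    simp only [insert_subset_iff, singleton_subset_iff] <;> tauto

theorem frontFace_subset (k : ℕ) : frontFace n θ k ⊆ {x | frontForm n θ k x = 0} := by
  have hC := (halfCos_pos hn hθ hθπ).ne'
  have hsq := (pageShape hn hθ hθπ k).sq
  simp only [frontForm_eq]
  refine convexHull_min ?_ (convex_inner_eq _ _)
  simp only [insert_subset_iff, singleton_subset_iff]
  change inner ℝ _ _ = _ ∧ inner ℝ _ _ = _ ∧ inner ℝ _ _ = _ ∧ inner ℝ _ _ = _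
  simp only [← frontForm_eq]
  rw [yA_eq (n := n) (θ := θ) k, yB_eq, zA_eq, zB_eq hn hθ hθπ]
  simp only [frontForm_framePt]
  refine ⟨by ring, by ring, ?_, ?_⟩
  · linear_combination -frontShift n θ k * halfSin n θ * hsq
  · field_simp; ring

theorem backFace_subset {k : ℕ} (hk : 1 ≤ k) : backFace n θ k ⊆ {x | backForm n θ k x = 0} := by
  have hC := (halfCos_pos hn hθ hθπ).ne'
  have hsq := (pageShape hn hθ hθπ k).sq
  simp only [backForm_eq]
  refine convexHull_min ?_ (convex_inner_eq _ _)
  simp only [insert_subset_iff, singleton_subset_iff]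
  change inner ℝ _ _ = _ ∧ inner ℝ _ _ = _ ∧ inner ℝ _ _ = _ ∧ inner ℝ _ _ = _
  simp only [← backForm_eq]
  rw [yA_eq (n := n) (θ := θ) k, yC_eq, zA_next_eq hk, zC_eq hn hθ hθπ]
  simp only [backForm_framePt]
  refine ⟨by ring, by ring, ?_, ?_⟩
  · field_simp; ring
  · linear_combination -backShift n θ k * halfSin n θ * hsq

theorem endFace_subset (k : ℕ) : endFace n θ k ⊆ {x | endForm n θ k x = halfCos n θ} := by
  simp only [endForm_eq]
  refine convexHull_min ?_ (convex_inner_eq _ _)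
  simp only [insert_subset_iff, singleton_subset_iff]
  change inner ℝ _ _ = _ ∧ inner ℝ _ _ = _ ∧ inner ℝ _ _ = _ ∧ inner ℝ _ _ = _
  simp only [← endForm_eq]
  rw [yB_eq, yC_eq, zB_eq hn hθ hθπ, zC_eq hn hθ hθπ]
  simp only [endForm_framePt]
  refine ⟨by ring, by ring, by ring, by ring⟩

theorem bottomFace_subset {k : ℕ} (hk : 1 ≤ k) : bottomFace n θ k ⊆ {x | depth x = 1} := by
  simp only [depth_eq (midAngle n θ k), bottomFace, union_subset_iff]
  refine ⟨⟨?_, ?_⟩, ?_⟩ <;> refine convexHull_min ?_ (convex_inner_eq _ _) <;>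
  · simp only [insert_subset_iff, singleton_subset_iff]
    change inner ℝ _ _ = _ ∧ inner ℝ _ _ = _ ∧ inner ℝ _ _ = _
    simp only [← depth_eq]
    rw [zA_one_eq k]
    try rw [zA_eq k]
    try rw [zB_eq hn hθ hθπ]
    try rw [zC_eq hn hθ hθπ]
    try rw [zA_next_eq hk]
    simp

theorem mem_frontFace {k : ℕ} {x : E3} (hx : x ∈ page n θ k) (h : frontForm n θ k x = 0) :
    x ∈ frontFace n θ k := by
  obtain ⟨w₁, w₂, w₃, w₄, h₁, h₂, h₃, h₄, hw, hp, hq, hd⟩ :=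
    PageRegion.exists_front_weights (pageShape hn hθ hθπ k) hx h
  rw [frontFace, yA_eq (n := n) (θ := θ) k, yB_eq, zA_eq, zB_eq hn hθ hθπ,
    ← framePt_coords (midAngle n θ k) x]
  exact framePt_mem_convexHull_four h₁ h₂ h₃ h₄ hw (by rw [hp]; ring) (by rw [hq]; ring)
    (by rw [hd]; ring)

theorem mem_backFace {k : ℕ} (hk : 1 ≤ k) {x : E3} (hx : x ∈ page n θ k)
    (h : backForm n θ k x = 0) : x ∈ backFace n θ k := by
  obtain ⟨w₁, w₂, w₃, w₄, h₁, h₂, h₃, h₄, hw, hp, hq, hd⟩ :=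
    (PageRegion.symm hx).exists_front_weights (pageShape hn hθ hθπ k).symm
      (by rw [← h, backForm]; ring)
  rw [backFace, yA_eq (n := n) (θ := θ) k, yC_eq, zA_next_eq hk, zC_eq hn hθ hθπ,
    ← framePt_coords (midAngle n θ k) x]
  exact framePt_mem_convexHull_four h₂ h₁ h₄ h₃ (by linarith) (by rw [hp]; ring)
    (by rw [← neg_neg (lateral _ _), hq]; ring) (by rw [hd]; ring)

theorem mem_endFace {k : ℕ} {x : E3} (hx : x ∈ page n θ k) (h : endForm n θ k x = halfCos n θ) :
    x ∈ endFace n θ k := by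
  obtain ⟨w₁, w₂, w₃, w₄, h₁, h₂, h₃, h₄, hw, hp, hq, hd⟩ :=
    PageRegion.exists_end_weights (pageShape hn hθ hθπ k) hx h
  rw [endFace, yB_eq, yC_eq, zB_eq hn hθ hθπ, zC_eq hn hθ hθπ,
    ← framePt_coords (midAngle n θ k) x]
  exact framePt_mem_convexHull_four h₁ h₂ h₃ h₄ hw (by rw [hp]) (by rw [hq])
    (by rw [hd]; ring)

theorem mem_topFace {k : ℕ} {x : E3} (hx : x ∈ page n θ k) (h : depth x = 0) :
    x ∈ topFace n θ k := by
  obtain ⟨w₁, w₂, w₃, h₁, h₂, h₃, hw, hp, hq⟩ :=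
    PageRegion.exists_top_weights (pageShape hn hθ hθπ k) hx h
  rw [topFace, yA_eq (n := n) (θ := θ) k, yB_eq, yC_eq, ← framePt_coords (midAngle n θ k) x]
  exact framePt_mem_convexHull_three h₁ h₂ h₃ hw (by rw [hp]; ring) (by rw [hq]; ring)
    (by rw [h]; ring)

theorem mem_bottomFace {k : ℕ} (hk : 1 ≤ k) {x : E3} (hx : x ∈ page n θ k) (h : depth x = 1) :
    x ∈ bottomFace n θ k := by
  have H := pageShape hn hθ hθπ k
  have hR : PageRegion _ _ _ _ _ _ _ _ := hx
  rw [h] at hR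
  rw [bottomFace, zA_one_eq k, zB_eq hn hθ hθπ, zC_eq hn hθ hθπ, zA_next_eq hk, zA_eq k,
    ← framePt_coords (midAngle n θ k) x, h]
  set p := radial (midAngle n θ k) x
  set q := lateral (midAngle n θ k) x
  -- The segments from the foot of the spine to the two outer lower vertices divide the bottom into
  -- its three triangles.
  by_cases h1 : lowerCos n θ * q +
      halfSin n θ * (frontShift n θ k + lowerCos n θ) / halfCos n θ * p < 0
  · obtain ⟨w₁, w₂, w₃, h₁, h₂, h₃, hw, hp, hq⟩ := hR.exists_bottom_weights_side H h1
    refine Or.inl (Or.inl ?_)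
    exact framePt_mem_convexHull_three h₁ h₂ h₃ hw (by rw [hp]; ring) (by rw [hq]; ring)
      (by linarith)
  by_cases h2 : lowerCos n θ * -q +
      halfSin n θ * (backShift n θ k + lowerCos n θ) / halfCos n θ * p < 0
  · obtain ⟨w₁, w₂, w₃, h₁, h₂, h₃, hw, hp, hq⟩ := hR.symm.exists_bottom_weights_side H.symm h2
    refine Or.inr ?_
    exact framePt_mem_convexHull_three h₁ h₃ h₂ (by linarith) (by rw [hp]; ring)
      (by rw [← neg_neg q, hq]; ring) (by linarith)
  · obtain ⟨w₁, w₂, w₃, h₁, h₂, h₃, hw, hp, hq⟩ :=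
      hR.exists_bottom_weights_middle H (not_lt.1 h1) (by linarith)
    refine Or.inl (Or.inr ?_)
    exact framePt_mem_convexHull_three h₁ h₂ h₃ hw (by rw [hp]; ring) (by rw [hq]; ring)
      (by linarith)

/-- Of the walls of a page only the two vertical ones towards the neighbouring pages do not belong
to the surface; through them the pages communicate. -/
theorem mem_pageBoundary_iff {k : ℕ} (hk : 1 ≤ k) {x : E3} : x ∈ pageBoundary n θ k ↔
    x ∈ page n θ k ∧ (frontForm n θ k x = 0 ∨ endForm n θ k x = halfCos n θ ∨
      backForm n θ k x = 0 ∨ depth x = 0 ∨ depth x = 1) := by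
  constructor
  · intro h
    refine ⟨pageBoundary_subset_page hn hθ hθπ hk h, ?_⟩
    rcases h with (((h | h) | h) | h) | h
    · exact Or.inl (frontFace_subset hn hθ hθπ k h)
    · exact Or.inr (Or.inl (endFace_subset hn hθ hθπ k h))
    · exact Or.inr (Or.inr (Or.inl (backFace_subset hn hθ hθπ hk h)))
    · exact Or.inr (Or.inr (Or.inr (Or.inl (topFace_subset k h))))
    · exact Or.inr (Or.inr (Or.inr (Or.inr (bottomFace_subset hn hθ hθπ hk h))))
  · rintro ⟨hx, h | h | h | h | h⟩
    · exact Or.inl (Or.inl (Or.inl (Or.inl (mem_frontFace hn hθ hθπ hx h))))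
    · exact Or.inl (Or.inl (Or.inl (Or.inr (mem_endFace hn hθ hθπ hx h))))
    · exact Or.inl (Or.inl (Or.inr (mem_backFace hn hθ hθπ hk hx h)))
    · exact Or.inl (Or.inr (mem_topFace hn hθ hθπ hx h))
    · exact Or.inr (mem_bottomFace hn hθ hθπ hk hx h)

end OpenBook
end

noncomputable section
namespace OpenBook

variable {n : ℕ} {θ : ℝ}

/-! ### The surface is made of convex planar pieces -/

theorem exists_planarPieces {ι : Type*} [Fintype ι] {S : ι → Set E3} (hc : ∀ i, IsCompact (S i))
    (hconv : ∀ i, Convex ℝ (S i))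
    (h : ∀ i, ∃ m : E3, ∃ c : ℝ, m ≠ 0 ∧ S i ⊆ {x | inner ℝ m x = c}) :
    ∃ (N : ι → E3) (c : ι → ℝ), PlanarPieces S N c := by
  choose m c hm hS using h
  refine ⟨fun i => ‖m i‖⁻¹ • m i, fun i => ‖m i‖⁻¹ * c i, hc, hconv, fun i => ?_, fun i x hx => ?_⟩
  · rw [norm_smul, norm_inv, norm_norm, inv_mul_cancel₀ (norm_ne_zero_iff.2 (hm i))]
  · change inner ℝ _ _ = _
    rw [real_inner_smul_left, hS i hx]

theorem framePt_ne_zero {α p q h : ℝ} (hne : p ^ 2 + q ^ 2 + h ^ 2 ≠ 0) : framePt α p q h ≠ 0 := by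
  intro h0
  rw [← norm_framePt_sq α, h0] at hne
  simp at hne

/-- The planar pieces of the surface. -/
def surfacePiece (n : ℕ) (θ : ℝ) (k : ℕ) : Fin 7 → Set E3 :=
  ![frontFace n θ k, endFace n θ k, backFace n θ k, topFace n θ k,
    convexHull ℝ {zA n θ 1, zA n θ k, zB n θ k}, convexHull ℝ {zA n θ 1, zB n θ k, zC n θ k},
    convexHull ℝ {zA n θ 1, zC n θ k, zA n θ (next n k)}]

theorem isCompact_surfacePiece (k : ℕ) (i : Fin 7) : IsCompact (surfacePiece n θ k i) := by
  fin_cases i <;> exact Set.Finite.isCompact_convexHull (𝕜 := ℝ) (by toFinite_tac)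

theorem convex_surfacePiece (k : ℕ) (i : Fin 7) : Convex ℝ (surfacePiece n θ k i) := by
  fin_cases i <;> exact convex_convexHull ℝ _

theorem iUnion_surfacePiece (k : ℕ) : ⋃ i, surfacePiece n θ k i = pageBoundary n θ k := by
  ext x
  simp only [mem_iUnion, Fin.exists_fin_succ, surfacePiece, pageBoundary, bottomFace, mem_union]
  simp
  tauto

theorem exists_planarPieces_surface (hn : 2 ≤ n) (hθ : 0 < θ) (hθπ : θ ≤ Real.pi) :
    ∃ (N : ↥(Finset.Icc 1 n) × Fin 7 → E3) (c : ↥(Finset.Icc 1 n) × Fin 7 → ℝ),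
      PlanarPieces (fun i => surfacePiece n θ i.1 i.2) N c := by
  refine exists_planarPieces (fun i => isCompact_surfacePiece _ _)
    (fun i => convex_surfacePiece _ _) ?_
  rintro ⟨⟨k, hk⟩, i⟩
  have hk1 : 1 ≤ k := (Finset.mem_Icc.1 hk).1
  have hS := halfSin_pos hn hθ hθπ
  have hb : ∀ T, T ⊆ bottomFace n θ k → ∃ m : E3, ∃ c : ℝ, m ≠ 0 ∧ T ⊆ {x | inner ℝ m x = c} := by
    intro T hT
    refine ⟨framePt 0 0 0 1, 1, framePt_ne_zero (by norm_num), ?_⟩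
    simp only [← depth_eq]
    exact hT.trans (bottomFace_subset hn hθ hθπ hk1)
  fin_cases i
  · refine ⟨framePt (midAngle n θ k) (halfSin n θ) (halfCos n θ) (frontShift n θ k * halfSin n θ), 0, framePt_ne_zero (by positivity), fun x hx => ?_⟩
    exact (frontForm_eq k x).symm.trans (frontFace_subset hn hθ hθπ k hx)
  · refine ⟨framePt (midAngle n θ k) 1 0 (halfCos n θ - lowerCos n θ), halfCos n θ, framePt_ne_zero (by positivity), fun x hx => ?_⟩
    exact (endForm_eq k x).symm.trans (endFace_subset hn hθ hθπ k hx)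
  · refine ⟨framePt (midAngle n θ k) (halfSin n θ) (-halfCos n θ) (backShift n θ k * halfSin n θ), 0, framePt_ne_zero (by positivity), fun x hx => ?_⟩
    exact (backForm_eq k x).symm.trans (backFace_subset hn hθ hθπ hk1 hx)
  · refine ⟨framePt 0 0 0 1, 0, framePt_ne_zero (by norm_num), ?_⟩
    simp only [← depth_eq]
    exact topFace_subset k
  · exact hb _ fun x hx => Or.inl (Or.inl hx)
  · exact hb _ fun x hx => Or.inl (Or.inr hx)
  · exact hb _ fun x hx => Or.inr hx

theorem surface_eq_iUnion :
    surface n θ = ⋃ i : ↥(Finset.Icc 1 n) × Fin 7, surfacePiece n θ i.1 i.2 := by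
  rw [surface_eq, iUnion_prod']
  simp only [iUnion_surfacePiece]
  exact (iUnion_subtype _ fun k => pageBoundary n θ k.1).symm

theorem exists_doubleLayer (hn : 2 ≤ n) (hθ : 0 < θ) (hθπ : θ ≤ Real.pi) :
    ∃ D D' : L2 n θ →L[ℂ] L2 n θ, IsDoubleLayer n θ D ∧ IsAdjointDoubleLayer n θ D' ∧
      D' = D.adjoint := by
  obtain ⟨N, c, h⟩ := exists_planarPieces_surface hn hθ hθπ
  exact h.exists_operators surface_eq_iUnion

theorem isFiniteMeasure_surfaceMeasure (hn : 2 ≤ n) (hθ : 0 < θ) (hθπ : θ ≤ Real.pi) :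
    IsFiniteMeasure (surfaceMeasure n θ) := by
  obtain ⟨N, c, h⟩ := exists_planarPieces_surface hn hθ hθπ
  have := h.isFiniteMeasure
  rw [← surface_eq_iUnion] at this
  exact this

end OpenBook
end

noncomputable section
namespace OpenBook

variable {n : ℕ} {θ : ℝ}

/-! ### The region enclosed by the surface -/

/-- The union of the pages. -/
def book (n : ℕ) (θ : ℝ) : Set E3 := ⋃ k ∈ Finset.Icc 1 n, page n θ k

theorem mem_book_iff {x : E3} : x ∈ book n θ ↔ ∃ k, 1 ≤ k ∧ k ≤ n ∧ x ∈ page n θ k := by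
  simp [book, and_assoc]

theorem mem_surface_iff {x : E3} :
    x ∈ surface n θ ↔ ∃ k, 1 ≤ k ∧ k ≤ n ∧ x ∈ pageBoundary n θ k := by
  simp [surface_eq, and_assoc]

theorem isClosed_book : IsClosed (book n θ) :=
  (Finset.finite_toSet _).isClosed_biUnion fun _ hk => isClosed_page (Finset.mem_Icc.1 hk).1

/-- The conditions on `x` that do not involve the front and the back of page `k`. -/
def pageCore (n : ℕ) (θ : ℝ) (k : ℕ) : Set E3 :=
  {x | 0 < gapForm n θ k x ∧ gapForm n θ (k + 1) x < 0 ∧ endForm n θ (k + 1) x < halfCos n θ ∧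
    0 < depth x ∧ depth x < 1}

theorem continuous_frontForm (k : ℕ) : Continuous (frontForm n θ k) := by
  have := continuous_radial (midAngle n θ k)
  have := continuous_lateral (midAngle n θ k)
  have := continuous_depth
  unfold frontForm
  fun_prop

theorem continuous_backForm (k : ℕ) : Continuous (backForm n θ k) := by
  have := continuous_radial (midAngle n θ k)
  have := continuous_lateral (midAngle n θ k)
  have := continuous_depth
  unfold backForm
  fun_prop

theorem continuous_endForm (k : ℕ) : Continuous (endForm n θ k) := by
  have := continuous_radial (midAngle n θ k)
  have := continuous_depth
  unfold endForm
  fun_prop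

theorem continuous_gapForm (k : ℕ) : Continuous (gapForm n θ k) := continuous_lateral _

theorem isOpen_pageCore (k : ℕ) : IsOpen (pageCore n θ k) :=
  (isOpen_lt continuous_const (continuous_gapForm k)).inter
    ((isOpen_lt (continuous_gapForm (k + 1)) continuous_const).inter
    ((isOpen_lt (continuous_endForm (k + 1)) continuous_const).inter
    ((isOpen_lt continuous_const continuous_depth).inter
    (isOpen_lt continuous_depth continuous_const))))

theorem mem_page_of_mem_pageCore {k : ℕ} {x : E3} (h : x ∈ pageCore n θ k)
    (hf : 0 ≤ frontForm n θ (k + 1) x) (hb : 0 ≤ backForm n θ (k + 1) x) :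
    x ∈ page n θ (k + 1) :=
  mem_page_iff.2 ⟨hf, hb, h.1.le, h.2.1.le, h.2.2.1.le, h.2.2.2.1.le, h.2.2.2.2.le⟩

theorem midAngle_gap (k : ℕ) (x : E3) :
    radial (midAngle n θ k) x = Real.cos (pageAngle n θ) *
        radial (midAngle n θ k + pageAngle n θ) x - Real.sin (pageAngle n θ) * gapForm n θ k x ∧
      lateral (midAngle n θ k) x = Real.sin (pageAngle n θ) *
        radial (midAngle n θ k + pageAngle n θ) x + Real.cos (pageAngle n θ) * gapForm n θ k x := by
  have h : midAngle n θ k = midAngle n θ k + pageAngle n θ + -pageAngle n θ := by ring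
  constructor
  · conv_lhs => rw [h]
    rw [radial_add, Real.cos_neg, Real.sin_neg, gapForm]; ring
  · conv_lhs => rw [h]
    rw [lateral_add, Real.cos_neg, Real.sin_neg, gapForm]; ring

theorem midAngle_succ_gap (k : ℕ) (x : E3) :
    radial (midAngle n θ (k + 1)) x = Real.cos (pageAngle n θ) *
        radial (midAngle n θ k + pageAngle n θ) x + Real.sin (pageAngle n θ) * gapForm n θ k x ∧
      lateral (midAngle n θ (k + 1)) x = -Real.sin (pageAngle n θ) *
        radial (midAngle n θ k + pageAngle n θ) x + Real.cos (pageAngle n θ) * gapForm n θ k x := by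
  rw [midAngle_succ]
  exact ⟨radial_add _ _ _, lateral_add _ _ _⟩

variable (hn : 2 ≤ n) (hθ : 0 < θ) (hθπ : θ ≤ Real.pi)
include hn hθ hθπ

theorem surface_subset_book : surface n θ ⊆ book n θ := by
  intro x hx
  obtain ⟨k, h1, h2, h⟩ := mem_surface_iff.1 hx
  exact mem_book_iff.2 ⟨k, h1, h2, pageBoundary_subset_page hn hθ hθπ h1 h⟩

theorem isBounded_book : Bornology.IsBounded (book n θ) :=
  (Bornology.isBounded_biUnion (Finset.finite_toSet _)).2 fun k _ => isBounded_page hn hθ hθπ k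

theorem sin_nonneg_of_le {m : ℕ} (hm : m + 1 ≤ n) : 0 ≤ Real.sin (2 * (m : ℝ) * pageAngle n θ) := by
  have h1 := pageAngle_pos hn hθ
  have h2 : (m : ℝ) + 1 ≤ n := by exact_mod_cast hm
  have h3 := three_le_two_mul_sub_one hn
  have h4 : (2 * (n : ℝ) - 1) * pageAngle n θ = θ := mul_div_cancel₀ _ (by linarith)
  refine Real.sin_nonneg_of_nonneg_of_le_pi (by positivity) ?_
  nlinarith

theorem sin_two_mul_pageAngle_pos : 0 < Real.sin (2 * pageAngle n θ) := by
  have h1 := pageAngle_pos hn hθ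
  have h2 := pageAngle_le hn hθ
  exact Real.sin_pos_of_pos_of_lt_pi (by linarith) (by linarith)

omit hn hθ hθπ in
theorem gapForm_add (j m : ℕ) (x : E3) : gapForm n θ (j + m) x =
    -Real.sin (2 * (m : ℝ) * pageAngle n θ) * radial (midAngle n θ j + pageAngle n θ) x +
      Real.cos (2 * (m : ℝ) * pageAngle n θ) * gapForm n θ j x := by
  rw [gapForm, show midAngle n θ (j + m) + pageAngle n θ =
    midAngle n θ j + pageAngle n θ + 2 * (m : ℝ) * pageAngle n θ by
      unfold midAngle; push_cast; ring, lateral_add]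
  rfl

omit hn hθ hθπ in
theorem gapForm_sub (j m : ℕ) (x : E3) : gapForm n θ j x =
    Real.sin (2 * (m : ℝ) * pageAngle n θ) * radial (midAngle n θ (j + m) + pageAngle n θ) x +
      Real.cos (2 * (m : ℝ) * pageAngle n θ) * gapForm n θ (j + m) x := by
  rw [gapForm, show midAngle n θ j + pageAngle n θ =
    midAngle n θ (j + m) + pageAngle n θ + -(2 * (m : ℝ) * pageAngle n θ) by
      unfold midAngle; push_cast; ring, lateral_add, Real.sin_neg, Real.cos_neg, neg_neg]
  rfl

/-- In its index `gapForm` is a sinusoid with step `2θ_n`. Hence `sin (2θ_n)` times its value at `j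
+ 1 + m` is `sin (2(m+1)θ_n)` times the value at `j + 1` minus `sin (2mθ_n)` times that at `j`. All
these sines are nonnegative, as the angles do not exceed `θ ≤ π`. -/
theorem gapForm_nonpos_of_mem_page {i j : ℕ} {x : E3} (hx : x ∈ page n θ (j + 1))
    (hij : j + 1 ≤ i) (hi : i + 1 ≤ n) : gapForm n θ i x ≤ 0 := by
  obtain ⟨m, rfl⟩ := Nat.exists_eq_add_of_le hij
  obtain ⟨-, -, h1, h2, -⟩ := mem_page_iff.1 hx
  have h3 := gapForm_add (n := n) (θ := θ) j 1 x
  have h4 := gapForm_add (n := n) (θ := θ) j (m + 1) x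
  rw [show j + (m + 1) = j + 1 + m by ring] at h4
  have h5 := sin_two_mul_pageAngle_pos hn hθ hθπ
  have h6 := sin_nonneg_of_le hn hθ hθπ (m := m) (by omega)
  have h7 := sin_nonneg_of_le hn hθ hθπ (m := m + 1) (by omega)
  push_cast at h3 h4 h7
  rw [mul_one] at h3
  set r := radial (midAngle n θ j + pageAngle n θ) x
  have h8 : Real.sin (2 * (m : ℝ) * pageAngle n θ) =
      Real.sin (2 * ((m : ℝ) + 1) * pageAngle n θ) * Real.cos (2 * pageAngle n θ) -
      Real.cos (2 * ((m : ℝ) + 1) * pageAngle n θ) * Real.sin (2 * pageAngle n θ) := by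
    rw [← Real.sin_sub]; congr 1; ring
  have h9 : Real.sin (2 * pageAngle n θ) * gapForm n θ (j + 1 + m) x =
      Real.sin (2 * ((m : ℝ) + 1) * pageAngle n θ) * gapForm n θ (j + 1) x -
        Real.sin (2 * (m : ℝ) * pageAngle n θ) * gapForm n θ j x := by
    rw [h4, h3, h8]; ring
  refine nonpos_of_mul_nonpos_right ?_ h5
  rw [h9]
  have := mul_nonneg h6 h1
  have := mul_nonneg h7 (neg_nonneg.2 h2)
  linarith

/-- The same identity, extrapolated to smaller indices. -/
theorem gapForm_nonneg_of_mem_page {i j : ℕ} {x : E3} (hx : x ∈ page n θ (j + 1))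
    (h0 : 1 ≤ i) (hij : i ≤ j) (hj : j + 1 ≤ n) : 0 ≤ gapForm n θ i x := by
  obtain ⟨m, rfl⟩ := Nat.exists_eq_add_of_le hij
  obtain ⟨-, -, h1, h2, -⟩ := mem_page_iff.1 hx
  have h3 := gapForm_add (n := n) (θ := θ) (i + m) 1 x
  have h4 := gapForm_sub (n := n) (θ := θ) i m x
  have h5 := sin_two_mul_pageAngle_pos hn hθ hθπ
  have h6 := sin_nonneg_of_le hn hθ hθπ (m := m) (by omega)
  have h7 := sin_nonneg_of_le hn hθ hθπ (m := m + 1) (by omega)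
  push_cast at h3 h7
  rw [mul_one] at h3
  set r := radial (midAngle n θ (i + m) + pageAngle n θ) x
  have h8 : Real.sin (2 * ((m : ℝ) + 1) * pageAngle n θ) =
      Real.sin (2 * (m : ℝ) * pageAngle n θ) * Real.cos (2 * pageAngle n θ) +
      Real.cos (2 * (m : ℝ) * pageAngle n θ) * Real.sin (2 * pageAngle n θ) := by
    rw [← Real.sin_add]; congr 1; ring
  have h9 : Real.sin (2 * pageAngle n θ) * gapForm n θ i x =
      Real.sin (2 * ((m : ℝ) + 1) * pageAngle n θ) * gapForm n θ (i + m) x -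
        Real.sin (2 * (m : ℝ) * pageAngle n θ) * gapForm n θ (i + m + 1) x := by
    rw [h4, h3, h8]; ring
  refine nonneg_of_mul_nonneg_right ?_ h5
  rw [h9]
  have := mul_nonneg h7 h1
  have := mul_nonneg h6 (neg_nonneg.2 h2)
  linarith

/-- A point strictly between the bisecting planes next to a page belongs to no other page. -/
theorem eq_of_mem_page {k j : ℕ} {x : E3} (hk : k + 1 ≤ n) (hj : j + 1 ≤ n)
    (h1 : 0 < gapForm n θ k x) (h2 : gapForm n θ (k + 1) x < 0) (hx : x ∈ page n θ (j + 1)) :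
    j = k := by
  rcases lt_trichotomy j k with h | h | h
  · exact absurd (gapForm_nonpos_of_mem_page hn hθ hθπ hx h hk) (not_le.2 h1)
  · exact h
  · exact absurd (gapForm_nonneg_of_mem_page hn hθ hθπ hx (by omega) h hj) (not_le.2 h2)

/-- On the plane between two pages the back of the one and the front of the other give the same
condition, radius less than `r₂` times depth. If it and the remaining inequalities are strict, they
persist nearby, and the sign of `gapForm` decides which of the two pages contains a neighbouring
point. -/
theorem mem_interior_book_of_gapForm_eq_zero {k : ℕ} (hk : k + 2 ≤ n) {x : E3}
    (hg : gapForm n θ (k + 1) x = 0)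
    (hM : 0 < radial (midAngle n θ (k + 1) + pageAngle n θ) x)
    (hM' : radial (midAngle n θ (k + 1) + pageAngle n θ) x < r₂ n θ * depth x)
    (he : Real.cos (pageAngle n θ) * radial (midAngle n θ (k + 1) + pageAngle n θ) x +
      (halfCos n θ - lowerCos n θ) * depth x < halfCos n θ) (hd : 0 < depth x)
    (hd1 : depth x < 1) : x ∈ interior (book n θ) := by
  have hS := halfSin_pos hn hθ hθπ
  have hC := halfCos_pos hn hθ hθπ
  have H := pageShape hn hθ hθπ (k + 1)
  have H2 := pageShape hn hθ hθπ (k + 1 + 1)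
  have hK := H.cos_pos
  have hsq := H.sq
  obtain ⟨e1, e2⟩ := midAngle_gap (n := n) (θ := θ) (k + 1) x
  obtain ⟨e3, e4⟩ := midAngle_succ_gap (n := n) (θ := θ) (k + 1) x
  rw [cos_pageAngle] at he e1 e2 e3 e4
  rw [sin_pageAngle, hg, mul_zero] at e1 e2 e3 e4
  simp only [sub_zero, add_zero] at e1 e2 e3 e4
  set M := radial (midAngle n θ (k + 1) + pageAngle n θ) x with hMdef
  have hb : backShift n θ (k + 1) = r₂ n θ := by rw [backShift, if_neg (by omega)]
  have hf : frontShift n θ (k + 1 + 1) = r₂ n θ := by rw [frontShift, if_neg (by omega)]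
  have hSM := mul_pos hS (sub_pos.2 hM')
  have c1 : 0 < backForm n θ (k + 1) x := by
    rw [backForm, e1, e2, hb]
    have : halfSin n θ * ((halfCos n θ ^ 2 - halfSin n θ ^ 2) * M) -
        halfCos n θ * (2 * halfSin n θ * halfCos n θ * M) + r₂ n θ * halfSin n θ * depth x =
        halfSin n θ * (r₂ n θ * depth x - M) := by
      linear_combination -halfSin n θ * M * hsq
    rw [this]; exact hSM
  have c2 : 0 < frontForm n θ (k + 1 + 1) x := by
    rw [frontForm, e3, e4, hf]
    have : halfSin n θ * ((halfCos n θ ^ 2 - halfSin n θ ^ 2) * M) +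
        halfCos n θ * (-(2 * halfSin n θ * halfCos n θ) * M) + r₂ n θ * halfSin n θ * depth x =
        halfSin n θ * (r₂ n θ * depth x - M) := by
      linear_combination -halfSin n θ * M * hsq
    rw [this]; exact hSM
  have c3 : 0 < frontForm n θ (k + 1) x := by
    rw [frontForm, e1, e2]
    have := H.a_nonneg
    positivity
  have c4 : 0 < backForm n θ (k + 1 + 1) x := by
    rw [backForm, e3, e4]
    have := H2.b_nonneg
    have h1 : 0 < halfSin n θ * ((halfCos n θ ^ 2 - halfSin n θ ^ 2) * M) := by positivity
    have h2 : 0 < halfCos n θ * (2 * halfSin n θ * halfCos n θ * M) := by positivity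
    have h3 : 0 ≤ backShift n θ (k + 1 + 1) * halfSin n θ * depth x := by positivity
    linarith
  have c5 : 0 < gapForm n θ k x := by rw [gapForm_eq_left, e1, e2]; positivity
  have c6 : gapForm n θ (k + 1 + 1) x < 0 := by
    rw [← neg_pos, gapForm_eq_right, e3, e4]
    have h1 : 0 < 2 * halfSin n θ * halfCos n θ * ((halfCos n θ ^ 2 - halfSin n θ ^ 2) * M) := by
      positivity
    linarith
  have c7 : endForm n θ (k + 1) x < halfCos n θ := by rw [endForm, e1]; exact he
  have c8 : endForm n θ (k + 1 + 1) x < halfCos n θ := by rw [endForm, e3]; exact he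
  rw [mem_interior_iff_mem_nhds]
  filter_upwards [(continuous_backForm _).continuousAt.eventually_const_lt c1,
    (continuous_frontForm _).continuousAt.eventually_const_lt c2,
    (continuous_frontForm _).continuousAt.eventually_const_lt c3,
    (continuous_backForm _).continuousAt.eventually_const_lt c4,
    (continuous_gapForm _).continuousAt.eventually_const_lt c5,
    (continuous_gapForm _).continuousAt.eventually_lt_const c6,
    (continuous_endForm _).continuousAt.eventually_lt_const c7,
    (continuous_endForm _).continuousAt.eventually_lt_const c8,
    continuous_depth.continuousAt.eventually_const_lt hd,
    continuous_depth.continuousAt.eventually_lt_const hd1] with y d1 d2 d3 d4 d5 d6 d7 d8 d9 d10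
  rw [mem_book_iff]
  rcases le_total (gapForm n θ (k + 1) y) 0 with h | h
  · exact ⟨k + 1, by omega, by omega,
      mem_page_iff.2 ⟨d3.le, d1.le, d5.le, h, d7.le, d9.le, d10.le⟩⟩
  · exact ⟨k + 1 + 1, by omega, by omega,
      mem_page_iff.2 ⟨d2.le, d4.le, h, d6.le, d8.le, d9.le, d10.le⟩⟩

omit hn hθ hθπ in
theorem radial_eq_zero {α β : ℝ} {x : E3} (h1 : radial α x = 0) (h2 : lateral α x = 0) :
    radial β x = 0 ∧ lateral β x = 0 := by
  rw [show β = α + (β - α) by ring, radial_add, lateral_add, h1, h2]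
  simp

/-- Off the surface, only the two walls towards the neighbouring pages can be attained with
equality. On a wall between two pages the preceding lemma applies; the outer walls of the first and
the last page are met only on the spine; and otherwise all inequalities are strict. -/
theorem mem_interior_book {x : E3} (hx : x ∈ book n θ) (hxs : x ∉ surface n θ) :
    x ∈ interior (book n θ) := by
  obtain ⟨k, hk1, hkn, hxk⟩ := mem_book_iff.1 hx
  obtain ⟨j, rfl⟩ := Nat.exists_eq_add_of_le' hk1
  have hS := halfSin_pos hn hθ hθπ
  have H := pageShape hn hθ hθπ (j + 1)
  have hsq := H.sq
  obtain ⟨h1, h2, h3, h4, h5, h6, h7⟩ := mem_page_iff.1 hxk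
  have hnb : x ∉ pageBoundary n θ (j + 1) := fun h => hxs (mem_surface_iff.2 ⟨_, hk1, hkn, h⟩)
  rw [mem_pageBoundary_iff hn hθ hθπ hk1] at hnb
  push Not at hnb
  obtain ⟨n1, n2, n3, n4, n5⟩ := hnb hxk
  replace h1 := h1.lt_of_ne' n1
  replace h2 := h2.lt_of_ne' n3
  replace h5 := h5.lt_of_ne n2
  replace h6 := h6.lt_of_ne' n4
  replace h7 := h7.lt_of_ne n5
  -- The front of page `1` is vertical and contains the whole spine, so points of the spine are on
  -- the surface.
  have haxis : ¬ (radial (midAngle n θ (j + 1)) x = 0 ∧ lateral (midAngle n θ (j + 1)) x = 0) := by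
    rintro ⟨e1, e2⟩
    obtain ⟨e3, e4⟩ := radial_eq_zero (β := midAngle n θ 1) e1 e2
    refine hxs (mem_surface_iff.2 ⟨1, le_rfl, by omega, ?_⟩)
    rw [mem_pageBoundary_iff hn hθ hθπ le_rfl]
    refine ⟨?_, Or.inl ?_⟩
    · rw [← framePt_coords (midAngle n θ 1) x, e3, e4, framePt_mem_page]
      exact pageRegion_spine (pageShape hn hθ hθπ 1) h6.le h7.le
    · rw [frontForm, e3, e4, frontShift, if_pos rfl]; ring
  have hR : PageRegion _ _ _ _ _ _ _ _ := hxk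
  have hp := hR.p_nonneg H
  rcases h4.eq_or_lt with h4 | h4
  · by_cases hjn : j + 1 = n
    · have hb : backShift n θ (j + 1) = 0 := by rw [backShift, if_pos hjn]
      have h8 := PageRegion.left_pos (hb ▸ H.symm) (hb ▸ hR.symm)
        (by rw [neg_ne_zero]; tauto)
      have h9 := gapForm_eq_right (n := n) (θ := θ) (j + 1) x
      linarith
    · have e := midAngle_gap (n := n) (θ := θ) (j + 1) x
      rw [h4, mul_zero, mul_zero, sub_zero, add_zero] at e
      obtain ⟨e1, e2⟩ := e
      have hb : backShift n θ (j + 1) = r₂ n θ := by rw [backShift, if_neg hjn]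
      rw [cos_pageAngle] at e1
      rw [sin_pageAngle] at e2
      refine mem_interior_book_of_gapForm_eq_zero hn hθ hθπ (k := j) (by omega) h4 ?_ ?_ ?_ h6 h7
      · by_contra hneg
        rw [e1] at hp
        have h8 : radial (midAngle n θ (j + 1) + pageAngle n θ) x = 0 :=
          le_antisymm (not_lt.1 hneg) (nonneg_of_mul_nonneg_right hp H.cos_pos)
        exact haxis ⟨by rw [e1, h8, mul_zero], by rw [e2, h8, mul_zero]⟩
      · rw [backForm, e1, e2, hb] at h2
        refine lt_of_mul_lt_mul_left ?_ hS.le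
        set M := radial (midAngle n θ (j + 1) + pageAngle n θ) x
        have : halfSin n θ * ((halfCos n θ ^ 2 - halfSin n θ ^ 2) * M) -
            halfCos n θ * (2 * halfSin n θ * halfCos n θ * M) = - (halfSin n θ * M) := by
          linear_combination -halfSin n θ * M * hsq
        linarith
      · rw [endForm, e1] at h5
        rwa [cos_pageAngle]
  rcases h3.eq_or_lt with h3 | h3
  · cases j with
    | zero =>
      have ha : frontShift n θ (0 + 1) = 0 := by rw [frontShift, if_pos (by omega)]
      have h8 := PageRegion.left_pos (ha ▸ H) (ha ▸ hR) (by tauto)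
      have h9 := gapForm_eq_left (n := n) (θ := θ) 0 x
      linarith
    | succ j =>
      have e := midAngle_succ_gap (n := n) (θ := θ) (j + 1) x
      rw [← h3, mul_zero, mul_zero, add_zero, add_zero] at e
      obtain ⟨e1, e2⟩ := e
      have ha : frontShift n θ (j + 1 + 1) = r₂ n θ := by rw [frontShift, if_neg (by omega)]
      rw [cos_pageAngle] at e1
      rw [sin_pageAngle] at e2
      refine mem_interior_book_of_gapForm_eq_zero hn hθ hθπ (k := j) (by omega) h3.symm ?_ ?_ ?_
        h6 h7
      · by_contra hneg
        rw [e1] at hp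
        have h8 : radial (midAngle n θ (j + 1) + pageAngle n θ) x = 0 :=
          le_antisymm (not_lt.1 hneg) (nonneg_of_mul_nonneg_right hp H.cos_pos)
        exact haxis ⟨by rw [e1, h8, mul_zero], by rw [e2, h8, mul_zero]⟩
      · rw [frontForm, e1, e2, ha] at h1
        refine lt_of_mul_lt_mul_left ?_ hS.le
        set M := radial (midAngle n θ (j + 1) + pageAngle n θ) x
        have : halfSin n θ * ((halfCos n θ ^ 2 - halfSin n θ ^ 2) * M) +
            halfCos n θ * (-(2 * halfSin n θ * halfCos n θ) * M) = - (halfSin n θ * M) := by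
          linear_combination -halfSin n θ * M * hsq
        linarith
      · rw [endForm, e1] at h5
        rwa [cos_pageAngle]
  · rw [mem_interior_iff_mem_nhds]
    have hcore : x ∈ pageCore n θ j := ⟨h3, h4, h5, h6, h7⟩
    filter_upwards [(isOpen_pageCore j).mem_nhds hcore,
      (continuous_frontForm _).continuousAt.eventually_const_lt h1,
      (continuous_backForm _).continuousAt.eventually_const_lt h2] with y d1 d2 d3
    exact mem_book_iff.2 ⟨_, hk1, hkn, mem_page_of_mem_pageCore d1 d2.le d3.le⟩

/-- Off the surface, the book coincides with its interior, so the complement of the surface splits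
into two disjoint open sets: the interior of the book and the complement of the book. A component
meeting the former stays in it and is bounded. -/
theorem mem_polyhedron {x : E3} (hx : x ∈ book n θ) (hxs : x ∉ surface n θ) :
    x ∈ polyhedron n θ := by
  refine ⟨hxs, ?_⟩
  have hsub : connectedComponentIn (surface n θ)ᶜ x ⊆ interior (book n θ) := by
    refine isPreconnected_connectedComponentIn.subset_left_of_subset_union isOpen_interior
      (isClosed_book (n := n) (θ := θ)).isOpen_compl ?_ (fun y hy => ?_)
      ⟨x, mem_connectedComponentIn hxs, mem_interior_book hn hθ hθπ hx hxs⟩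
    · exact (disjoint_compl_right).mono_left interior_subset
    · by_cases hyb : y ∈ book n θ
      · exact Or.inl (mem_interior_book hn hθ hθπ hyb (connectedComponentIn_subset _ _ hy))
      · exact Or.inr hyb
  exact (isBounded_book hn hθ hθπ).subset (hsub.trans interior_subset)

omit hn hθ hθπ in
theorem coords_add_smul_up (α t : ℝ) (x : E3) :
    radial α (x + t • framePt 0 0 0 (-1)) = radial α x ∧
      lateral α (x + t • framePt 0 0 0 (-1)) = lateral α x ∧
      depth (x + t • framePt 0 0 0 (-1)) = depth x - t := by
  refine ⟨?_, ?_, ?_⟩ <;> simp [radial, lateral, depth, framePt]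
  ring

/-- The vector `framePt 0 0 0 (-1)` points upwards; a ray that avoids the book makes the component
of `x` unbounded. -/
theorem notMem_polyhedron {x : E3}
    (hx : ∀ t : ℝ, 0 ≤ t → x + t • framePt 0 0 0 (-1) ∉ book n θ) : x ∉ polyhedron n θ := by
  rintro ⟨hxs, hb⟩
  set R : Set E3 := (fun t : ℝ => x + t • framePt 0 0 0 (-1)) '' Ici 0 with hR
  have hRsub : R ⊆ (surface n θ)ᶜ := by
    rintro _ ⟨t, ht, rfl⟩ h
    exact hx t ht (surface_subset_book hn hθ hθπ h)
  have hpre : IsPreconnected R := isPreconnected_Ici.image _ (by fun_prop)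
  have hxR : x ∈ R := ⟨0, self_mem_Ici, by simp⟩
  have hbR := hb.subset (hpre.subset_connectedComponentIn hxR hRsub)
  obtain ⟨M, hM⟩ := (isBounded_iff_forall_norm_le).1 hbR
  have h1 : ∀ t : ℝ, 0 ≤ t → t - depth x ≤ M := by
    intro t ht
    have h2 := hM _ ⟨t, ht, rfl⟩
    have h3 := abs_real_inner_le_norm (framePt 0 0 0 1) (x + t • framePt 0 0 0 (-1))
    rw [← depth_eq, (coords_add_smul_up 0 t x).2.2] at h3
    have h4 : ‖framePt 0 0 0 1‖ = 1 := by
      have := norm_framePt_sq 0 0 0 1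
      rw [← Real.sqrt_sq (norm_nonneg (framePt 0 0 0 1)), this]; simp
    rw [h4, one_mul] at h3
    have := neg_abs_le (depth x - t)
    linarith
  have := h1 (|depth x| + |M| + 1) (by positivity)
  linarith [le_abs_self (depth x), le_abs_self M]

theorem mem_polyhedron_of_mem_pageCore {k : ℕ} {x : E3} (hk : k + 1 ≤ n) (h : x ∈ pageCore n θ k)
    (hf : 0 < frontForm n θ (k + 1) x) (hb : 0 < backForm n θ (k + 1) x) :
    x ∈ polyhedron n θ := by
  refine mem_polyhedron hn hθ hθπ
    (mem_book_iff.2 ⟨_, by omega, hk, mem_page_of_mem_pageCore h hf.le hb.le⟩) fun hs => ?_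
  obtain ⟨i, hi1, hin, hi⟩ := mem_surface_iff.1 hs
  obtain ⟨i, rfl⟩ := Nat.exists_eq_add_of_le' hi1
  have hik := eq_of_mem_page hn hθ hθπ hk hin h.1 h.2.1 (pageBoundary_subset_page hn hθ hθπ hi1 hi)
  subst hik
  obtain ⟨-, h1 | h1 | h1 | h1 | h1⟩ := (mem_pageBoundary_iff hn hθ hθπ hi1).1 hi
  · exact hf.ne' h1
  · exact h.2.2.1.ne h1
  · exact hb.ne' h1
  · exact h.2.2.2.1.ne' h1
  · exact h.2.2.2.2.ne h1

/-- Going up leaves the position between the bisecting planes unchanged, which excludes all other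
pages. The forms of the front and the back do not increase as the depth decreases, so the violated
one stays negative. -/
theorem notMem_polyhedron_of_mem_pageCore {k : ℕ} {x : E3} (hk : k + 1 ≤ n)
    (h : x ∈ pageCore n θ k)
    (hfb : frontForm n θ (k + 1) x < 0 ∨ backForm n θ (k + 1) x < 0) : x ∉ polyhedron n θ := by
  refine notMem_polyhedron hn hθ hθπ fun t ht hb => ?_
  have H := pageShape hn hθ hθπ (k + 1)
  have hc := fun α => coords_add_smul_up α t x
  obtain ⟨i, hi1, hin, hi⟩ := mem_book_iff.1 hb
  obtain ⟨i, rfl⟩ := Nat.exists_eq_add_of_le' hi1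
  have hik := eq_of_mem_page hn hθ hθπ hk hin (by rw [gapForm, (hc _).2.1]; exact h.1)
    (by rw [gapForm, (hc _).2.1]; exact h.2.1) hi
  subst hik
  obtain ⟨h1, h2, -⟩ := mem_page_iff.1 hi
  have ha := mul_nonneg (mul_nonneg H.a_nonneg H.S_pos.le) ht
  have hb := mul_nonneg (mul_nonneg H.b_nonneg H.S_pos.le) ht
  rw [frontForm, (hc _).1, (hc _).2.1, (hc 0).2.2] at h1
  rw [backForm, (hc _).1, (hc _).2.1, (hc 0).2.2] at h2
  unfold frontForm backForm at hfb
  rcases hfb with hfb | hfb <;> linarith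

theorem outwardNormal_front {k : ℕ} {y : E3} (hk : k + 1 ≤ n) (h : y ∈ pageCore n θ k)
    (hf : frontForm n θ (k + 1) y = 0) (hb : 0 < backForm n θ (k + 1) y) {N : E3} (hN : ‖N‖ = 1)
    {c : ℝ} (hc : 0 < c) (hNf : ∀ x, inner ℝ N x = -(c * frontForm n θ (k + 1) x)) :
    outwardNormal (polyhedron n θ) y = N := by
  have hev := (isOpen_pageCore k).mem_nhds h
  refine outwardNormal_eq_of_sides hN ?_ ?_
  · filter_upwards [hev, (continuous_backForm _).continuousAt.eventually_const_lt hb] with x h1 h2 h3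
    rw [inner_sub_right, hNf, hNf, hf] at h3
    refine mem_polyhedron_of_mem_pageCore hn hθ hθπ hk h1 ?_ h2
    exact pos_of_mul_pos_right (by linarith : 0 < c * frontForm n θ (k + 1) x) hc.le
  · filter_upwards [hev] with x h1 h3
    rw [inner_sub_right, hNf, hNf, hf] at h3
    refine notMem_polyhedron_of_mem_pageCore hn hθ hθπ hk h1 (Or.inl ?_)
    by_contra h4
    have := mul_nonneg hc.le (not_lt.1 h4)
    linarith

theorem outwardNormal_back {k : ℕ} {y : E3} (hk : k + 1 ≤ n) (h : y ∈ pageCore n θ k)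
    (hf : 0 < frontForm n θ (k + 1) y) (hb : backForm n θ (k + 1) y = 0) {N : E3} (hN : ‖N‖ = 1)
    {c : ℝ} (hc : 0 < c) (hNf : ∀ x, inner ℝ N x = -(c * backForm n θ (k + 1) x)) :
    outwardNormal (polyhedron n θ) y = N := by
  have hev := (isOpen_pageCore k).mem_nhds h
  refine outwardNormal_eq_of_sides hN ?_ ?_
  · filter_upwards [hev, (continuous_frontForm _).continuousAt.eventually_const_lt hf] with x h1 h2 h3
    rw [inner_sub_right, hNf, hNf, hb] at h3
    refine mem_polyhedron_of_mem_pageCore hn hθ hθπ hk h1 h2 ?_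
    exact pos_of_mul_pos_right (by linarith : 0 < c * backForm n θ (k + 1) x) hc.le
  · filter_upwards [hev] with x h1 h3
    rw [inner_sub_right, hNf, hNf, hb] at h3
    refine notMem_polyhedron_of_mem_pageCore hn hθ hθπ hk h1 (Or.inr ?_)
    by_contra h4
    have := mul_nonneg hc.le (not_lt.1 h4)
    linarith

end OpenBook
end

noncomputable section
namespace OpenBook

/-! ### The solid angle of a square seen from a nearby point -/

/-- The open square `(1, 2)²`. -/
def unitSquare : Set (ℝ × ℝ) := Ioo 1 2 ×ˢ Ioo 1 2

theorem isOpen_unitSquare : IsOpen unitSquare := isOpen_Ioo.prod isOpen_Ioo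

theorem volume_unitSquare : volume unitSquare = 1 := by
  rw [unitSquare, Measure.volume_eq_prod, Measure.prod_prod, Real.volume_Ioo]
  norm_num

/-- The density of the solid angle at height one, normalised. -/
def poissonDensity (w : ℝ × ℝ) : ℝ := (4 * Real.pi * √(w.1 ^ 2 + w.2 ^ 2 + 1) ^ 3)⁻¹

/-- The solid angle, divided by `4π`, of the unit square seen from the point of height `d` above
`A`, with the sign of `d`. -/
def poissonInt (A : ℝ × ℝ) (d : ℝ) : ℝ :=
  ∫ v in unitSquare, d / (4 * Real.pi * √((A.1 - v.1) ^ 2 + (A.2 - v.2) ^ 2 + d ^ 2) ^ 3)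

theorem poissonDensity_nonneg (w : ℝ × ℝ) : 0 ≤ poissonDensity w := by
  unfold poissonDensity; positivity

theorem continuous_poissonDensity : Continuous poissonDensity := by
  unfold poissonDensity
  refine Continuous.inv₀ (by fun_prop) fun w => ?_
  have : 0 < w.1 ^ 2 + w.2 ^ 2 + 1 := by positivity
  positivity

theorem poissonDensity_eq (w : ℝ × ℝ) :
    poissonDensity w = (4 * Real.pi)⁻¹ * (w.1 ^ 2 + w.2 ^ 2 + 1) ^ (-(3 / 2) : ℝ) := by
  have h : 0 < w.1 ^ 2 + w.2 ^ 2 + 1 := by positivity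
  rw [poissonDensity, mul_inv, Real.rpow_neg h.le, Real.sqrt_eq_rpow, ← Real.rpow_mul_natCast h.le]
  norm_num

theorem integrable_poissonDensity : Integrable poissonDensity := by
  refine ⟨continuous_poissonDensity.aestronglyMeasurable, ?_⟩
  have h := lintegral_one_add_sq_rpow_lt_top (r := 3 / 2) (by norm_num)
  rw [hasFiniteIntegral_iff_ofReal (ae_of_all _ poissonDensity_nonneg)]
  simp only [poissonDensity_eq, ENNReal.ofReal_mul (by positivity : 0 ≤ (4 * Real.pi)⁻¹)]
  rw [lintegral_const_mul' _ _ ENNReal.ofReal_ne_top]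
  exact ENNReal.mul_lt_top ENNReal.ofReal_lt_top h

theorem hasDerivAt_neg_inv_sqrt (r : ℝ) :
    HasDerivAt (fun r : ℝ => -(√(r ^ 2 + 1))⁻¹) (r / √(r ^ 2 + 1) ^ 3) r := by
  have h0 : 0 < r ^ 2 + 1 := by positivity
  have h1 : HasDerivAt (fun r : ℝ => r ^ 2 + 1) (2 * r) r := by
    simpa using (hasDerivAt_pow 2 r).add_const 1
  have h2 := ((h1.sqrt h0.ne').inv (Real.sqrt_pos.2 h0).ne').neg
  have h3 := (Real.sqrt_pos.2 h0).ne'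
  have e : r / √(r ^ 2 + 1) ^ 3 = -(-(2 * r / (2 * √(r ^ 2 + 1))) / √(r ^ 2 + 1) ^ 2) := by
    field_simp
  rw [e]
  exact h2

theorem integral_Ioi_radial : ∫ r in Ioi (0 : ℝ), r / √(r ^ 2 + 1) ^ 3 = 1 := by
  have hlim : Tendsto (fun r : ℝ => -(√(r ^ 2 + 1))⁻¹) atTop (𝓝 0) := by
    rw [← neg_zero]
    refine (tendsto_inv_atTop_zero.comp ?_).neg
    refine tendsto_atTop_mono (fun r => ?_) tendsto_id
    exact Real.le_sqrt_of_sq_le (by simp)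
  have := integral_Ioi_of_hasDerivAt_of_nonneg' (a := 0)
    (g := fun r : ℝ => -(√(r ^ 2 + 1))⁻¹) (g' := fun r => r / √(r ^ 2 + 1) ^ 3) (l := 0)
    (fun r _ => hasDerivAt_neg_inv_sqrt r)
    (fun r hr => div_nonneg (le_of_lt hr) (by positivity)) hlim
  rw [this]
  simp

/-- A full plane subtends a solid angle `2π` out of `4π`; in polar coordinates the radial integral
equals `1`. -/
theorem integral_poissonDensity : ∫ w, poissonDensity w = 1 / 2 := by
  rw [← integral_comp_polarCoord_symm]
  have h : ∀ p ∈ polarCoord.target, p.1 • poissonDensity (polarCoord.symm p) =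
      (p.1 / √(p.1 ^ 2 + 1) ^ 3) * (4 * Real.pi)⁻¹ := by
    intro p _
    rw [polarCoord_symm_apply, poissonDensity]
    have : (p.1 * Real.cos p.2) ^ 2 + (p.1 * Real.sin p.2) ^ 2 = p.1 ^ 2 := by
      linear_combination p.1 ^ 2 * Real.sin_sq_add_cos_sq p.2
    simp only [this, mul_inv, smul_eq_mul]
    ring
  rw [setIntegral_congr_fun polarCoord.open_target.measurableSet h, polarCoord_target,
    Measure.volume_eq_prod, setIntegral_prod_mul (fun r : ℝ => r / √(r ^ 2 + 1) ^ 3)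
      (fun _ : ℝ => (4 * Real.pi)⁻¹), integral_Ioi_radial, setIntegral_const]
  simp
  have := Real.pi_pos
  rw [max_eq_left (by linarith)]
  field_simp
  norm_num

theorem poissonInt_neg (A : ℝ × ℝ) (d : ℝ) : poissonInt A (-d) = -poissonInt A d := by
  rw [poissonInt, poissonInt, ← integral_neg]
  simp only [neg_div, neg_sq]

/-- Substituting `v = A + d w` moves the dependence on the height from the kernel to the domain of
integration. -/
theorem poissonInt_eq (A : ℝ × ℝ) {d : ℝ} (hd : 0 < d) : poissonInt A d =
    ∫ w, {w | A + d • w ∈ unitSquare}.indicator poissonDensity w := by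
  rw [poissonInt, ← integral_indicator isOpen_unitSquare.measurableSet]
  set G : ℝ × ℝ → ℝ := unitSquare.indicator fun v =>
    d / (4 * Real.pi * √((A.1 - v.1) ^ 2 + (A.2 - v.2) ^ 2 + d ^ 2) ^ 3) with hG
  have h1 : ∫ w, G (A + d • w) = (d ^ 2)⁻¹ * ∫ v, G v := by
    rw [Measure.integral_comp_smul volume (fun w => G (A + w)), integral_add_left_eq_self G]
    simp
  have h2 : ∫ v, G v = d ^ 2 * ∫ w, G (A + d • w) := by
    rw [h1]; field_simp
  rw [h2, ← integral_const_mul]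
  refine integral_congr_ae (ae_of_all _ fun w => ?_)
  change d ^ 2 * G (A + d • w) = _
  by_cases hw : A + d • w ∈ unitSquare
  · rw [hG, indicator_of_mem hw, indicator_of_mem (s := {w | A + d • w ∈ unitSquare}) hw]
    have h3 : (A.1 - (A + d • w).1) ^ 2 + (A.2 - (A + d • w).2) ^ 2 + d ^ 2 =
        d ^ 2 * (w.1 ^ 2 + w.2 ^ 2 + 1) := by
      simp; ring
    rw [h3, Real.sqrt_mul (by positivity), Real.sqrt_sq hd.le, poissonDensity]
    have : 0 < √(w.1 ^ 2 + w.2 ^ 2 + 1) := Real.sqrt_pos.2 (by positivity)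
    have := Real.pi_pos
    field_simp
  · rw [hG, indicator_of_notMem hw,
      indicator_of_notMem (s := {w | A + d • w ∈ unitSquare}) hw, mul_zero]

theorem measurableSet_preimage_unitSquare (A : ℝ × ℝ) (d : ℝ) :
    MeasurableSet {w : ℝ × ℝ | A + d • w ∈ unitSquare} :=
  (isOpen_unitSquare.preimage (f := fun w : ℝ × ℝ => A + d • w) (by fun_prop)).measurableSet

theorem abs_poissonInt_le (A : ℝ × ℝ) {d : ℝ} (hd : 0 < d) : ‖poissonInt A d‖ ≤ 1 / 2 := by
  rw [poissonInt_eq A hd, ← integral_poissonDensity, Real.norm_of_nonneg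
    (integral_nonneg fun w => indicator_nonneg (fun w _ => poissonDensity_nonneg w) w)]
  exact integral_mono (integrable_poissonDensity.indicator (measurableSet_preimage_unitSquare A d))
    integrable_poissonDensity (indicator_le_self' fun w _ => poissonDensity_nonneg w)

section Limit

variable {ι : Type*} {l : Filter ι} [l.IsCountablyGenerated]

/-- The rescaled squares, seen from a point approaching an interior point `u`, fill the whole plane,
and `poissonDensity` dominates. -/
theorem tendsto_poissonInt {A : ι → ℝ × ℝ} {d : ι → ℝ} {u : ℝ × ℝ} (hu : u ∈ unitSquare)
    (hA : Tendsto A l (𝓝 u)) (hd : Tendsto d l (𝓝 0)) (hpos : ∀ᶠ i in l, 0 < d i) :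
    Tendsto (fun i => poissonInt (A i) (d i)) l (𝓝 (1 / 2)) := by
  rw [← integral_poissonDensity]
  refine Tendsto.congr' (hpos.mono fun i hi => (poissonInt_eq (A i) hi).symm) ?_
  refine tendsto_integral_filter_of_dominated_convergence poissonDensity
    (Eventually.of_forall fun i => (integrable_poissonDensity.indicator
      (measurableSet_preimage_unitSquare (A i) (d i))).aestronglyMeasurable)
    (Eventually.of_forall fun i => ae_of_all _ fun w => ?_) integrable_poissonDensity
    (ae_of_all _ fun w => ?_)
  · rw [Real.norm_of_nonneg (indicator_nonneg (fun w _ => poissonDensity_nonneg w) w)]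
    exact indicator_le_self' (fun w _ => poissonDensity_nonneg w) w
  · have h1 : Tendsto (fun i => A i + d i • w) l (𝓝 u) := by
      simpa using hA.add (hd.smul_const w)
    refine tendsto_const_nhds.congr' ?_
    filter_upwards [h1 (isOpen_unitSquare.mem_nhds hu)] with i hi
    exact (indicator_of_mem (s := {w | A i + d i • w ∈ unitSquare}) hi _).symm

theorem tendsto_integral_poissonInt {A : ι → ℝ × ℝ → ℝ × ℝ} {d : ι → ℝ × ℝ → ℝ}
    (hAc : ∀ i, Continuous (A i)) (hdc : ∀ i, Continuous (d i))
    (hA : ∀ u ∈ unitSquare, Tendsto (fun i => A i u) l (𝓝 u))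
    (hd : ∀ u ∈ unitSquare, Tendsto (fun i => d i u) l (𝓝 0))
    (hpos : ∀ᶠ i in l, ∀ u ∈ unitSquare, 0 < d i u) :
    Tendsto (fun i => ∫ u in unitSquare, poissonInt (A i u) (d i u)) l (𝓝 (1 / 2)) := by
  have h1 : ∫ _u in unitSquare, (1 / 2 : ℝ) = 1 / 2 := by
    rw [setIntegral_const, measureReal_def, volume_unitSquare]; simp
  rw [← h1]
  have hint : IntegrableOn (fun _ : ℝ × ℝ => (1 / 2 : ℝ)) unitSquare := by
    refine integrableOn_const ?_
    rw [volume_unitSquare]; simp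
  refine tendsto_integral_filter_of_dominated_convergence (fun _ => 1 / 2)
    (Eventually.of_forall fun i => ?_) ?_ hint ?_
  · refine StronglyMeasurable.aestronglyMeasurable ?_
    unfold poissonInt
    refine StronglyMeasurable.integral_prod_right (f := fun (u : ℝ × ℝ) (v : ℝ × ℝ) =>
      d i u / (4 * Real.pi * √(((A i u).1 - v.1) ^ 2 + ((A i u).2 - v.2) ^ 2 + d i u ^ 2) ^ 3)) ?_
    have := hAc i
    have := hdc i
    refine Measurable.stronglyMeasurable ?_
    refine Measurable.div (by fun_prop) (Continuous.measurable (by fun_prop))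
  · filter_upwards [hpos] with i hi
    filter_upwards [ae_restrict_mem isOpen_unitSquare.measurableSet] with u hu
    exact abs_poissonInt_le _ (hi u hu)
  · filter_upwards [ae_restrict_mem isOpen_unitSquare.measurableSet] with u hu
    exact tendsto_poissonInt hu (hA u hu) (hd u hu) (hpos.mono fun i hi => hi u hu)

end Limit

end OpenBook
end

noncomputable section

open scoped Pointwise
namespace OpenBook

/-! ### Test functions concentrated near the origin -/

/-- The image of the scaled square `δ • (1, 2)²` in the plane through `0` spanned by `b₀`, `b₁`. -/
def patch (b : OrthonormalBasis (Fin 3) ℝ E3) (δ : ℝ) : Set E3 :=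
  planeChart b 0 '' (δ • unitSquare)

theorem planeChart_smul (b : OrthonormalBasis (Fin 3) ℝ E3) (δ : ℝ) (u : ℝ × ℝ) :
    planeChart b 0 (δ • u) = δ • planeChart b 0 u := by
  simp [planeChart, smul_smul]

theorem inner_planeChart_self (b : OrthonormalBasis (Fin 3) ℝ E3) (u : ℝ × ℝ) :
    inner ℝ (b 2) (planeChart b 0 u) = 0 := by
  have := (inner_planeChart_sub b 0 0 u).2.2
  simpa using this

theorem measurableSet_smul_unitSquare (δ : ℝ) (hδ : δ ≠ 0) : MeasurableSet (δ • unitSquare) :=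
  (isOpen_unitSquare.smul₀ hδ).measurableSet

theorem measurableSet_patch (b : OrthonormalBasis (Fin 3) ℝ E3) {δ : ℝ} (hδ : δ ≠ 0) :
    MeasurableSet (patch b δ) :=
  (measurableEmbedding_planeChart b 0).measurableSet_image.2 (measurableSet_smul_unitSquare δ hδ)

theorem preimage_patch (b : OrthonormalBasis (Fin 3) ℝ E3) (δ : ℝ) :
    planeChart b 0 ⁻¹' patch b δ = δ • unitSquare :=
  preimage_image_eq _ (measurableEmbedding_planeChart b 0).injective

theorem patch_subset_range (b : OrthonormalBasis (Fin 3) ℝ E3) (δ : ℝ) :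
    patch b δ ⊆ range (planeChart b 0) := image_subset_range _ _

theorem hausdorff_patch (b : OrthonormalBasis (Fin 3) ℝ E3) (δ : ℝ) :
    (μHE[2] : Measure E3) (patch b δ) = ENNReal.ofReal (δ ^ 2) := by
  rw [hausdorff_planeChart b 0 (patch_subset_range b δ), preimage_patch, Measure.addHaar_smul,
    volume_unitSquare, Module.finrank_prod, Module.finrank_self, one_add_one_eq_two, abs_of_nonneg (sq_nonneg δ), mul_one]

theorem setIntegral_patch (b : OrthonormalBasis (Fin 3) ℝ E3) {δ : ℝ} (hδ : 0 < δ) (g : E3 → ℝ) :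
    ∫ x in patch b δ, g x ∂(μHE[2] : Measure E3) =
      δ ^ 2 * ∫ u in unitSquare, g (planeChart b 0 (δ • u)) := by
  have h := Measure.setIntegral_comp_smul_of_pos volume (fun u => g (planeChart b 0 u)) unitSquare hδ
  rw [Module.finrank_prod, Module.finrank_self] at h
  rw [setIntegral_planeChart b 0 (patch_subset_range b δ), preimage_patch, h, smul_eq_mul]
  have := hδ.ne'
  field_simp

/-- Plane faces through the origin that carry scaled squares, with their outward normals. -/
structure TestFaces (Γ Ω : Set E3) (N : ℕ) (b : ℕ → OrthonormalBasis (Fin 3) ℝ E3) (σ : ℕ → ℝ) :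
    Prop where
  mem : ∀ i < N, ∀ δ : ℝ, 0 < δ → δ ≤ 1 / 8 → ∀ u ∈ unitSquare, planeChart (b i) 0 (δ • u) ∈ Γ
  normal : ∀ i < N, ∀ δ : ℝ, 0 < δ → δ ≤ 1 / 8 → ∀ u ∈ unitSquare,
    outwardNormal Ω (planeChart (b i) 0 (δ • u)) = σ i • b i 2
  height_ne : ∀ i < N, ∀ k < N, i ≠ k → ∀ u ∈ unitSquare,
    inner ℝ (b k 2) (planeChart (b i) 0 u) ≠ 0

/-- The coupling of faces `i` and `k` through the double layer potential. -/
def faceEntry (b b' : OrthonormalBasis (Fin 3) ℝ E3) : ℝ :=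
  ∫ u in unitSquare, poissonInt (inner ℝ (b' 0) (planeChart b 0 u), inner ℝ (b' 1) (planeChart b 0 u))
    (inner ℝ (b' 2) (planeChart b 0 u))

theorem faceEntry_self (b : OrthonormalBasis (Fin 3) ℝ E3) : faceEntry b b = 0 := by
  simp [faceEntry, inner_planeChart_self, poissonInt]

/-- The size of the `m`-th patch. -/
def patchScale (m : ℕ) : ℝ := (1 / 4) ^ m / 8

theorem patchScale_pos (m : ℕ) : 0 < patchScale m := by unfold patchScale; positivity

theorem patchScale_le (m : ℕ) : patchScale m ≤ 1 / 8 := by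
  unfold patchScale
  have : (1 / 4 : ℝ) ^ m ≤ 1 := pow_le_one₀ (by norm_num) (by norm_num)
  linarith

theorem four_mul_patchScale_le {m m' : ℕ} (h : m < m') : 4 * patchScale m' ≤ patchScale m := by
  unfold patchScale
  have : (1 / 4 : ℝ) ^ m' ≤ (1 / 4) ^ (m + 1) :=
    pow_le_pow_of_le_one (by norm_num) (by norm_num) h
  rw [pow_succ] at this
  linarith

/-- First coordinates decide: one exceeds `δ ≥ 4δ'` and the other is below `2δ'`. -/
theorem disjoint_smul_unitSquare {δ δ' : ℝ} (hδ : 0 < δ') (h : 4 * δ' ≤ δ) {u u' : ℝ × ℝ}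
    (hu : u ∈ unitSquare) (hu' : u' ∈ unitSquare) : δ • u ≠ δ' • u' := by
  intro he
  have h1 := congrArg Prod.fst he
  simp only [Prod.smul_fst, smul_eq_mul] at h1
  have h2 := hu.1.1
  have h3 := hu'.1.2
  nlinarith

namespace TestFaces

variable {Γ Ω : Set E3} {N : ℕ} {b : ℕ → OrthonormalBasis (Fin 3) ℝ E3} {σ : ℕ → ℝ}

theorem patch_subset (H : TestFaces Γ Ω N b σ) {i : ℕ} (hi : i < N) {δ : ℝ} (hδ : 0 < δ)
    (hδ' : δ ≤ 1 / 8) : patch (b i) δ ⊆ Γ := by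
  rintro _ ⟨_, ⟨u, hu, rfl⟩, rfl⟩
  exact H.mem i hi δ hδ hδ' u hu

theorem disjoint_patch (H : TestFaces Γ Ω N b σ) {p q : Fin N × ℕ} (hpq : p ≠ q) :
    patch (b p.1) (patchScale p.2) ∩ patch (b q.1) (patchScale q.2) = ∅ := by
  obtain ⟨i, m⟩ := p
  obtain ⟨k, l⟩ := q
  rw [eq_empty_iff_forall_notMem]
  rintro x ⟨⟨_, ⟨u, hu, rfl⟩, rfl⟩, ⟨_, ⟨u', hu', rfl⟩, he⟩⟩
  simp only at hu hu' he
  by_cases hik : i = k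
  · subst hik
    have h1 := (measurableEmbedding_planeChart (b i) 0).injective he
    rcases lt_trichotomy m l with h | h | h
    · exact disjoint_smul_unitSquare (patchScale_pos l) (four_mul_patchScale_le h) hu hu' h1.symm
    · exact hpq (by rw [h])
    · exact disjoint_smul_unitSquare (patchScale_pos m) (four_mul_patchScale_le h) hu' hu h1
  · have h1 := H.height_ne i i.2 k k.2 (fun h => hik (Fin.ext h)) u hu
    have h2 := congrArg (fun y => inner ℝ (b k 2) y) he
    simp only [planeChart_smul, inner_smul_right, inner_planeChart_self, mul_zero] at h2
    exact h1 ((mul_eq_zero.1 h2.symm).resolve_left (patchScale_pos m).ne')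

/-- Both faces lie in planes through `0`, so scaling both points by `δ` multiplies the numerator by
`δ` and the denominator by `δ³`. -/
theorem dlKernel_planeChart (H : TestFaces Γ Ω N b σ) {i k : ℕ} (hk : k < N) {δ : ℝ} (hδ : 0 < δ)
    (hδ' : δ ≤ 1 / 8) {u v : ℝ × ℝ} (hv : v ∈ unitSquare) :
    dlKernel Ω (planeChart (b i) 0 (δ • u)) (planeChart (b k) 0 (δ • v)) =
      σ k * (δ ^ 2)⁻¹ * (inner ℝ (b k 2) (planeChart (b i) 0 u) /
        (4 * Real.pi * √((inner ℝ (b k 0) (planeChart (b i) 0 u) - v.1) ^ 2 +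
          (inner ℝ (b k 1) (planeChart (b i) 0 u) - v.2) ^ 2 +
          inner ℝ (b k 2) (planeChart (b i) 0 u) ^ 2) ^ 3)) := by
  set x := planeChart (b i) 0 u with hx
  have h1 : ‖planeChart (b i) 0 (δ • u) - planeChart (b k) 0 (δ • v)‖ =
      δ * √((inner ℝ (b k 0) x - v.1) ^ 2 + (inner ℝ (b k 1) x - v.2) ^ 2 +
        inner ℝ (b k 2) x ^ 2) := by
    rw [planeChart_smul, planeChart_smul, ← smul_sub, norm_smul, Real.norm_of_nonneg hδ.le, ← hx]
    congr 1
    rw [eq_comm, Real.sqrt_eq_iff_eq_sq (by positivity) (norm_nonneg _), norm_sub_planeChart_sq,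
      sub_zero]
    ring
  rw [dlKernel, h1, H.normal k hk δ hδ hδ' v hv, inner_smul_right, real_inner_comm, inner_sub_right,
    planeChart_smul, planeChart_smul, inner_smul_right, inner_smul_right, inner_planeChart_self,
    ← hx, mul_pow]
  simp only [mul_zero, sub_zero]
  have := hδ.ne'
  have := Real.pi_pos.ne'
  rw [div_eq_mul_inv, div_eq_mul_inv, mul_inv, mul_inv, mul_inv, mul_inv]
  field_simp

theorem integral_integral_dlKernel (H : TestFaces Γ Ω N b σ) {i k : ℕ} (hk : k < N) {δ : ℝ}
    (hδ : 0 < δ) (hδ' : δ ≤ 1 / 8) :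
    ∫ x in patch (b i) δ, ∫ y in patch (b k) δ, dlKernel Ω x y ∂(μHE[2] : Measure E3)
      ∂(μHE[2] : Measure E3) = δ ^ 2 * (σ k * faceEntry (b i) (b k)) := by
  rw [setIntegral_patch (b i) hδ]
  congr 1
  rw [faceEntry, ← integral_const_mul]
  congr 1 with u
  rw [setIntegral_patch (b k) hδ, setIntegral_congr_fun isOpen_unitSquare.measurableSet
    (fun v hv => H.dlKernel_planeChart (i := i) (u := u) hk hδ hδ' hv), integral_const_mul, poissonInt]
  have := hδ.ne'
  field_simp

/-- The vectors are indicators of patches divided by `δ`, the square root of the area. The double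
integral of the kernel is `δ²` times a constant, so `δ` cancels and the entry is the same at every
scale `m`. -/
theorem exists_orthonormal (H : TestFaces Γ Ω N b σ)
    {μ : Measure E3} (hμ : μ = (μHE[2] : Measure E3).restrict Γ) [IsFiniteMeasure μ]
    {D : Lp ℂ 2 μ →L[ℂ] Lp ℂ 2 μ}
    (hD : ∀ φ, ∀ᵐ x ∂μ, D φ x = ∫ y, dlKernel Ω x y • φ y ∂μ) :
    ∃ e : Fin N × ℕ → Lp ℂ 2 μ, Orthonormal ℂ e ∧
      ∀ (i k : Fin N) (m : ℕ),
        inner ℂ (e (i, m)) (D (e (k, m))) = ((σ k * faceEntry (b i) (b k) : ℝ) : ℂ) := by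
  have hmeas : ∀ p : Fin N × ℕ, MeasurableSet (patch (b p.1) (patchScale p.2)) := fun p =>
    measurableSet_patch _ (patchScale_pos _).ne'
  have hsub : ∀ p : Fin N × ℕ, patch (b p.1) (patchScale p.2) ⊆ Γ := fun p =>
    H.patch_subset p.1.2 (patchScale_pos _) (patchScale_le _)
  have hres : ∀ p : Fin N × ℕ, μ.restrict (patch (b p.1) (patchScale p.2)) =
      (μHE[2] : Measure E3).restrict (patch (b p.1) (patchScale p.2)) := fun p => by
    rw [hμ]; exact Measure.restrict_restrict_of_subset (hsub p)
  refine ⟨fun p => indicatorConstLp 2 (hmeas p) (measure_ne_top μ _)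
    (((patchScale p.2)⁻¹ : ℝ) : ℂ), ?_, fun i k m => ?_⟩
  · rw [orthonormal_iff_ite]
    intro p q
    rw [L2.inner_indicatorConstLp_indicatorConstLp]
    split_ifs with hpq
    · subst hpq
      have h0 := (patchScale_pos p.2).ne'
      rw [inter_self, measureReal_def, hμ, Measure.restrict_apply (hmeas p),
        inter_eq_left.2 (hsub p), hausdorff_patch, ENNReal.toReal_ofReal (sq_nonneg _)]
      simp only [RCLike.inner_apply, Complex.conj_ofReal, Complex.real_smul, ← Complex.ofReal_mul]
      rw [← Complex.ofReal_one]
      congr 1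
      field_simp
    · rw [H.disjoint_patch hpq]
      simp
  · have hδ := patchScale_pos m
    rw [L2.inner_indicatorConstLp_eq_inner_setIntegral]
    set f := indicatorConstLp 2 (hmeas (k, m)) (measure_ne_top μ _)
      (((patchScale m)⁻¹ : ℝ) : ℂ) with hf
    have h1 : ∀ x, ∫ y, dlKernel Ω x y • f y ∂μ =
        (((patchScale m)⁻¹ * ∫ y in patch (b k) (patchScale m), dlKernel Ω x y
          ∂(μHE[2] : Measure E3) : ℝ) : ℂ) := fun x => by
      rw [← integral_const_mul, ← integral_complex_ofReal, ← hres (k, m), ← integral_indicator (hmeas (k, m))]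
      refine integral_congr_ae ?_
      filter_upwards [indicatorConstLp_coeFn (p := 2) (hs := hmeas (k, m))
        (hμs := measure_ne_top μ _) (c := (((patchScale m)⁻¹ : ℝ) : ℂ))] with y hy
      rw [hf, hy]
      by_cases hyp : y ∈ patch (b k) (patchScale m)
      · rw [indicator_of_mem hyp, indicator_of_mem hyp, Complex.real_smul, ← Complex.ofReal_mul,
          mul_comm]
      · rw [indicator_of_notMem hyp, indicator_of_notMem hyp, smul_zero]
    have h2 : ∫ x in patch (b i) (patchScale m), D f x ∂μ =
        ((patchScale m * (σ k * faceEntry (b i) (b k)) : ℝ) : ℂ) := by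
      rw [integral_congr_ae (ae_restrict_of_ae ((hD f).mono fun x hx => hx.trans (h1 x))),
        hres (i, m), integral_complex_ofReal, integral_const_mul,
        H.integral_integral_dlKernel k.2 hδ (patchScale_le m)]
      congr 1
      field_simp
    rw [h2]
    simp only [RCLike.inner_apply, Complex.conj_ofReal, ← Complex.ofReal_mul]
    congr 1
    field_simp

end TestFaces

end OpenBook
end

noncomputable section
namespace OpenBook

/-! ### Orthonormal frames adapted to the faces -/

theorem orthonormal_faceBasis (α t : ℝ) : Orthonormal ℝ ![framePt α 1 0 0,
    framePt α 0 (-(t / √(1 + t ^ 2))) (1 / √(1 + t ^ 2)),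
    framePt α 0 (1 / √(1 + t ^ 2)) (t / √(1 + t ^ 2))] := by
  have h0 : 0 < √(1 + t ^ 2) := Real.sqrt_pos.2 (by positivity)
  have h1 : √(1 + t ^ 2) ^ 2 = 1 + t ^ 2 := Real.sq_sqrt (by positivity)
  have hn : ∀ p q h : ℝ, p ^ 2 + q ^ 2 + h ^ 2 = 1 → ‖framePt α p q h‖ = 1 := fun p q h e => by
    rw [← pow_eq_one_iff_of_nonneg (norm_nonneg _) two_ne_zero, norm_framePt_sq, e]
  constructor
  · intro i
    fin_cases i <;> refine hn _ _ _ ?_ <;> field_simp <;> linarith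
  · intro i j hij
    fin_cases i <;> fin_cases j <;> first | exact absurd rfl hij | skip
    all_goals
      simp [inner_framePt]
      try (field_simp; ring)

/-- The frame of the plane through the radial direction of angle `α` in which `t` times the depth
is opposite to the lateral coordinate: radial direction, downward direction, normal. -/
def faceBasis (α t : ℝ) : OrthonormalBasis (Fin 3) ℝ E3 :=
  (basisOfOrthonormalOfCardEqFinrank (orthonormal_faceBasis α t)
    (by simp)).toOrthonormalBasis (by
      rw [coe_basisOfOrthonormalOfCardEqFinrank]; exact orthonormal_faceBasis α t)

theorem coe_faceBasis (α t : ℝ) : ⇑(faceBasis α t) = ![framePt α 1 0 0,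
    framePt α 0 (-(t / √(1 + t ^ 2))) (1 / √(1 + t ^ 2)),
    framePt α 0 (1 / √(1 + t ^ 2)) (t / √(1 + t ^ 2))] := by
  rw [faceBasis, Module.Basis.coe_toOrthonormalBasis, coe_basisOfOrthonormalOfCardEqFinrank]

theorem planeChart_faceBasis (α t : ℝ) (u : ℝ × ℝ) : planeChart (faceBasis α t) 0 u =
    framePt α u.1 (-(t * (u.2 / √(1 + t ^ 2)))) (u.2 / √(1 + t ^ 2)) := by
  rw [planeChart, coe_faceBasis]
  change 0 + u.1 • framePt α 1 0 0 +
    u.2 • framePt α 0 (-(t / √(1 + t ^ 2))) (1 / √(1 + t ^ 2)) = _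
  rw [zero_add, ← framePt_smul, ← framePt_smul, ← framePt_add]
  congr 1 <;> ring

theorem inner_faceBasis_two (α t : ℝ) (x : E3) : inner ℝ (faceBasis α t 2) x =
    (√(1 + t ^ 2))⁻¹ * (lateral α x + t * depth x) := by
  rw [coe_faceBasis]
  change inner ℝ (framePt α 0 (1 / √(1 + t ^ 2)) (t / √(1 + t ^ 2))) x = _
  rw [inner_framePt]
  ring

/-- The position of a point of the face `(α, t)` relative to the face `(α + φ, t')`. -/
theorem inner_faceBasis_planeChart (α φ t t' : ℝ) (u : ℝ × ℝ) :
    inner ℝ (faceBasis (α + φ) t' 0) (planeChart (faceBasis α t) 0 u) =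
      Real.cos φ * u.1 - Real.sin φ * (t * (u.2 / √(1 + t ^ 2))) ∧
    inner ℝ (faceBasis (α + φ) t' 1) (planeChart (faceBasis α t) 0 u) =
      t' / √(1 + t' ^ 2) * (Real.sin φ * u.1 + Real.cos φ * (t * (u.2 / √(1 + t ^ 2)))) +
        u.2 / √(1 + t ^ 2) / √(1 + t' ^ 2) ∧
    inner ℝ (faceBasis (α + φ) t' 2) (planeChart (faceBasis α t) 0 u) =
      (√(1 + t' ^ 2))⁻¹ * (-(Real.sin φ * u.1) -
        Real.cos φ * (t * (u.2 / √(1 + t ^ 2))) + t' * (u.2 / √(1 + t ^ 2))) := by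
  refine ⟨?_, ?_, ?_⟩
  · rw [coe_faceBasis]
    change inner ℝ (framePt (α + φ) 1 0 0) _ = _
    rw [inner_framePt, radial_add, planeChart_faceBasis, radial_framePt, lateral_framePt]
    ring
  · rw [coe_faceBasis]
    change inner ℝ (framePt (α + φ) 0 (-(t' / √(1 + t' ^ 2))) (1 / √(1 + t' ^ 2))) _ = _
    rw [inner_framePt, lateral_add, planeChart_faceBasis, radial_framePt, lateral_framePt,
      depth_framePt]
    ring
  · rw [inner_faceBasis_two, lateral_add, planeChart_faceBasis, radial_framePt, lateral_framePt,
      depth_framePt]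
    ring

/-- As the two faces approach the same vertical plane, their coupling tends to one half of the sign
of their relative height. -/
theorem tendsto_faceEntry {ι : Type*} {l : Filter ι} [l.IsCountablyGenerated] {α φ t t' : ι → ℝ}
    (hφ : Tendsto φ l (𝓝 0)) (ht : Tendsto t l (𝓝 0)) (ht' : Tendsto t' l (𝓝 0)) {s : ℝ}
    (hs : s = 1 ∨ s = -1)
    (hpos : ∀ᶠ i in l, ∀ u ∈ unitSquare, 0 < s *
      inner ℝ (faceBasis (α i + φ i) (t' i) 2) (planeChart (faceBasis (α i) (t i)) 0 u)) :
    Tendsto (fun i => faceEntry (faceBasis (α i) (t i)) (faceBasis (α i + φ i) (t' i))) l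
      (𝓝 (s / 2)) := by
  have hroot : ∀ {t : ι → ℝ}, Tendsto t l (𝓝 0) → Tendsto (fun i => √(1 + t i ^ 2)) l (𝓝 1) :=
    fun h => by simpa using ((h.pow 2).const_add 1).sqrt
  have hw : ∀ {t : ι → ℝ} (c : ℝ), Tendsto t l (𝓝 0) →
      Tendsto (fun i => c / √(1 + t i ^ 2)) l (𝓝 c) := fun c h => by
    have := (tendsto_const_nhds (x := c)).div (hroot h) one_ne_zero
    rw [div_one] at this
    exact this
  have hcos : Tendsto (fun i => Real.cos (φ i)) l (𝓝 1) := by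
    rw [← Real.cos_zero]
    exact (Real.continuous_cos.tendsto 0).comp hφ
  have hsin : Tendsto (fun i => Real.sin (φ i)) l (𝓝 0) := by
    rw [← Real.sin_zero]
    exact (Real.continuous_sin.tendsto 0).comp hφ
  have h1 : ∀ u : ℝ × ℝ, Tendsto (fun i =>
      inner ℝ (faceBasis (α i + φ i) (t' i) 0) (planeChart (faceBasis (α i) (t i)) 0 u)) l
      (𝓝 u.1) := fun u => by
    simp only [fun i => (inner_faceBasis_planeChart (α i) (φ i) (t i) (t' i) u).1]
    simpa using (hcos.mul_const u.1).sub (hsin.mul (ht.mul (hw u.2 ht)))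
  have h2 : ∀ u : ℝ × ℝ, Tendsto (fun i =>
      inner ℝ (faceBasis (α i + φ i) (t' i) 1) (planeChart (faceBasis (α i) (t i)) 0 u)) l
      (𝓝 u.2) := fun u => by
    simp only [fun i => (inner_faceBasis_planeChart (α i) (φ i) (t i) (t' i) u).2.1]
    simpa using ((ht'.div (hroot ht') one_ne_zero).mul
      ((hsin.mul_const u.1).add (hcos.mul (ht.mul (hw u.2 ht))))).add
      ((hw u.2 ht).div (hroot ht') one_ne_zero)
  have h3 : ∀ u : ℝ × ℝ, Tendsto (fun i => s *
      inner ℝ (faceBasis (α i + φ i) (t' i) 2) (planeChart (faceBasis (α i) (t i)) 0 u)) l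
      (𝓝 0) := fun u => by
    simp only [fun i => (inner_faceBasis_planeChart (α i) (φ i) (t i) (t' i) u).2.2]
    simpa using (((hroot ht').inv₀ one_ne_zero).mul
      (((hsin.mul_const u.1).neg.sub (hcos.mul (ht.mul (hw u.2 ht)))).add
        (ht'.mul (hw u.2 ht)))).const_mul s
  have hcont := fun i => continuous_planeChart (faceBasis (α i) (t i)) 0
  have key := tendsto_integral_poissonInt (l := l)
    (A := fun i u => (inner ℝ (faceBasis (α i + φ i) (t' i) 0)
        (planeChart (faceBasis (α i) (t i)) 0 u),
      inner ℝ (faceBasis (α i + φ i) (t' i) 1) (planeChart (faceBasis (α i) (t i)) 0 u)))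
    (d := fun i u => s *
      inner ℝ (faceBasis (α i + φ i) (t' i) 2) (planeChart (faceBasis (α i) (t i)) 0 u))
    (fun i => by have := hcont i; fun_prop) (fun i => by have := hcont i; fun_prop)
    (fun u _ => (h1 u).prodMk_nhds (h2 u)) (fun u _ => h3 u) hpos
  -- The solid angle is odd in the height, which reduces negative heights to positive ones.
  have h4 : ∀ (A : ℝ × ℝ) (d : ℝ), poissonInt A d = s * poissonInt A (s * d) := by
    intro A d
    rcases hs with rfl | rfl
    · rw [one_mul, one_mul]
    · rw [neg_one_mul d, poissonInt_neg]; ring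
  unfold faceEntry
  simp only [h4 _ (inner ℝ (faceBasis _ _ 2) _), integral_const_mul]
  have h5 := key.const_mul s
  rwa [mul_one_div] at h5

/-! ### The faces along the spine of the open book -/

variable {n : ℕ} {θ : ℝ}

/-- The tilt of the `i`-th of the faces that meet the spine. -/
def faceTilt (n : ℕ) (θ : ℝ) (i : ℕ) : ℝ :=
  if Even i then frontShift n θ (i / 2 + 1) * halfSin n θ
  else -(backShift n θ (i / 2 + 1) * halfSin n θ)

/-- The frame of the `i`-th of the faces that meet the spine. -/
def spineBasis (n : ℕ) (θ : ℝ) (i : ℕ) : OrthonormalBasis (Fin 3) ℝ E3 :=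
  faceBasis (i * pageAngle n θ) (faceTilt n θ i)

/-- The sign that makes the normal of `spineBasis` point outwards. -/
def faceSign (i : ℕ) : ℝ := if Even i then -1 else 1

/-- The faces through the spine are numbered by the rays in which they meet the top: face `i`
contains the ray of angle `i θ_n`. Even numbers are fronts and odd ones are backs. -/
theorem frontForm_eq_tilt (j : ℕ) (x : E3) : frontForm n θ (j + 1) x =
    lateral ((2 * j : ℕ) * pageAngle n θ) x + faceTilt n θ (2 * j) * depth x := by
  rw [show (2 * j : ℕ) * pageAngle n θ = midAngle n θ (j + 1) + -(pageAngle n θ / 2) by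
    unfold midAngle; push_cast; ring, lateral_add, Real.sin_neg, Real.cos_neg, faceTilt,
    if_pos (even_two_mul j), Nat.mul_div_cancel_left _ two_pos, frontForm]
  simp only [halfSin, halfCos]
  ring

theorem backForm_eq_tilt (j : ℕ) (x : E3) : backForm n θ (j + 1) x =
    -(lateral ((2 * j + 1 : ℕ) * pageAngle n θ) x + faceTilt n θ (2 * j + 1) * depth x) := by
  rw [show (2 * j + 1 : ℕ) * pageAngle n θ = midAngle n θ (j + 1) + pageAngle n θ / 2 by
    unfold midAngle; push_cast; ring, lateral_add, faceTilt,
    if_neg (Nat.not_even_iff_odd.2 (odd_two_mul_add_one j)),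
    show (2 * j + 1) / 2 = j by omega, backForm]
  simp only [halfSin, halfCos]
  ring

/-- Points of the front of a page close to the spine satisfy all other conditions strictly. -/
theorem PageShape.near_spine {S C c a b p h : ℝ} (H : PageShape S C c a b) (ha : a ≤ 1 / 4)
    (hp : 0 < p) (hp' : p < 1 / 4) (hh : 0 < h) (hh' : h < 1 / 4) (hph : h < 2 * p) :
    S * (C * p - a * S ^ 2 * h) + C * -(S * p + C * a * S * h) + a * S * h = 0 ∧
    0 < S * (C * p - a * S ^ 2 * h) - C * -(S * p + C * a * S * h) + b * S * h ∧
    0 < 2 * S * C * (C * p - a * S ^ 2 * h) + (C ^ 2 - S ^ 2) * -(S * p + C * a * S * h) ∧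
    0 < 2 * S * C * (C * p - a * S ^ 2 * h) - (C ^ 2 - S ^ 2) * -(S * p + C * a * S * h) ∧
    C * p - a * S ^ 2 * h + (C - c) * h < C := by
  have hS := H.S_pos
  have hC := H.C_pos
  have hsq := H.sq
  have hK := H.cos_pos
  have ha0 := H.a_nonneg
  have hb0 := H.b_nonneg
  have hC1 : C < 1 := by nlinarith
  have hah : a * h < p / 2 := by nlinarith
  have hah0 : 0 ≤ a * h := by positivity
  have hP : 0 < C * p - a * S ^ 2 * h := by
    have h1 : S ^ 2 < C := by nlinarith
    have h2 : S ^ 2 * (a * h) ≤ C * (a * h) := mul_le_mul_of_nonneg_right h1.le hah0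
    have h3 : C * (a * h) < C * (p / 2) := mul_lt_mul_of_pos_left hah hC
    nlinarith
  refine ⟨?_, ?_, ?_, ?_, ?_⟩
  · linear_combination -a * S * h * hsq
  · have h1 : S * (C * p - a * S ^ 2 * h) - C * -(S * p + C * a * S * h) + b * S * h =
        S * (2 * C * p + (C ^ 2 - S ^ 2) * (a * h) + b * h) := by ring
    rw [h1]; positivity
  · have h1 : 2 * S * C * (C * p - a * S ^ 2 * h) + (C ^ 2 - S ^ 2) * -(S * p + C * a * S * h) =
        S * (p - C * (a * h)) := by
      linear_combination (S * p - C * a * S * h) * hsq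
    rw [h1]
    have h2 : C * (a * h) ≤ 1 * (a * h) := mul_le_mul_of_nonneg_right hC1.le hah0
    exact mul_pos hS (by linarith)
  · have h1 : 0 ≤ (C ^ 2 - S ^ 2) * (S * p + C * a * S * h) := by positivity
    have h2 : 0 < 2 * S * C * (C * p - a * S ^ 2 * h) := by positivity
    linarith
  · have h1 : C * p < C * (1 / 4) := mul_lt_mul_of_pos_left hp' hC
    have h2 : (C - c) * h ≤ C * (1 / 4) := by
      have := H.c_lt
      have := H.c_pos
      nlinarith
    have h3 : 0 ≤ a * S ^ 2 * h := by positivity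
    linarith

/-- Jordan's inequality for `sin (θ_n/2)` and `sin η ≤ η` bound `r₂` by `π η / θ_n`, and this is
`θ/4` by the definition of `η`. -/
theorem r₂_le (hn : 2 ≤ n) (hθ : 0 < θ) (hθπ : θ ≤ Real.pi) : r₂ n θ ≤ θ / 4 := by
  have h1 := pageAngle_pos hn hθ
  have h2 := pageAngle_le hn hθ
  have h3 := Real.mul_le_sin (x := pageAngle n θ / 2) (by linarith) (by linarith)
  have h4 := Real.sin_le (eta_pos hn hθ).le
  rw [r₂, div_le_iff₀ (show 0 < Real.sin (pageAngle n θ / 2) from halfSin_pos hn hθ hθπ)]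
  refine h4.trans ?_
  have h5 := mul_le_mul_of_nonneg_left h3 (by positivity : 0 ≤ θ / 4)
  refine le_trans (le_of_eq ?_) h5
  have := Real.pi_pos.ne'
  rw [eta]
  field_simp

theorem abs_faceTilt_le (hn : 2 ≤ n) (hθ : 0 < θ) (hθπ : θ ≤ Real.pi) (i : ℕ) :
    |faceTilt n θ i| ≤ eta n θ := by
  have h0 := (eta_pos hn hθ).le
  have h1 : r₂ n θ * halfSin n θ ≤ eta n θ := by
    rw [r₂_mul_halfSin hn hθ hθπ]; exact Real.sin_le h0
  have h2 : 0 ≤ r₂ n θ * halfSin n θ :=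
    mul_nonneg (r₂_nonneg hn hθ hθπ) (halfSin_pos hn hθ hθπ).le
  unfold faceTilt
  split_ifs
  · rcases shift_cases_front (n := n) (θ := θ) (i / 2 + 1) with h | h <;> rw [h]
    · simpa using h0
    · rwa [abs_of_nonneg h2]
  · rw [abs_neg]
    rcases shift_cases_back (n := n) (θ := θ) (i / 2 + 1) with h | h <;> rw [h]
    · simpa using h0
    · rwa [abs_of_nonneg h2]

theorem norm_faceSign_smul (i : ℕ) : ‖faceSign i • spineBasis n θ i 2‖ = 1 := by
  rw [norm_smul, (spineBasis n θ i).norm_eq_one, mul_one, faceSign]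
  split_ifs <;> simp

/-- The tilts do not disturb the order of the faces. Up to a positive factor the height is `sin ((i
- k) θ_n) u.1` plus two tilt terms of size at most `2η` each; the first has modulus above `(2/π)
θ_n` by Jordan's inequality and `u.1 > 1`, so it prevails. -/
theorem spine_height_pos (hn : 2 ≤ n) (hθ : 0 < θ) (hθ1 : θ ≤ 1) {i k : ℕ} (hi : i < 2 * n)
    (hk : k < 2 * n) (hik : i ≠ k) {u : ℝ × ℝ} (hu : u ∈ unitSquare) :
    0 < (if k < i then 1 else -1 : ℝ) *
      inner ℝ (spineBasis n θ k 2) (planeChart (spineBasis n θ i) 0 u) := by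
  have hπ := Real.pi_gt_three
  have hθπ : θ ≤ Real.pi := by linarith
  have hτ := pageAngle_pos hn hθ
  have hn3 := three_le_two_mul_sub_one hn
  have hmul : (2 * (n : ℝ) - 1) * pageAngle n θ = θ := mul_div_cancel₀ _ (by linarith)
  have hs : spineBasis n θ k = faceBasis (i * pageAngle n θ + ((k : ℝ) - i) * pageAngle n θ)
      (faceTilt n θ k) := by
    rw [spineBasis]; congr 1; ring
  rw [hs, spineBasis, (inner_faceBasis_planeChart _ _ _ _ u).2.2]
  set t := faceTilt n θ i
  set t' := faceTilt n θ k
  have ht : |t| ≤ eta n θ := abs_faceTilt_le hn hθ hθπ i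
  have ht' : |t'| ≤ eta n θ := abs_faceTilt_le hn hθ hθπ k
  have h1s : 1 ≤ √(1 + t ^ 2) := Real.le_sqrt_of_sq_le (by nlinarith)
  obtain ⟨w, hw⟩ : ∃ w, w = u.2 / √(1 + t ^ 2) := ⟨_, rfl⟩
  have hu2 : 0 < u.2 := by linarith [hu.2.1]
  have hw0 : 0 ≤ w := by rw [hw]; positivity
  have hw2 : w ≤ 2 := by
    rw [hw]
    exact (div_le_self hu2.le h1s).trans hu.2.2.le
  -- The definition of `η` makes `4η` equal to `(θ/π) θ_n`, and `θ ≤ 1 < 2`.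
  have heta : 4 * eta n θ < 2 / Real.pi * pageAngle n θ := by
    have : 4 * eta n θ = θ / Real.pi * pageAngle n θ := by
      rw [eta]; field_simp
    rw [this]
    refine mul_lt_mul_of_pos_right ?_ hτ
    exact div_lt_div_of_pos_right (by linarith) Real.pi_pos
  have hcos : |Real.cos (((k : ℝ) - i) * pageAngle n θ)| ≤ 1 := Real.abs_cos_le_one _
  have hb1 : |Real.cos (((k : ℝ) - i) * pageAngle n θ) * (t * w)| ≤ 2 * eta n θ := by
    rw [abs_mul, abs_mul, abs_of_nonneg hw0]
    have h1 : |t| * w ≤ eta n θ * 2 := mul_le_mul ht hw2 hw0 (eta_pos hn hθ).le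
    have h2 : 0 ≤ |t| * w := by positivity
    nlinarith [abs_nonneg (Real.cos (((k : ℝ) - i) * pageAngle n θ))]
  have hb2 : |t' * w| ≤ 2 * eta n θ := by
    rw [abs_mul, abs_of_nonneg hw0]
    have h1 : |t'| * w ≤ eta n θ * 2 := mul_le_mul ht' hw2 hw0 (eta_pos hn hθ).le
    linarith
  have hsin : ∀ m : ℝ, 1 ≤ m → m ≤ 2 * (n : ℝ) - 1 →
      2 / Real.pi * pageAngle n θ ≤ Real.sin (m * pageAngle n θ) := by
    intro m h1 h2
    have h3 : m * pageAngle n θ ≤ θ := (mul_le_mul_of_nonneg_right h2 hτ.le).trans hmul.le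
    have h4 : pageAngle n θ ≤ m * pageAngle n θ := by nlinarith
    refine le_trans ?_ (Real.mul_le_sin (by linarith) (by linarith))
    exact mul_le_mul_of_nonneg_left h4 (by positivity)
  rw [← hw]
  have hinv : 0 < (√(1 + t' ^ 2))⁻¹ := inv_pos.2 (Real.sqrt_pos.2 (by positivity))
  have hu1 := hu.1.1
  obtain ⟨l1, l2⟩ := abs_le.1 hb1
  obtain ⟨l3, l4⟩ := abs_le.1 hb2
  have hpos : 0 < 2 / Real.pi * pageAngle n θ := by positivity
  have hi' : (i : ℝ) + 1 ≤ 2 * n := by exact_mod_cast hi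
  have hk' : (k : ℝ) + 1 ≤ 2 * n := by exact_mod_cast hk
  have hi0 : (0 : ℝ) ≤ i := by positivity
  have hk0 : (0 : ℝ) ≤ k := by positivity
  split_ifs with hlt
  · have h1 : (k : ℝ) + 1 ≤ i := by exact_mod_cast hlt
    have h2 := hsin ((i : ℝ) - k) (by linarith) (by linarith)
    have h3 : Real.sin (((k : ℝ) - i) * pageAngle n θ) =
        -Real.sin (((i : ℝ) - k) * pageAngle n θ) := by
      rw [← Real.sin_neg]; congr 1; ring
    rw [h3, one_mul]
    refine mul_pos hinv ?_
    nlinarith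
  · have h1 : (i : ℝ) + 1 ≤ k := by
      have : i < k := by omega
      exact_mod_cast this
    have h2 := hsin ((k : ℝ) - i) (by linarith) (by linarith)
    rw [neg_one_mul, neg_pos]
    refine mul_neg_of_pos_of_neg hinv ?_
    nlinarith

end OpenBook
end

/-! ### Position and normals of the test squares on the surface -/

noncomputable section
namespace OpenBook

variable {n : ℕ} {θ : ℝ}

theorem frontShift_le (hn : 2 ≤ n) (hθ : 0 < θ) (hθ1 : θ ≤ 1) (k : ℕ) :
    frontShift n θ k ≤ 1 / 4 := by
  have := r₂_le hn hθ (by linarith [Real.pi_gt_three])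
  rcases shift_cases_front (n := n) (θ := θ) k with h | h <;> rw [h] <;> linarith

theorem backShift_le (hn : 2 ≤ n) (hθ : 0 < θ) (hθ1 : θ ≤ 1) (k : ℕ) :
    backShift n θ k ≤ 1 / 4 := by
  have := r₂_le hn hθ (by linarith [Real.pi_gt_three])
  rcases shift_cases_back (n := n) (θ := θ) k with h | h <;> rw [h] <;> linarith

theorem frontFace_near_spine (hn : 2 ≤ n) (hθ : 0 < θ) (hθ1 : θ ≤ 1) (j : ℕ) {p h : ℝ}
    (hp : 0 < p) (hp' : p < 1 / 4) (hh : 0 < h) (hh' : h < 1 / 4) (hph : h < 2 * p) {x : E3}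
    (hx : x = framePt ((2 * j : ℕ) * pageAngle n θ) p (-(faceTilt n θ (2 * j) * h)) h) :
    x ∈ pageCore n θ j ∧ frontForm n θ (j + 1) x = 0 ∧ 0 < backForm n θ (j + 1) x := by
  have H := pageShape hn hθ (by linarith [Real.pi_gt_three]) (j + 1)
  have ht : faceTilt n θ (2 * j) = frontShift n θ (j + 1) * halfSin n θ := by
    rw [faceTilt, if_pos (even_two_mul j), Nat.mul_div_cancel_left _ two_pos]
  have hm : midAngle n θ (j + 1) = (2 * j : ℕ) * pageAngle n θ + pageAngle n θ / 2 := by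
    unfold midAngle; push_cast; ring
  have e1 : radial (midAngle n θ (j + 1)) x =
      halfCos n θ * p - frontShift n θ (j + 1) * halfSin n θ ^ 2 * h := by
    rw [hm, radial_add, hx, radial_framePt, lateral_framePt, ht]
    simp only [halfCos, halfSin]; ring
  have e2 : lateral (midAngle n θ (j + 1)) x =
      -(halfSin n θ * p + halfCos n θ * frontShift n θ (j + 1) * halfSin n θ * h) := by
    rw [hm, lateral_add, hx, radial_framePt, lateral_framePt, ht]
    simp only [halfCos, halfSin]; ring
  have e3 : depth x = h := by rw [hx, depth_framePt]
  obtain ⟨f1, f2, f3, f4, f5⟩ := H.near_spine (frontShift_le hn hθ hθ1 _) hp hp' hh hh' hph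
  refine ⟨⟨?_, ?_, ?_, ?_, ?_⟩, ?_, ?_⟩
  · rw [gapForm_eq_left, e1, e2]; exact f3
  · rw [← neg_pos, gapForm_eq_right, e1, e2]; exact f4
  · rw [endForm, e1, e3]; exact f5
  · rw [e3]; exact hh
  · rw [e3]; linarith
  · rw [frontForm, e1, e2, e3]; exact f1
  · rw [backForm, e1, e2, e3]; exact f2

theorem backFace_near_spine (hn : 2 ≤ n) (hθ : 0 < θ) (hθ1 : θ ≤ 1) (j : ℕ) {p h : ℝ}
    (hp : 0 < p) (hp' : p < 1 / 4) (hh : 0 < h) (hh' : h < 1 / 4) (hph : h < 2 * p) {x : E3}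
    (hx : x = framePt ((2 * j + 1 : ℕ) * pageAngle n θ) p (-(faceTilt n θ (2 * j + 1) * h)) h) :
    x ∈ pageCore n θ j ∧ 0 < frontForm n θ (j + 1) x ∧ backForm n θ (j + 1) x = 0 := by
  have H := (pageShape hn hθ (by linarith [Real.pi_gt_three]) (j + 1)).symm
  have ht : faceTilt n θ (2 * j + 1) = -(backShift n θ (j + 1) * halfSin n θ) := by
    rw [faceTilt, if_neg (Nat.not_even_iff_odd.2 (odd_two_mul_add_one j)),
      show (2 * j + 1) / 2 = j by omega]
  have hm : midAngle n θ (j + 1) = (2 * j + 1 : ℕ) * pageAngle n θ + -(pageAngle n θ / 2) := by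
    unfold midAngle; push_cast; ring
  have e1 : radial (midAngle n θ (j + 1)) x =
      halfCos n θ * p - backShift n θ (j + 1) * halfSin n θ ^ 2 * h := by
    rw [hm, radial_add, hx, radial_framePt, lateral_framePt, ht, Real.cos_neg, Real.sin_neg]
    simp only [halfCos, halfSin]; ring
  have e2 : lateral (midAngle n θ (j + 1)) x =
      halfSin n θ * p + halfCos n θ * backShift n θ (j + 1) * halfSin n θ * h := by
    rw [hm, lateral_add, hx, radial_framePt, lateral_framePt, ht, Real.cos_neg, Real.sin_neg]
    simp only [halfCos, halfSin]; ring
  have e3 : depth x = h := by rw [hx, depth_framePt]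
  obtain ⟨f1, f2, f3, f4, f5⟩ := H.near_spine (backShift_le hn hθ hθ1 _) hp hp' hh hh' hph
  refine ⟨⟨?_, ?_, ?_, ?_, ?_⟩, ?_, ?_⟩
  · rw [gapForm_eq_left, e1, e2]; linarith
  · rw [← neg_pos, gapForm_eq_right, e1, e2]; linarith
  · rw [endForm, e1, e3]; exact f5
  · rw [e3]; exact hh
  · rw [e3]; linarith
  · rw [frontForm, e1, e2, e3]; linarith
  · rw [backForm, e1, e2, e3]; linarith

theorem testFaces (hn : 2 ≤ n) (hθ : 0 < θ) (hθ1 : θ ≤ 1) :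
    TestFaces (surface n θ) (polyhedron n θ) (2 * n) (spineBasis n θ) faceSign := by
  have hθπ : θ ≤ Real.pi := by linarith [Real.pi_gt_three]
  have key : ∀ i < 2 * n, ∀ δ : ℝ, 0 < δ → δ ≤ 1 / 8 → ∀ u ∈ unitSquare,
      planeChart (spineBasis n θ i) 0 (δ • u) ∈ surface n θ ∧
      outwardNormal (polyhedron n θ) (planeChart (spineBasis n θ i) 0 (δ • u)) =
        faceSign i • spineBasis n θ i 2 := by
    intro i hi δ hδ hδ' u hu
    have hx := planeChart_faceBasis (i * pageAngle n θ) (faceTilt n θ i) (δ • u)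
    change planeChart (spineBasis n θ i) 0 (δ • u) = _ at hx
    set x := planeChart (spineBasis n θ i) 0 (δ • u)
    have hs1 : 1 ≤ √(1 + faceTilt n θ i ^ 2) := Real.le_sqrt_of_sq_le (by nlinarith)
    have hs0 : 0 < √(1 + faceTilt n θ i ^ 2) := by linarith
    obtain ⟨⟨hu1, hu1'⟩, hu2, hu2'⟩ := hu
    simp only [Prod.smul_fst, Prod.smul_snd, smul_eq_mul] at hx
    set h := δ * u.2 / √(1 + faceTilt n θ i ^ 2) with hh
    have h0 : 0 < h := div_pos (mul_pos hδ (by linarith)) hs0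
    have hle : h ≤ δ * u.2 := div_le_self (mul_pos hδ (by linarith)).le hs1
    have hp0 : 0 < δ * u.1 := mul_pos hδ (by linarith)
    -- The bounds `δ ≤ 1/8` and `u < 2` give `1/4`; and `h ≤ δ u.2 < 2δ < 2δ u.1` keeps the square
    -- in the part of the page where the face is not cut off by its neighbour.
    have hp4 : δ * u.1 < 1 / 4 := by nlinarith
    have hh4 : h < 1 / 4 := by nlinarith
    have hph : h < 2 * (δ * u.1) := by nlinarith
    have hN := norm_faceSign_smul (n := n) (θ := θ) i
    have hinner : ∀ y, inner ℝ (faceSign i • spineBasis n θ i 2) y =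
        faceSign i * ((√(1 + faceTilt n θ i ^ 2))⁻¹ *
          (lateral (i * pageAngle n θ) y + faceTilt n θ i * depth y)) := fun y => by
      rw [real_inner_smul_left, spineBasis, inner_faceBasis_two]
    rcases Nat.even_or_odd' i with ⟨j, rfl | rfl⟩
    · obtain ⟨c1, c2, c3⟩ := frontFace_near_spine hn hθ hθ1 j hp0 hp4 h0 hh4 hph hx
      refine ⟨mem_surface_iff.2 ⟨j + 1, by omega, by omega, ?_⟩, ?_⟩
      · rw [mem_pageBoundary_iff hn hθ hθπ (by omega)]
        exact ⟨mem_page_of_mem_pageCore c1 c2.ge c3.le, Or.inl c2⟩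
      · refine outwardNormal_front hn hθ hθπ (by omega) c1 c2 c3 hN (inv_pos.2 hs0) fun y => ?_
        rw [hinner, frontForm_eq_tilt, faceSign, if_pos (even_two_mul j)]
        ring
    · obtain ⟨c1, c2, c3⟩ := backFace_near_spine hn hθ hθ1 j hp0 hp4 h0 hh4 hph hx
      refine ⟨mem_surface_iff.2 ⟨j + 1, by omega, by omega, ?_⟩, ?_⟩
      · rw [mem_pageBoundary_iff hn hθ hθπ (by omega)]
        exact ⟨mem_page_of_mem_pageCore c1 c2.le c3.ge, Or.inr (Or.inr (Or.inl c3))⟩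
      · refine outwardNormal_back hn hθ hθπ (by omega) c1 c2 c3 hN (inv_pos.2 hs0) fun y => ?_
        rw [hinner, backForm_eq_tilt, faceSign,
          if_neg (Nat.not_even_iff_odd.2 (odd_two_mul_add_one j))]
        ring
  refine ⟨fun i hi δ h1 h2 u hu => (key i hi δ h1 h2 u hu).1,
    fun i hi δ h1 h2 u hu => (key i hi δ h1 h2 u hu).2, fun i hi k hk hik u hu h0 => ?_⟩
  have := spine_height_pos hn hθ hθ1 hi hk hik hu
  rw [h0, mul_zero] at this
  exact lt_irrefl _ this

/-! ### The limit of vanishing opening angle -/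

theorem tendsto_pageAngle (n : ℕ) : Tendsto (pageAngle n) (𝓝[>] 0) (𝓝 0) := by
  have h : Continuous (pageAngle n) := by unfold pageAngle; fun_prop
  exact (h.tendsto' 0 0 (by simp [pageAngle])).mono_left nhdsWithin_le_nhds

theorem eventually_mem_Ioc_one : ∀ᶠ θ : ℝ in 𝓝[>] 0, 0 < θ ∧ θ ≤ 1 := by
  filter_upwards [Ioc_mem_nhdsGT (zero_lt_one' ℝ)] with θ hθ using hθ

theorem tendsto_faceTilt (hn : 2 ≤ n) (i : ℕ) :
    Tendsto (fun θ => faceTilt n θ i) (𝓝[>] 0) (𝓝 0) := by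
  have h : Continuous (eta n) := by unfold eta pageAngle; fun_prop
  have h1 : Tendsto (eta n) (𝓝[>] 0) (𝓝 0) :=
    (h.tendsto' 0 0 (by simp [eta])).mono_left nhdsWithin_le_nhds
  refine squeeze_zero_norm' ?_ h1
  filter_upwards [eventually_mem_Ioc_one] with θ hθ
  exact abs_faceTilt_le hn hθ.1 (by linarith [Real.pi_gt_three]) i

/-- Face `i` is on the positive side of the frame normal of face `k` exactly when `k < i`, and
`faceSign k` turns this normal outwards; the product of the two signs is `alternatingSign`. -/
theorem tendsto_faceSign_mul_faceEntry (hn : 2 ≤ n) {i k : ℕ} (hi : i < 2 * n) (hk : k < 2 * n) :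
    Tendsto (fun θ => faceSign k * faceEntry (spineBasis n θ i) (spineBasis n θ k)) (𝓝[>] 0)
      (𝓝 (Hilb.alternatingSign i k / 2)) := by
  by_cases hik : i = k
  · subst hik
    simp [faceEntry_self, Hilb.alternatingSign]
  have hs : ∀ θ, spineBasis n θ k = faceBasis (i * pageAngle n θ + ((k : ℝ) - i) * pageAngle n θ)
      (faceTilt n θ k) := fun θ => by
    rw [spineBasis]; congr 1; ring
  have h1 : Tendsto (fun θ => ((k : ℝ) - i) * pageAngle n θ) (𝓝[>] 0) (𝓝 0) := by
    simpa using (tendsto_pageAngle n).const_mul ((k : ℝ) - i)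
  have key := tendsto_faceEntry (α := fun θ => i * pageAngle n θ) h1 (tendsto_faceTilt hn i)
    (tendsto_faceTilt hn k) (s := if k < i then 1 else -1) (by split_ifs <;> simp) (by
      filter_upwards [eventually_mem_Ioc_one] with θ hθ u hu
      have := spine_height_pos hn hθ.1 hθ.2 hi hk hik hu
      rwa [hs θ] at this)
  have h2 := key.const_mul (faceSign k)
  have h3 : faceSign k * ((if k < i then 1 else -1 : ℝ) / 2) = Hilb.alternatingSign i k / 2 := by
    unfold faceSign Hilb.alternatingSign
    rw [if_neg hik]
    by_cases h4 : Even k <;> by_cases h5 : k < i <;> simp [h4, h5] <;> norm_num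
  rw [h3] at h2
  refine h2.congr fun θ => ?_
  rw [hs θ]
  rfl

theorem exists_convexHull_subset_weakRange (hn : 2 ≤ n) {ε : ℝ} (hε : 0 < ε) :
    ∃ θ₀ : ℝ, 0 < θ₀ ∧ θ₀ ≤ Real.pi ∧ ∀ θ : ℝ, 0 < θ → θ ≤ θ₀ →
      ∀ D : L2 n θ →L[ℂ] L2 n θ, IsDoubleLayer n θ D →
        convexHull ℝ
            ((fun t : ℝ => (t : ℂ)) '' Set.Icc (-(√(n : ℝ) / 2) + ε) (√(n : ℝ) / 2 - ε) ∪
              {l : ℂ | ‖l‖ ≤ √((n : ℝ) - 1) / 2 - ε}) ⊆ Hilb.weakRange D := by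
  have hn0 : (0 : ℝ) < n := by positivity
  -- The total error `(2n)² ρ` of the quadratic form becomes `ε/2`. Finitely many entries allow a
  -- common bound for `θ`.
  set ρ : ℝ := ε / 2 / (2 * n) ^ 2 with hρ
  have hρ0 : 0 < ρ := by positivity
  have hev : ∀ᶠ θ in 𝓝[>] (0 : ℝ), ∀ i ∈ Finset.range (2 * n), ∀ k ∈ Finset.range (2 * n),
      |faceSign k * faceEntry (spineBasis n θ i) (spineBasis n θ k) -
        Hilb.alternatingSign i k / 2| < ρ := by
    rw [Filter.eventually_all_finset]
    intro i hi
    rw [Filter.eventually_all_finset]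
    intro k hk
    exact (tendsto_faceSign_mul_faceEntry hn (Finset.mem_range.1 hi) (Finset.mem_range.1 hk)).eventually
      (Metric.ball_mem_nhds _ hρ0)
  obtain ⟨t, ht0, ht⟩ := mem_nhdsGT_iff_exists_Ioc_subset.1 (hev.and eventually_mem_Ioc_one)
  have ht0 : 0 < t := ht0
  have htt := ht ⟨ht0, le_rfl⟩
  refine ⟨t, ht0, by linarith [htt.2.2, Real.pi_gt_three], fun θ hθ0 hθt D hD => ?_⟩
  obtain ⟨h1, -, hθ1⟩ := ht ⟨hθ0, hθt⟩
  have := isFiniteMeasure_surfaceMeasure hn hθ0 (by linarith [Real.pi_gt_three])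
  obtain ⟨e, he, ha⟩ := (testFaces hn hθ0 hθ1).exists_orthonormal
    (μ := surfaceMeasure n θ) rfl (D := D) fun φ => (hD φ).mono fun _ h => h.2
  refine Hilb.convexHull_subset_weakRange hn (ρ := ρ) ?_ he
    (a := fun i k => ((faceSign k * faceEntry (spineBasis n θ i) (spineBasis n θ k) : ℝ) : ℂ))
    ha fun i hi k hk => ?_
  · rw [hρ, mul_div_cancel₀ _ (by positivity)]
  · have h2 := (h1 i (Finset.mem_range.2 hi) k (Finset.mem_range.2 hk)).le
    rw [← Complex.ofReal_ofNat, ← Complex.ofReal_div, ← Complex.ofReal_sub, Complex.norm_real]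
    exact h2

end OpenBook
end

/-! ### The theorem -/

theorem theorem1p3 (n : ℕ) (hn : 2 ≤ n) :
    ∃ D D' : ∀ θ : ℝ, OpenBook.L2 n θ →L[ℂ] OpenBook.L2 n θ,
      (∀ θ : ℝ, 0 < θ → θ ≤ Real.pi →
        OpenBook.IsDoubleLayer n θ (D θ) ∧ OpenBook.IsAdjointDoubleLayer n θ (D' θ)) ∧
      (∀ ε : ℝ, 0 < ε → ∃ θ₀ : ℝ, 0 < θ₀ ∧ θ₀ ≤ Real.pi ∧ ∀ θ : ℝ, 0 < θ → θ ≤ θ₀ →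
        convexHull ℝ
            ((fun t : ℝ => (t : ℂ)) '' Set.Icc (-(√(n : ℝ) / 2) + ε) (√(n : ℝ) / 2 - ε) ∪
              {l : ℂ | ‖l‖ ≤ √((n : ℝ) - 1) / 2 - ε}) ⊆ Hilb.essNumericalRange (D θ) ∧
          Hilb.essNumericalRadius (D θ) ≤ Hilb.essNorm (D θ) ∧
          √(n : ℝ) / 2 - ε ≤ Hilb.essNumericalRadius (D θ)) ∧
      ∃ θ₁ : ℝ, 0 < θ₁ ∧ θ₁ ≤ Real.pi ∧ ∀ θ : ℝ, 0 < θ → θ ≤ θ₁ →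
        ∀ T ∈ ({D θ, -D θ, D' θ, -D' θ} : Set (OpenBook.L2 n θ →L[ℂ] OpenBook.L2 n θ)),
          ¬ Hilb.CoercivePlusCompact ((1 / 2 : ℂ) • ContinuousLinearMap.id ℂ _ + T) ∧
          ∀ K : OpenBook.L2 n θ →L[ℂ] OpenBook.L2 n θ, IsCompactOperator K →
            ∃ V : ℕ → Submodule ℂ (OpenBook.L2 n θ), Hilb.AsymptoticallyDense V ∧
              ¬ Hilb.GalerkinConverges
                ((1 / 2 : ℂ) • ContinuousLinearMap.id ℂ _ + T + K) V := by
  have hroot : (1.4 : ℝ) ≤ √(n : ℝ) := by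
    refine Real.le_sqrt_of_sq_le ?_
    have : (2 : ℝ) ≤ n := by exact_mod_cast hn
    norm_num
    linarith
  have hex : ∀ θ : ℝ, ∃ D D' : OpenBook.L2 n θ →L[ℂ] OpenBook.L2 n θ, 0 < θ → θ ≤ Real.pi →
      OpenBook.IsDoubleLayer n θ D ∧ OpenBook.IsAdjointDoubleLayer n θ D' ∧ D' = D.adjoint := by
    intro θ
    by_cases h : 0 < θ ∧ θ ≤ Real.pi
    · obtain ⟨D, D', h'⟩ := OpenBook.exists_doubleLayer hn h.1 h.2
      exact ⟨D, D', fun _ _ => h'⟩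
    -- Outside `(0, π]` nothing is claimed, and zero operators serve as default values.
    · exact ⟨0, 0, fun h1 h2 => absurd ⟨h1, h2⟩ h⟩
  choose D D' hD using hex
  refine ⟨D, D', fun θ h1 h2 => ⟨(hD θ h1 h2).1, (hD θ h1 h2).2.1⟩, fun ε hε => ?_, ?_⟩
  -- A large `ε` would make the segment empty. Capping it at `1/10` keeps the end point `√n/2 - ε`
  -- available and positive, and a smaller `ε` only strengthens the claim.
  · have hε' : 0 < min ε (1 / 10) := lt_min hε (by norm_num)
    obtain ⟨θ₀, h0, h0π, hsub⟩ := OpenBook.exists_convexHull_subset_weakRange hn hε'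
    refine ⟨θ₀, h0, h0π, fun θ hθ hθ₀ => ?_⟩
    have hsub' := (hsub θ hθ hθ₀ (D θ) (hD θ hθ (hθ₀.trans h0π)).1).trans
      (Hilb.weakRange_subset_essNumericalRange (D θ))
    have hle := min_le_left ε (1 / 10)
    have hle' := min_le_right ε (1 / 10)
    refine ⟨(convexHull_mono (union_subset_union (image_mono (Icc_subset_Icc (by linarith)
      (by linarith))) fun l hl => ?_)).trans hsub', Hilb.essNumericalRadius_le_essNorm _, ?_⟩
    · change ‖l‖ ≤ _ at hl
      change ‖l‖ ≤ _
      linarith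
    · have hmem : ((√(n : ℝ) / 2 - min ε (1 / 10) : ℝ) : ℂ) ∈ Hilb.essNumericalRange (D θ) :=
        hsub' (subset_convexHull ℝ _ (Or.inl ⟨_, ⟨by linarith, le_rfl⟩, rfl⟩))
      have h1 := Hilb.norm_le_essNumericalRadius hmem
      rw [Complex.norm_real, Real.norm_of_nonneg (by linarith)] at h1
      linarith
  -- Since `1.4/2 - 1/10 = 0.6`, the segment contains `[-1/2, 1/2]`.
  · obtain ⟨θ₁, h0, h0π, hsub⟩ := OpenBook.exists_convexHull_subset_weakRange hn
      (ε := 1 / 10) (by norm_num)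
    refine ⟨θ₁, h0, h0π, fun θ hθ hθ₁ T hT => ?_⟩
    obtain ⟨hDθ, -, hadj⟩ := hD θ hθ (hθ₁.trans h0π)
    have hsub' := hsub θ hθ hθ₁ (D θ) hDθ
    have hmem : ∀ t : ℝ, |t| ≤ 1 / 2 → (t : ℂ) ∈ Hilb.weakRange (D θ) := fun t ht => by
      obtain ⟨h1, h2⟩ := abs_le.1 ht
      exact hsub' (subset_convexHull ℝ _ (Or.inl ⟨t, ⟨by linarith, by linarith⟩, rfl⟩))
    have hmem' : ∀ t : ℝ, |t| ≤ 1 / 2 → (t : ℂ) ∈ Hilb.weakRange (D' θ) := fun t ht => by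
      have := Hilb.conj_mem_weakRange_adjoint (hmem t ht)
      rwa [Complex.conj_ofReal, ← hadj] at this
    -- For all four operators it is `-1/2` that cancels the identity term; symmetry of the segment
    -- covers the signs, and conjugation fixes real points and so covers the adjoint.
    have hT' : ((-(1 / 2) : ℝ) : ℂ) ∈ Hilb.weakRange T := by
      have hneg : ((-(1 / 2) : ℝ) : ℂ) = -((1 / 2 : ℝ) : ℂ) := by push_cast; ring
      have h1 : |(1 / 2 : ℝ)| ≤ 1 / 2 := (abs_of_pos one_half_pos).le
      have h2 : |(-(1 / 2) : ℝ)| ≤ 1 / 2 := by rw [abs_neg]; exact h1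
      rcases hT with rfl | rfl | rfl | rfl
      · exact hmem _ h2
      · rw [hneg]; exact Hilb.neg_mem_weakRange (hmem _ h1)
      · exact hmem' _ h2
      · rw [hneg]; exact Hilb.neg_mem_weakRange (hmem' _ h1)
    have hzero : (0 : ℂ) ∈ Hilb.weakRange ((1 / 2 : ℂ) • ContinuousLinearMap.id ℂ _ + T) := by
      have := Hilb.add_mem_weakRange_smul_id_add (1 / 2) hT'
      convert this using 1
      push_cast
      ring
    have := OpenBook.isFiniteMeasure_surfaceMeasure hn hθ (hθ₁.trans h0π)
    have : Fact ((2 : ENNReal) ≠ ⊤) := ⟨by finiteness⟩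
    exact ⟨Hilb.not_coercivePlusCompact_of_zero_mem hzero, fun K hK =>
      Hilb.exists_not_galerkinConverges (Hilb.weakRange_subset_add_compact _ hK hzero)⟩
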